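/- Let $A=(a_{ij})$ be a complex upper-triangular $5\times5$ matrix with diagonal entries $\lambda_j=\alpha_j+i\beta_j$ ($\alpha_j,\beta_j\in\mathbb R$, $j=1,\dots,5$), let $(p,q,w,t,v)$ be a permutation of $(1,2,3,4,5)$, and let $r>0$. Let $p_A(x,y,z)=\det(x\,\Re A+y\,\Im A+zI_5)$ with $\Re A=(A+A^*)/2$, $\Im A=(A-A^*)/2i$. Let $C(A)\subset\mathbb{CP}^2$ be the dual of the curve $p_A=0$, that is, the union of the dual curves of its irreducible components (the dual of a component is the Zariski closure of the set of its tangent lines at smooth points, the line $\{(X,Y,Z): xX+yY+zZ=0\}$ having coordinates $(x,y,z)$; the dual of a line is a point). Let $C_{\mathbb R}(A)=\{X+iY : X,Y\in\mathbb R,\ (X,Y,1)\in C(A)\}\subset\mathbb C$. A curve of degree $4$ with a double tangent is an infinite set $S\subset\mathbb C=\mathbb R^2$ which is the set of all real affine points of an irreducible complex algebraic curve $\Gamma\subset\mathbb{CP}^2$ of degree $4$, such that some line is tangent to $\Gamma$ at two distinct real smooth points. Its foci are the points $\lambda\in\mathbb C$ such that both isotropic lines $X+iY=\lambda Z$ and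 $X-iY=\overline\lambda Z$ belong to the dual curve of $\Gamma$. For $\theta,\mu\in\mathbb R$ put $\mu_j=\Re(e^{-i\theta}\lambda_j)+\mu$ ($j=1,\dots,5$), and $$m_2=\mu_t\mu_v+\mu_w\mu_v+\mu_w\mu_t,\quad m_3=\mu_w\mu_t\mu_v,\quad \sigma(x)=x_w\mu_t\mu_v+x_t\mu_w\mu_v+x_v\mu_w\mu_t .$$ Put $c_{klm}=a_{kl}a_{lm}\overline{a_{km}}$, $d_{jklm}=a_{jk}a_{kl}a_{lm}\overline{a_{jm}}$, $e_5=a_{12}a_{23}a_{34}a_{45}\overline{a_{15}}$. In every sum below the indices run over $\{1,\dots,5\}$; they are pairwise distinct, and $S_{i_1\dots i_n}$ means $i_1<\dots<i_n$ (all the conditions listed under one sum hold simultaneously). Let $$U=\sum_{S_{ijkl}S_{iml}}a_{ij}a_{jk}a_{kl}\overline{a_{im}}\,\overline{a_{ml}},\qquad V=\sum_{S_{ijk}S_{lm}S_{im}S_{lk}}a_{ij}a_{jk}a_{lm}\overline{a_{im}}\,\overline{a_{lk}},$$ $$P_i=\sum_{S_{jkm}S_{lm}}|a_{jk}|^2|a_{lm}|^2-\sum_{S_{jkl}S_{jml}}\Re(a_{jk}a_{kl}\overline{a_{jm}}\,\overline{a_{ml}})-\sum_{S_{jk}S_{lkm}}\Re(a_{jk}a_{lm}\overline{a_{jm}}\,\overline{a_{lk}}),$$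 where in $P_i$ the indices $j,k,l,m$ are also different from $i$. Then $C_{\mathbb R}(A)$ is the union of the ellipse with foci $\lambda_p,\lambda_q$ and minor axis of length $r$ and of a curve of degree $4$ with a double tangent whose set of foci is $\{\lambda_w,\lambda_t,\lambda_v\}$ if and only if there exist $\theta\in[0,2\pi)$ and $\mu\in\mathbb R$ such that all of the following hold: (a) $r^2+4m_2=\sum_{S_{lm}}|a_{lm}|^2$; (b) $r^2(\lambda_w+\lambda_t+\lambda_v)+4[\sigma(\lambda)-2m_3e^{i\theta}+(\lambda_p+\lambda_q)m_2]=\sum_{S_{ijk}S_{lm}}|a_{lm}|^2(\lambda_i+\lambda_j+\lambda_k)-\sum_{S_{klm}}c_{klm}$; (c) $r^2(\lambda_w\lambda_t+\lambda_t\lambda_v+\lambda_w\lambda_v)+4[\lambda_p\lambda_q m_2+(\lambda_p+\lambda_q)(\sigma(\lambda)-2m_3e^{i\theta})]=\sum_{S_{ijk}S_{lm}}|a_{lm}|^2(\lambda_i\lambda_j+\lambda_i\lambda_k+\lambda_j\lambda_k)-\sum_{S_{ij}S_{klm}}(\lambda_i+\lambda_j)c_{klm}+\sum_{S_{jklm}}d_{jklm}$;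 (d) $r^2\lambda_w\lambda_t\lambda_v+4\lambda_p\lambda_q(\sigma(\lambda)-2m_3e^{i\theta})=\sum_{S_{ijk}S_{lm}}|a_{lm}|^2\lambda_i\lambda_j\lambda_k-\sum_{S_{ij}S_{klm}}\lambda_i\lambda_jc_{klm}+\sum_{S_iS_{jklm}}\lambda_id_{jklm}-e_5$; (e) $r^2[\alpha_w\alpha_t\alpha_v-\sigma(\alpha)+2m_3\cos\theta]+4\alpha_p\alpha_q[\sigma(\alpha)-2m_3\cos\theta]=\sum_{S_{ijk}S_{lm}}|a_{lm}|^2\alpha_i\alpha_j\alpha_k-\sum_{S_{ij}S_{klm}}\Re(c_{klm})\alpha_i\alpha_j-\frac14\sum_{i=1}^5P_i\alpha_i+\frac12\sum_{S_iS_{jklm}}\Re(d_{jklm})\alpha_i+\frac14\sum_{S_{ij}S_{klm}}\Re(c_{klm})|a_{ij}|^2-\frac14\Re U-\frac14\Re V-\frac14\Re e_5$; (f) $r^2[\beta_w\beta_t\beta_v-\sigma(\beta)+2m_3\sin\theta]+4\beta_p\beta_q[\sigma(\beta)-2m_3\sin\theta]=\sum_{S_{ijk}S_{lm}}|a_{lm}|^2\beta_i\beta_j\beta_k-\sum_{S_{ij}S_{klm}}\Im(c_{klm})\beta_i\beta_j-\frac14\sum_{i=1}^5P_i\beta_i-\frac12\sum_{S_iS_{jklm}}\Re(d_{jklm})\beta_i+\frac14\sum_{S_{ij}S_{klm}}\Im(c_{klm})|a_{ij}|^2-\frac14\Im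 U-\frac14\Im V+\frac14\Im e_5$; (g) $r^2[\alpha_t\alpha_v+\alpha_w\alpha_v+\alpha_w\alpha_t-m_2]+4\alpha_p\alpha_qm_2+4(\alpha_p+\alpha_q)[\sigma(\alpha)-2m_3\cos\theta]=\sum_{S_{ijk}S_{lm}}|a_{lm}|^2(\alpha_i\alpha_j+\alpha_i\alpha_k+\alpha_j\alpha_k)-\sum_{S_{ij}S_{klm}}\Re(c_{klm})(\alpha_i+\alpha_j)-\frac14\sum_{i=1}^5P_i+\frac12\sum_{S_{jklm}}\Re(d_{jklm})$; (h) $\mu_w\mu_t\mu_v\neq0$; (i) $\lambda_j\mu_k+\lambda_k\mu_j-2\mu_j\mu_ke^{i\theta}\neq\lambda_i(\mu_k+\mu_j)$ for all pairwise distinct $i,j,k\in\{w,t,v\}$. -/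

import Mathlib

noncomputable section

namespace Kippenhahn

open MvPolynomial

/-! ### Plane algebraic curves and their duals

Points and lines of the complex projective plane are given by homogeneous coordinates, that is,
by nonzero vectors of `Fin 3 → ℂ`; the line with coordinates `(x, y, z)` consists of the points
`(X, Y, Z)` with `x X + y Y + z Z = 0`. The affine point `X + i Y` of the real plane `ℂ = ℝ²` has
homogeneous coordinates `(X, Y, 1)`. -/

/-- The gradient of the polynomial `f` at `P`. If `P` is a point of the curve `f = 0` and the
gradient is nonzero there, then `P` is a smooth point and the gradient is its tangent line. -/
def grad (f : MvPolynomial (Fin 3) ℂ) (P : Fin 3 → ℂ) : Fin 3 → ℂ :=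
  fun i => eval P (pderiv i f)

/-- The dual of the curve `f = 0` (for irreducible homogeneous `f`): the Zariski closure, in the
projective plane, of the set of the tangent lines at smooth points. It is described
by its homogeneous coordinate vectors. -/
def dualCurve (f : MvPolynomial (Fin 3) ℂ) : Set (Fin 3 → ℂ) :=
  {u | u ≠ 0 ∧ ∀ (d : ℕ) (G : MvPolynomial (Fin 3) ℂ), G.IsHomogeneous d →
    (∀ P : Fin 3 → ℂ, P ≠ 0 → eval P f = 0 → grad f P ≠ 0 → eval (grad f P) G = 0) →
    eval u G = 0}

/-- Homogeneous coordinates of the point `ζ` of the real affine plane `ℂ = ℝ²`. -/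
def homCoord (ζ : ℂ) : Fin 3 → ℂ := ![(ζ.re : ℂ), (ζ.im : ℂ), 1]

/-- The point `a` is a focus of the curve `g = 0`: both isotropic lines through it,
`X + i Y = a` and `X - i Y = conj a`, are tangent to the curve (belong to its dual). -/
def IsFocus (g : MvPolynomial (Fin 3) ℂ) (a : ℂ) : Prop :=
  (![1, Complex.I, -a] : Fin 3 → ℂ) ∈ dualCurve g ∧
    (![1, -Complex.I, -(starRingEnd ℂ a)] : Fin 3 → ℂ) ∈ dualCurve g

/-- Some line is tangent to the real part of the curve `g = 0` at two distinct smooth points. -/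
def HasDoubleTangent (g : MvPolynomial (Fin 3) ℂ) : Prop :=
  ∃ ζ₁ ζ₂ : ℂ, ζ₁ ≠ ζ₂ ∧ eval (homCoord ζ₁) g = 0 ∧ eval (homCoord ζ₂) g = 0 ∧
    grad g (homCoord ζ₁) ≠ 0 ∧
    ∃ c : ℂ, c ≠ 0 ∧ grad g (homCoord ζ₂) = c • grad g (homCoord ζ₁)

/-- `S` is a real plane curve of degree `4` with a double tangent and with set of foci `F`:
the real part, assumed infinite, of an irreducible complex quartic with these properties. -/
def IsQuarticWithDoubleTangent (S F : Set ℂ) : Prop :=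
  ∃ g : MvPolynomial (Fin 3) ℂ, Irreducible g ∧ g.IsHomogeneous 4 ∧
    S = {ζ | eval (homCoord ζ) g = 0} ∧ S.Infinite ∧ HasDoubleTangent g ∧ {a | IsFocus g a} = F

/-- The ellipse with foci `a`, `b` and minor axis of (full) length `r > 0`; its major axis has
length `√(|a - b|² + r²)`. -/
def ellipse (a b : ℂ) (r : ℝ) : Set ℂ :=
  {ζ | ‖ζ - a‖ + ‖ζ - b‖ = Real.sqrt (‖a - b‖ ^ 2 + r ^ 2)}

/-! ### The Kippenhahn curve of a matrix -/

/-- The real part `(A + A*) / 2`. -/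
def reMat {n : ℕ} (A : Matrix (Fin n) (Fin n) ℂ) : Matrix (Fin n) (Fin n) ℂ :=
  (1 / 2 : ℂ) • (A + A.conjTranspose)

/-- The imaginary part `(A - A*) / (2 i)`. -/
def imMat {n : ℕ} (A : Matrix (Fin n) (Fin n) ℂ) : Matrix (Fin n) (Fin n) ℂ :=
  (1 / (2 * Complex.I)) • (A - A.conjTranspose)

/-- The Kippenhahn polynomial `det (x Re A + y Im A + z I)`, with `x, y, z = X 0, X 1, X 2`. -/
def kippenhahnPoly {n : ℕ} (A : Matrix (Fin n) (Fin n) ℂ) : MvPolynomial (Fin 3) ℂ :=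
  Matrix.det ((X 0 : MvPolynomial (Fin 3) ℂ) • (reMat A).map (C : ℂ → MvPolynomial (Fin 3) ℂ) +
    (X 1 : MvPolynomial (Fin 3) ℂ) • (imMat A).map (C : ℂ → MvPolynomial (Fin 3) ℂ) +
    (X 2 : MvPolynomial (Fin 3) ℂ) • (1 : Matrix (Fin n) (Fin n) (MvPolynomial (Fin 3) ℂ)))

/-- `C(A)`: the dual of the curve `p_A = 0`, i.e. the union of the duals of its irreducible
components (the dual of a line being a point). -/
def kippenhahnCurve {n : ℕ} (A : Matrix (Fin n) (Fin n) ℂ) : Set (Fin 3 → ℂ) :=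
  {u | ∃ f : MvPolynomial (Fin 3) ℂ, Irreducible f ∧ f ∣ kippenhahnPoly A ∧ u ∈ dualCurve f}

/-- `C_R(A)`: the real points of `C(A)`, as a subset of `ℂ = ℝ²`. -/
def realKippenhahnCurve {n : ℕ} (A : Matrix (Fin n) (Fin n) ℂ) : Set ℂ :=
  {ζ | homCoord ζ ∈ kippenhahnCurve A}

/-! ### Sums over increasing tuples of indices (indices `1, …, 5` are `0, …, 4` here) -/

/-- `∑ F i j k l m` over the pairwise distinct `i, j, k, l, m` that satisfy `R`. -/
def dsum {M : Type*} [AddCommMonoid M]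
    (R : Fin 5 → Fin 5 → Fin 5 → Fin 5 → Fin 5 → Prop)
    [∀ i j k l m, Decidable (R i j k l m)]
    (F : Fin 5 → Fin 5 → Fin 5 → Fin 5 → Fin 5 → M) : M :=
  ∑ i, ∑ j, ∑ k, ∑ l, ∑ m,
    if [i, j, k, l, m].Nodup ∧ R i j k l m then F i j k l m else 0

/-- The sum over `i < j < k`, `l < m`, with `i, j, k, l, m` pairwise distinct. -/
def sum32 {M : Type*} [AddCommMonoid M]
    (F : Fin 5 → Fin 5 → Fin 5 → Fin 5 → Fin 5 → M) : M :=
  dsum (fun i j k l m => (i < j ∧ j < k) ∧ l < m) F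

/-- The sum over `i < j`, `k < l < m`, with `i, j, k, l, m` pairwise distinct. -/
def sum23 {M : Type*} [AddCommMonoid M]
    (F : Fin 5 → Fin 5 → Fin 5 → Fin 5 → Fin 5 → M) : M :=
  dsum (fun i j k l m => i < j ∧ (k < l ∧ l < m)) F

/-- The sum over `i` and `j < k < l < m`, with `i, j, k, l, m` pairwise distinct. -/
def sum14 {M : Type*} [AddCommMonoid M]
    (F : Fin 5 → Fin 5 → Fin 5 → Fin 5 → Fin 5 → M) : M :=
  dsum (fun _ j k l m => j < k ∧ k < l ∧ l < m) F

/-- The sum over `l < m`. -/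
def sum2 {M : Type*} [AddCommMonoid M] (F : Fin 5 → Fin 5 → M) : M :=
  ∑ l, ∑ m, if l < m then F l m else 0

/-- The sum over `k < l < m`. -/
def sum3 {M : Type*} [AddCommMonoid M] (F : Fin 5 → Fin 5 → Fin 5 → M) : M :=
  ∑ k, ∑ l, ∑ m, if k < l ∧ l < m then F k l m else 0

/-- The sum over `j < k < l < m`. -/
def sum4 {M : Type*} [AddCommMonoid M] (F : Fin 5 → Fin 5 → Fin 5 → Fin 5 → M) : M :=
  ∑ j, ∑ k, ∑ l, ∑ m, if j < k ∧ k < l ∧ l < m then F j k l m else 0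

/-- `a_kl a_lm conj(a_km)`. -/
def cyc3 (A : Matrix (Fin 5) (Fin 5) ℂ) (k l m : Fin 5) : ℂ :=
  A k l * A l m * starRingEnd ℂ (A k m)

/-- `a_jk a_kl a_lm conj(a_jm)`. -/
def cyc4 (A : Matrix (Fin 5) (Fin 5) ℂ) (j k l m : Fin 5) : ℂ :=
  A j k * A k l * A l m * starRingEnd ℂ (A j m)

/-- `a_12 a_23 a_34 a_45 conj(a_15)`. -/
def cyc5 (A : Matrix (Fin 5) (Fin 5) ℂ) : ℂ :=
  A 0 1 * A 1 2 * A 2 3 * A 3 4 * starRingEnd ℂ (A 0 4)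

/-- The sum of `a_ij a_jk a_kl conj(a_im) conj(a_ml)` over `i < j < k < l`, `i < m < l`. -/
def cycU (A : Matrix (Fin 5) (Fin 5) ℂ) : ℂ :=
  dsum (fun i j k l m => (i < j ∧ j < k ∧ k < l) ∧ (i < m ∧ m < l))
    (fun i j k l m => A i j * A j k * A k l * starRingEnd ℂ (A i m) * starRingEnd ℂ (A m l))

/-- The sum of `a_ij a_jk a_lm conj(a_im) conj(a_lk)` over `i < j < k`, `l < m`, `i < m`,
`l < k`. -/
def cycV (A : Matrix (Fin 5) (Fin 5) ℂ) : ℂ :=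
  dsum (fun i j k l m => (i < j ∧ j < k) ∧ l < m ∧ i < m ∧ l < k)
    (fun i j k l m => A i j * A j k * A l m * starRingEnd ℂ (A i m) * starRingEnd ℂ (A l k))

/-- `P_i`; in all three sums `j, k, l, m` are distinct from each other and from `i`. -/
def Pcoef (A : Matrix (Fin 5) (Fin 5) ℂ) (i : Fin 5) : ℝ :=
  dsum (fun i' j k l m => i' = i ∧ (j < k ∧ k < m) ∧ l < m)
      (fun _ j k l m => ‖A j k‖ ^ 2 * ‖A l m‖ ^ 2)
    - dsum (fun i' j k l m => i' = i ∧ (j < k ∧ k < l) ∧ (j < m ∧ m < l))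
      (fun _ j k l m =>
        (A j k * A k l * starRingEnd ℂ (A j m) * starRingEnd ℂ (A m l)).re)
    - dsum (fun i' j k l m => i' = i ∧ j < k ∧ (l < k ∧ k < m))
      (fun _ j k l m =>
        (A j k * A l m * starRingEnd ℂ (A j m) * starRingEnd ℂ (A l k)).re)

/-- `μ_j = Re (e^{-iθ} λ_j) + μ`, where `λ_j` is the `j`-th diagonal entry. -/
def shiftedRe (A : Matrix (Fin 5) (Fin 5) ℂ) (θ μ : ℝ) (j : Fin 5) : ℝ :=
  (Complex.exp (-(Complex.I * θ)) * A j j).re + μ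

end Kippenhahn

end

/-!
Write `x, y, z` for the coordinates and `λ_j = α_j + i β_j` for the eigenvalues. The Kippenhahn
polynomial of an upper triangular `5 × 5` matrix is
`∏ (z + α_j x + β_j y) - (x² + y²) R / 4` with a real cubic form `R`, and the right-hand sides of
the equations (a)-(g) determine the ten coefficients of `R` (`eval_kippenhahnPoly`). The dual of the
ellipse with foci `λ_p`, `λ_q` and minor axis `r` is a conic
`(z + α_p x + β_p y) (z + α_q x + β_q y) - r² (x² + y²) / 4`. The monic cubics with the remaining
eigenvalues as foci are the focal cubics
`∏ (z + α_j x + β_j y) - (x² + y²) (a z + b x + c y)`, over `j = w, t, v`. Such a cubic has a double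
point at `(cos θ, sin θ, μ)` only if `a, b, c` are given by the expressions `m₂` and
`σ(λ) - 2 m₃ e^{iθ} = b + i c` (`focalCubic_coeff_of_grad_eq_zero`). Hence (a)-(g) say that the
Kippenhahn polynomial is the product of the conic and the focal cubic with these coefficients
(`kippenhahnPoly_eq_mul_iff`), while (h) and (i) say that this cubic contains none of the lines dual
to its foci (`focal_nondegenerate_iff`).

Assume that the polynomial factors in this way. It is hyperbolic, since Hermitian matrices have real
eigenvalues, and so is its cubic factor. A linear factor of a hyperbolic focal cubic is dual to one
of the foci, so the cubic is irreducible (`focalCubic_no_line`, `irreducible_of_no_line`). On the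
lines through `(0, 0, 1)` it restricts to cubic polynomials with real roots, which depend linearly
on the parameter of the line because of the double point. Their discriminant is a nonnegative
polynomial in the parameter; with irreducibility this leaves only an ordinary double point with two
real tangents (`exists_node_tangents`). After a real change of
coordinates the cubic becomes `XYZ + κ X³ + κ' Y³` (`exists_linSubst_nodalCubic`). It is rational,
and its dual is an explicit quartic whose double tangent is dual to the node. The dual of this
quartic is the cubic again, so its foci are read off from the isotropic zeros of the focal cubic
(`isQuarticWithDoubleTangent_of_linSubst`).

Conversely, let the real curve be the union of the ellipse and a quartic with a double tangent.
Each of the two has infinitely many real points, hence shares infinitely many with the dual of some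
component of the Kippenhahn polynomial (`exists_component`). A curve that meets an irreducible curve
in infinitely many points contains it, so these duals satisfy the equations of the ellipse and of
the quartic (`dual_subset_of_infinite`). By `biduality`, the first component is the conic; the
second one is not a line or a conic, whose duals have smaller degree, so it is the complementary
cubic (`associated_conic`, `exists_cubic_factor`). The cubic is a focal cubic, because its zeros on
the isotropic lines `x² + y² = 0` are known (`exists_eq_focalCubic`). By `biduality` again, the
double tangent of the quartic is a double point of the cubic (`grad_eq_zero_of_bitangent`), and as a
line through two real affine points it has normalized coordinates `(cos θ, sin θ, μ)`.

Biduality is proved algebraically in the coordinate ring of the curve `f = 0`. If `h` vanishes on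
the gradient `∇f`, then both the point `x` and `∇h(∇f)` are orthogonal to `∇f` and to the
derivatives of `∇f` along the curve; these span a plane unless the Gauss map is constant.
-/

noncomputable section

namespace Kippenhahn

open MvPolynomial

/-! ### Polynomials on the complex projective plane -/

lemma eval_bind {σ τ : Type*} (u : σ → MvPolynomial τ ℂ) (G : MvPolynomial σ ℂ) (P : τ → ℂ) :
    eval P (bind₁ u G) = eval (fun i => eval P (u i)) G := by
  induction G using MvPolynomial.induction_on with
  | C a => simp
  | add p q hp hq => simp [hp, hq]
  | mul_X p i hp => simp [hp]

lemma pderiv_bind {σ τ : Type*} [Fintype σ] (u : σ → MvPolynomial τ ℂ) (G : MvPolynomial σ ℂ)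
    (i : τ) :
    pderiv i (bind₁ u G) = ∑ j, bind₁ u (pderiv j G) * pderiv i (u j) := by
  classical
  induction G using MvPolynomial.induction_on with
  | C a => simp
  | add p q hp hq => simp only [map_add, hp, hq, add_mul, Finset.sum_add_distrib]
  | mul_X p k hp =>
    have h : ∀ j, bind₁ u (pderiv j (p * X k)) * pderiv i (u j) =
        bind₁ u (pderiv j p) * pderiv i (u j) * u k
          + (if k = j then bind₁ u p * pderiv i (u j) else 0) := by
      intro j
      rw [pderiv_mul, map_add, map_mul, map_mul, bind₁_X_right]
      split_ifs with hj
      · subst hj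
        rw [pderiv_X_self, map_one]; ring
      · rw [pderiv_X_of_ne hj, map_zero]; ring
    rw [Finset.sum_congr rfl fun j _ => h j, Finset.sum_add_distrib, ← Finset.sum_mul, ← hp,
      Finset.sum_ite_eq, if_pos (Finset.mem_univ k), map_mul, bind₁_X_right, pderiv_mul]

/-- Nullstellensatz for an irreducible hypersurface. -/
lemma dvd_of_forall_eval_eq_zero {σ : Type*} [Finite σ] {f G : MvPolynomial σ ℂ}
    (hf : Irreducible f) (h : ∀ P, eval P f = 0 → eval P G = 0) : f ∣ G := by
  have hp : (Ideal.span {f}).IsPrime :=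
    (Ideal.span_singleton_prime hf.ne_zero).2 hf.prime
  rw [← Ideal.mem_span_singleton, ← IsPrime.vanishingIdeal_zeroLocus (K := ℂ) (Ideal.span {f})]
  intro P hP
  have := hP f (Ideal.mem_span_singleton_self f)
  simp only [aeval_eq_eval] at this ⊢
  exact h P this

/-- The substitution `X i ↦ X i * T`, which separates the homogeneous components of a polynomial
as the coefficients of the powers of `T`. -/
def scaleHom {σ : Type*} : MvPolynomial σ ℂ →ₐ[ℂ] Polynomial (MvPolynomial σ ℂ) :=
  aeval fun i => Polynomial.C (X i) * Polynomial.X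

lemma scaleHom_C {σ : Type*} (c : ℂ) :
    scaleHom (C c : MvPolynomial σ ℂ) = Polynomial.C (C c) := by
  rw [scaleHom, algHom_C, IsScalarTower.algebraMap_apply ℂ (MvPolynomial σ ℂ),
    Polynomial.algebraMap_apply]
  rfl

lemma scaleHom_monomial {σ : Type*} (m : σ →₀ ℕ) (c : ℂ) :
    scaleHom (monomial m c) = Polynomial.C (monomial m c) * Polynomial.X ^ m.degree := by
  have h : ∀ i, scaleHom (X i : MvPolynomial σ ℂ) = Polynomial.C (X i) * Polynomial.X :=
    fun i => aeval_X _ _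
  rw [monomial_eq, Finsupp.prod, Finsupp.degree_apply, map_mul, map_mul, map_prod, map_prod,
    scaleHom_C, mul_assoc, ← Finset.prod_pow_eq_pow_sum, ← Finset.prod_mul_distrib]
  congr 1
  refine Finset.prod_congr rfl fun i _ => ?_
  rw [map_pow, h, mul_pow, map_pow]

lemma coeff_scaleHom {σ : Type*} (p : MvPolynomial σ ℂ) (k : ℕ) :
    (scaleHom p).coeff k = homogeneousComponent k p := by
  induction p using MvPolynomial.monomial_add_induction_on with
  | C a =>
    rw [scaleHom_C, Polynomial.coeff_C, homogeneousComponent_of_mem (isHomogeneous_C σ a)]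
  | monomial_add m c p _ _ hp =>
    rw [map_add, Polynomial.coeff_add, hp, map_add]
    congr 1
    rw [scaleHom_monomial, Polynomial.coeff_C_mul_X_pow,
      homogeneousComponent_of_mem (isHomogeneous_monomial c rfl)]

lemma scaleHom_of_isHomogeneous {σ : Type*} {p : MvPolynomial σ ℂ} {n : ℕ}
    (hp : p.IsHomogeneous n) : scaleHom p = Polynomial.C p * Polynomial.X ^ n := by
  ext1 k
  rw [coeff_scaleHom, Polynomial.coeff_C_mul_X_pow, homogeneousComponent_of_mem hp]

lemma scaleHom_eq_zero {σ : Type*} {p : MvPolynomial σ ℂ} (h : scaleHom p = 0) : p = 0 := by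
  rw [← sum_homogeneousComponent p]
  exact Finset.sum_eq_zero fun i _ => by rw [← coeff_scaleHom, h, Polynomial.coeff_zero]

/-- A factor of a nonzero homogeneous polynomial is homogeneous. -/
lemma isHomogeneous_of_dvd {σ : Type*} {p q : MvPolynomial σ ℂ} {n : ℕ}
    (hq : q.IsHomogeneous n) (hq0 : q ≠ 0) (h : p ∣ q) : p.IsHomogeneous p.totalDegree := by
  obtain ⟨r, rfl⟩ := h
  have hp0 : p ≠ 0 := left_ne_zero_of_mul hq0
  have hr0 : r ≠ 0 := right_ne_zero_of_mul hq0
  have h1 : scaleHom p ≠ 0 := fun h => hp0 (scaleHom_eq_zero h)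
  have h2 : scaleHom r ≠ 0 := fun h => hr0 (scaleHom_eq_zero h)
  have h3 : scaleHom p * scaleHom r = Polynomial.C (p * r) * Polynomial.X ^ n := by
    rw [← map_mul, scaleHom_of_isHomogeneous hq]
  have h4 : (scaleHom p).natDegree + (scaleHom r).natDegree = n := by
    rw [← Polynomial.natDegree_mul h1 h2, h3, Polynomial.natDegree_C_mul_X_pow _ _ hq0]
  have h5 : (scaleHom p).natTrailingDegree + (scaleHom r).natTrailingDegree = n := by
    rw [← Polynomial.natTrailingDegree_mul h1 h2, h3, Polynomial.C_mul_X_pow_eq_monomial,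
      Polynomial.natTrailingDegree_monomial hq0]
  have h6 := Polynomial.natTrailingDegree_le_natDegree (scaleHom p)
  have h7 := Polynomial.natTrailingDegree_le_natDegree (scaleHom r)
  have h8 : p = homogeneousComponent (scaleHom p).natDegree p := by
    conv_lhs => rw [← sum_homogeneousComponent p]
    by_cases hd : (scaleHom p).natDegree ∈ Finset.range (p.totalDegree + 1)
    · rw [Finset.sum_eq_single_of_mem _ hd]
      intro k _ hk
      rw [← coeff_scaleHom]
      rcases lt_or_gt_of_ne hk with h | h
      · exact Polynomial.coeff_eq_zero_of_lt_natTrailingDegree (by omega)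
      · exact Polynomial.coeff_eq_zero_of_natDegree_lt h
    · exfalso
      have := Polynomial.leadingCoeff_ne_zero.2 h1
      rw [Polynomial.leadingCoeff, coeff_scaleHom] at this
      exact this (homogeneousComponent_eq_zero _ _ (by simpa using hd))
  have h9 : p.IsHomogeneous (scaleHom p).natDegree := by
    have := homogeneousComponent_isHomogeneous (scaleHom p).natDegree p
    rwa [← h8] at this
  rwa [h9.totalDegree hp0]

/-- The factors of a product of homogeneous polynomials. -/
lemma isHomogeneous_mul_split {σ : Type*} {p q : MvPolynomial σ ℂ} {n : ℕ}
    (h : (p * q).IsHomogeneous n) (h0 : p * q ≠ 0) :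
    ∃ a b, p.IsHomogeneous a ∧ q.IsHomogeneous b ∧ a + b = n := by
  have hp := isHomogeneous_of_dvd h h0 (dvd_mul_right p q)
  have hq := isHomogeneous_of_dvd h h0 (dvd_mul_left q p)
  exact ⟨_, _, hp, hq, (hp.mul hq).inj_right h h0⟩

lemma isUnit_of_isHomogeneous_zero {σ : Type*} {p : MvPolynomial σ ℂ} (h : p.IsHomogeneous 0)
    (h0 : p ≠ 0) : IsUnit p := by
  have := totalDegree_eq_zero_iff_eq_C.1 ((totalDegree_zero_iff_isHomogeneous σ).2 h)
  rw [this] at h0 ⊢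
  exact (isUnit_iff_ne_zero.2 fun hc => h0 (by rw [hc, C_0])).map C

lemma not_isUnit_of_isHomogeneous {σ : Type*} {p : MvPolynomial σ ℂ} {n : ℕ}
    (h : p.IsHomogeneous n) (hn : n ≠ 0) : ¬ IsUnit p := by
  intro hu
  have h1 := (isUnit_iff_eq_C_of_isReduced.1 hu)
  obtain ⟨r, hr, rfl⟩ := h1
  exact hn ((isHomogeneous_C σ r).inj_right h hu.ne_zero).symm

/-- Any three polynomials in three variables become algebraically dependent modulo an irreducible
polynomial, since the quotient ring has transcendence degree less than `3`. -/
lemma exists_relation_mod {f : MvPolynomial (Fin 3) ℂ} (hf : Irreducible f)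
    (a : Fin 3 → MvPolynomial (Fin 3) ℂ) : ∃ F : MvPolynomial (Fin 3) ℂ, F ≠ 0 ∧ f ∣ bind₁ a F := by
  let I := Ideal.span {f}
  have hp : I.IsPrime := (Ideal.span_singleton_prime hf.ne_zero).2 hf.prime
  let R := MvPolynomial (Fin 3) ℂ ⧸ I
  let π : MvPolynomial (Fin 3) ℂ →ₐ[ℂ] R := Ideal.Quotient.mkₐ ℂ I
  have hπ : ∀ G, π G = 0 ↔ f ∣ G := fun G => by
    rw [← Ideal.mem_span_singleton]; exact Ideal.Quotient.eq_zero_iff_mem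
  have hcomp : ∀ (b : Fin 3 → MvPolynomial (Fin 3) ℂ) F,
      aeval (fun i => π (b i)) F = π (bind₁ b F) := fun b F => by
    rw [bind₁, ← comp_aeval_apply]
  have key : ¬ AlgebraicIndependent ℂ (fun i => π (a i)) := by
    intro hai
    have hle := hai.cardinalMk_le_trdeg
    let x : Fin 3 → R := fun i => π (X i)
    have hgen : Algebra.adjoin ℂ (Set.range x) = ⊤ := by
      rw [Algebra.adjoin_range_eq_range_aeval, AlgHom.range_eq_top]
      intro y
      obtain ⟨G, rfl⟩ := Ideal.Quotient.mkₐ_surjective ℂ I y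
      refine ⟨G, ?_⟩
      rw [hcomp, bind₁_X_left, AlgHom.id_apply]
    have halg : Algebra.IsAlgebraic (Algebra.adjoin ℂ (Set.range x)) R := by
      constructor
      intro y
      have hy : y ∈ Algebra.adjoin ℂ (Set.range x) := by rw [hgen]; trivial
      exact isAlgebraic_algebraMap (⟨y, hy⟩ : Algebra.adjoin ℂ (Set.range x))
    have hx := (Algebra.IsAlgebraic.isTranscendenceBasis_of_le_trdeg_of_finite ℂ x hle).1
    refine hf.ne_zero (hx (a₁ := f) (a₂ := 0) ?_)
    rw [map_zero, hcomp, bind₁_X_left, AlgHom.id_apply, hπ]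
  rw [algebraicIndependent_iff] at key
  push Not at key
  obtain ⟨F, hF, hF0⟩ := key
  exact ⟨F, hF0, by rwa [hcomp, hπ] at hF⟩

lemma aeval_mul_of_isHomogeneous {σ S : Type*} [CommRing S] [Algebra ℂ S] {G : MvPolynomial σ ℂ}
    {n : ℕ} (hG : G.IsHomogeneous n) (c : S) (x : σ → S) :
    aeval (fun i => c * x i) G = c ^ n * aeval x G := by
  have h : ∀ p : MvPolynomial σ ℂ, aeval (fun i => c * x i) p
      = Polynomial.eval₂ (aeval x : MvPolynomial σ ℂ →ₐ[ℂ] S).toRingHom c (scaleHom p) := by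
    intro p
    induction p using MvPolynomial.induction_on with
    | C a => simp
    | add p q hp hq => rw [map_add, map_add, Polynomial.eval₂_add, hp, hq]
    | mul_X p i hp =>
      have hX : scaleHom (X i : MvPolynomial σ ℂ) = Polynomial.C (X i) * Polynomial.X := aeval_X _ _
      rw [map_mul, map_mul, Polynomial.eval₂_mul, hp, hX, Polynomial.eval₂_mul,
        Polynomial.eval₂_C, Polynomial.eval₂_X, aeval_X, mul_comm c]
      congr 2
      exact (aeval_X _ _).symm
  rw [h, scaleHom_of_isHomogeneous hG, Polynomial.eval₂_mul, Polynomial.eval₂_C,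
    Polynomial.eval₂_X_pow, mul_comm]
  rfl

lemma eval_smul_of_isHomogeneous {σ : Type*} {G : MvPolynomial σ ℂ} {n : ℕ}
    (hG : G.IsHomogeneous n) (c : ℂ) (P : σ → ℂ) : eval (c • P) G = c ^ n * eval P G :=
  aeval_mul_of_isHomogeneous hG c P

/-- Modulo `g`, a polynomial `G` that `g` does not divide satisfies an equation over the polynomials
in `X i` and `X 2`; its constant term vanishes at the common zeros of `g` and `G`. -/
lemma exists_elimination {g G : MvPolynomial (Fin 3) ℂ} (hg : Irreducible g) (hgG : ¬ g ∣ G)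
    (i : Fin 3) : ∃ H : MvPolynomial (Fin 2) ℂ, H ≠ 0 ∧
      ∀ P, eval P g = 0 → eval P G = 0 → eval ![P i, P 2] H = 0 := by
  obtain ⟨F, hF0, hF⟩ := exists_relation_mod hg ![X i, X 2, G]
  have hX : Irreducible (X 2 : MvPolynomial (Fin 3) ℂ) := (X_prime (i := (2 : Fin 3))).irreducible
  -- Divide out the powers of the last variable, to get a nonzero constant term.
  obtain ⟨k, F', hF', rfl⟩ := WfDvdMonoid.max_power_factor hF0 hX
  rw [map_mul, map_pow, bind₁_X_right] at hF
  have hdvd : g ∣ bind₁ ![X i, X 2, G] F' :=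
    (hg.prime.dvd_or_dvd hF).resolve_left fun h => hgG (hg.prime.dvd_of_dvd_pow h)
  have hev : ∀ a b : ℂ, eval ![a, b] (bind₁ ![X 0, X 1, 0] F' : MvPolynomial (Fin 2) ℂ)
      = eval ![a, b, 0] F' := by
    intro a b
    rw [eval_bind]
    congr 2
    ext j; fin_cases j <;> simp
  refine ⟨bind₁ ![X 0, X 1, 0] F', fun h0 => hF' ?_, fun P hP hG => ?_⟩
  · refine dvd_of_forall_eval_eq_zero hX fun P hP => ?_
    have h1 := hev (P 0) (P 1)
    rw [h0, map_zero] at h1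
    rw [eval_X] at hP
    rw [h1]
    congr 2
    ext j; fin_cases j <;> simp [hP]
  · obtain ⟨q, hq⟩ := hdvd
    have h1 := congrArg (eval P) hq
    rw [map_mul, hP, zero_mul, eval_bind] at h1
    refine (hev _ _).trans (Eq.trans ?_ h1)
    congr 2
    ext j; fin_cases j <;> simp [hG]

/-- Two curves without common component have finitely many common points in the real affine
plane. -/
lemma dvd_of_infinite_zeros {g G : MvPolynomial (Fin 3) ℂ} {n d : ℕ} (hg : Irreducible g)
    (hgh : g.IsHomogeneous n) (hGh : G.IsHomogeneous d) {T : Set ℂ} (hT : T.Infinite)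
    (hTg : ∀ ζ ∈ T, eval (homCoord ζ) g = 0) (hTG : ∀ ζ ∈ T, eval (homCoord ζ) G = 0) :
    g ∣ G := by
  by_contra hgG
  -- Each affine coordinate takes only finitely many values, the zeros of an eliminant.
  have fin : ∀ i : Fin 3, ((fun ζ => homCoord ζ i) '' T).Finite := by
    intro i
    obtain ⟨H, hH0, hH⟩ := exists_elimination hg hgG i
    by_contra hinf
    -- `H` vanishes on the cone over the values of the coordinate.
    have hK : (bind₁ ![X 0 * X 1, X 0] H : MvPolynomial (Fin 2) ℂ) = 0 := by
      refine funext_set ![Set.univ, (fun ζ => homCoord ζ i) '' T] ?_ ?_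
      · intro j
        fin_cases j
        · exact Set.infinite_univ
        · exact hinf
      · intro y hy
        obtain ⟨ζ, hζ, hζy⟩ : y 1 ∈ (fun ζ => homCoord ζ i) '' T := hy 1 trivial
        rw [eval_bind, map_zero]
        rw [← hH (y 0 • homCoord ζ)
          (by rw [eval_smul_of_isHomogeneous hgh, hTg ζ hζ, mul_zero])
          (by rw [eval_smul_of_isHomogeneous hGh, hTG ζ hζ, mul_zero])]
        congr 2
        ext j
        fin_cases j
        · simp [← hζy]
        · simp [homCoord]
    have hX : H * X 1 = 0 := by
      refine MvPolynomial.funext fun y => ?_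
      rw [map_mul, eval_X, map_zero]
      by_cases hy : y 1 = 0
      · rw [hy, mul_zero]
      · have h1 := congrArg (eval ![y 1, y 0 / y 1]) hK
        rw [eval_bind, map_zero] at h1
        have h2 : (fun j => eval ![y 1, y 0 / y 1]
            ((![X 0 * X 1, X 0] : Fin 2 → MvPolynomial (Fin 2) ℂ) j)) = y := by
          ext j
          fin_cases j
          · simp [mul_div_cancel₀ _ hy]
          · simp
        rw [h2] at h1
        rw [h1, zero_mul]
    exact (mul_ne_zero hH0 (X_ne_zero 1)) hX
  refine hT (((fin 0).prod (fin 1)).preimage (f := fun ζ : ℂ => (homCoord ζ 0, homCoord ζ 1)) ?_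
    |>.subset ?_)
  · intro a _ b _ hab
    simp only [homCoord, Prod.mk.injEq, Matrix.cons_val_zero, Matrix.cons_val_one,
      Complex.ofReal_inj] at hab
    exact Complex.ext hab.1 hab.2
  · exact fun ζ hζ => ⟨⟨ζ, hζ, rfl⟩, ⟨ζ, hζ, rfl⟩⟩

lemma dvd_homogeneousComponent {σ : Type*} {f G : MvPolynomial σ ℂ} {n : ℕ}
    (hf : f.IsHomogeneous n) (h : f ∣ G) (m : ℕ) : f ∣ homogeneousComponent m G := by
  obtain ⟨q, rfl⟩ := h
  rw [← coeff_scaleHom, map_mul, scaleHom_of_isHomogeneous hf, mul_assoc, Polynomial.coeff_C_mul]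
  exact dvd_mul_right _ _

/-- If homogeneous polynomials of the same positive degree satisfy a polynomial relation modulo
`f`, then they satisfy every homogeneous component of it. -/
lemma dvd_bind_homogeneousComponent {σ τ : Type*} {f : MvPolynomial τ ℂ} {n d : ℕ}
    (hf : f.IsHomogeneous n) {u : σ → MvPolynomial τ ℂ} (hd : d ≠ 0)
    (hu : ∀ i, (u i).IsHomogeneous d) {F : MvPolynomial σ ℂ} (h : f ∣ bind₁ u F) (k : ℕ) :
    f ∣ bind₁ u (homogeneousComponent k F) := by
  have hcomp : ∀ j, (bind₁ u (homogeneousComponent j F)).IsHomogeneous (d * j) := fun j =>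
    (homogeneousComponent_isHomogeneous j F).aeval u hu
  by_cases hk : k ∈ Finset.range (F.totalDegree + 1)
  · have h1 := dvd_homogeneousComponent hf h (d * k)
    rw [← sum_homogeneousComponent F, map_sum, map_sum, Finset.sum_eq_single_of_mem k hk] at h1
    · rwa [homogeneousComponent_of_mem (hcomp k), if_pos rfl] at h1
    · intro j _ hj
      rw [homogeneousComponent_of_mem (hcomp j), if_neg]
      exact fun h => hj (Nat.eq_of_mul_eq_mul_left (Nat.pos_of_ne_zero hd) h).symm
  · rw [homogeneousComponent_eq_zero _ _ (by simpa using hk), map_zero]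
    exact dvd_zero _

/-- The polynomial map `P ↦ grad f P`. -/
def gradPoly (f : MvPolynomial (Fin 3) ℂ) : Fin 3 → MvPolynomial (Fin 3) ℂ := fun i => pderiv i f

lemma eval_bind_gradPoly (f G : MvPolynomial (Fin 3) ℂ) (P : Fin 3 → ℂ) :
    eval P (bind₁ (gradPoly f) G) = eval (grad f P) G := eval_bind _ _ _

/-- The tangent lines of an irreducible plane curve satisfy an irreducible homogeneous equation. -/
lemma exists_dual_equation {f : MvPolynomial (Fin 3) ℂ} {n : ℕ} (hf : Irreducible f)
    (hfn : f.IsHomogeneous n) :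
    ∃ h e, Irreducible h ∧ h.IsHomogeneous e ∧ f ∣ bind₁ (gradPoly f) h := by
  obtain ⟨j, hj⟩ : ∃ j : Fin 3, ¬ f ∣ X j := by
    by_contra hall
    push Not at hall
    have hX : Irreducible (X 0 : MvPolynomial (Fin 3) ℂ) := (X_prime (i := (0 : Fin 3))).irreducible
    obtain ⟨q, hq⟩ := ((hf.associated_of_dvd hX (hall 0)).symm.dvd).trans (hall 1)
    have := congrArg (eval ![0, 1, 0]) hq
    simp at this
  -- The factor `X j` makes the degree positive also when `f` is a line.
  obtain ⟨F, hF0, hF⟩ := exists_relation_mod hf fun i => pderiv i f * X j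
  obtain ⟨k, hk⟩ : ∃ k, homogeneousComponent k F ≠ 0 := by
    by_contra hall
    push Not at hall
    exact hF0 (by rw [← sum_homogeneousComponent F]; exact Finset.sum_eq_zero fun i _ => hall i)
  have h1 := dvd_bind_homogeneousComponent hfn (Nat.succ_ne_zero (n - 1))
    (fun i => (hfn.pderiv (i := i)).mul (isHomogeneous_X ℂ j)) hF k
  have hFk := homogeneousComponent_isHomogeneous k F
  have h2 : bind₁ (fun i => pderiv i f * X j) (homogeneousComponent k F)
      = X j ^ k * bind₁ (gradPoly f) (homogeneousComponent k F) := by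
    refine MvPolynomial.funext fun P => ?_
    rw [map_mul, eval_bind, eval_bind, map_pow, eval_X, ← eval_smul_of_isHomogeneous hFk]
    congr 2
    ext i
    simp [gradPoly, mul_comm]
  rw [h2] at h1
  have h3 : f ∣ bind₁ (gradPoly f) (homogeneousComponent k F) :=
    (hf.prime.dvd_or_dvd h1).resolve_left fun h => hj (hf.prime.dvd_of_dvd_pow h)
  have h4 : f ∣ ((UniqueFactorizationMonoid.factors (homogeneousComponent k F)).map
      (bind₁ (gradPoly f))).prod := by
    rw [← map_multiset_prod]
    exact h3.trans (map_dvd _ (UniqueFactorizationMonoid.factors_prod hk).symm.dvd)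
  obtain ⟨h, hh, hfh⟩ := hf.prime.exists_mem_multiset_map_dvd h4
  exact ⟨h, _, UniqueFactorizationMonoid.irreducible_of_factor _ hh,
    isHomogeneous_of_dvd hFk hk (UniqueFactorizationMonoid.dvd_of_mem_factors hh), hfh⟩

/-- If infinitely many real affine points of the dual of `f` lie on the irreducible curve `g`, then
every tangent line of `f` is a point of `g`, and `g` divides every equation that holds for all the
tangent lines of `f`. -/
lemma dual_subset_of_infinite {f g : MvPolynomial (Fin 3) ℂ} {n d : ℕ} (hf : Irreducible f)
    (hfn : f.IsHomogeneous n) (hg : Irreducible g) (hgd : g.IsHomogeneous d) {T : Set ℂ}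
    (hT : T.Infinite) (hTf : ∀ ζ ∈ T, homCoord ζ ∈ dualCurve f)
    (hTg : ∀ ζ ∈ T, eval (homCoord ζ) g = 0) :
    f ∣ bind₁ (gradPoly f) g ∧
      ∀ G e, G.IsHomogeneous e → f ∣ bind₁ (gradPoly f) G → g ∣ G := by
  have key : ∀ G e, G.IsHomogeneous e → f ∣ bind₁ (gradPoly f) G → g ∣ G := by
    intro G e hG hfG
    refine dvd_of_infinite_zeros hg hgd hG hT hTg fun ζ hζ => ?_
    refine (hTf ζ hζ).2 e G hG fun P _ hP _ => ?_
    obtain ⟨q, hq⟩ := hfG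
    rw [← eval_bind_gradPoly, hq, map_mul, hP, zero_mul]
  refine ⟨?_, key⟩
  obtain ⟨h, e, hh, hhe, hfh⟩ := exists_dual_equation hf hfn
  obtain ⟨q, hq⟩ := (hg.associated_of_dvd hh (key h e hhe hfh)).symm.dvd
  rw [hq, map_mul]
  exact hfh.mul_right _

/-! ### Biduality -/

lemma pderiv_comm {σ : Type*} (i j : σ) (p : MvPolynomial σ ℂ) :
    pderiv i (pderiv j p) = pderiv j (pderiv i p) := by
  classical
  have h : ⁅(pderiv i : Derivation ℂ (MvPolynomial σ ℂ) (MvPolynomial σ ℂ)),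
      (pderiv j : Derivation ℂ (MvPolynomial σ ℂ) (MvPolynomial σ ℂ))⁆ = 0 := by
    refine derivation_ext fun k => ?_
    rw [Derivation.commutator_apply, pderiv_X, pderiv_X]
    simp [Pi.single_apply, apply_ite]
  have h1 := congrArg (fun D => D p) h
  simpa [Derivation.commutator_apply, sub_eq_zero] using h1

lemma totalDegree_pderiv_lt {σ : Type*} {p : MvPolynomial σ ℂ} {i : σ} (h : pderiv i p ≠ 0) :
    (pderiv i p).totalDegree < p.totalDegree := by
  have key : ∀ s ∈ (pderiv i p).support, s.degree < p.totalDegree := by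
    intro s hs
    rw [mem_support_iff, coeff_pderiv] at hs
    have h1 := le_totalDegree (mem_support_iff.2 (left_ne_zero_of_mul hs))
    have h2 : (s + Finsupp.single i 1).degree = s.degree + 1 := by
      rw [map_add, Finsupp.degree_single]
    have h3 : ((s + Finsupp.single i 1).sum fun _ e => e) = (s + Finsupp.single i 1).degree := rfl
    omega
  obtain ⟨s, hs⟩ := support_nonempty.2 h
  rw [totalDegree, Finset.sup_lt_iff]
  · exact fun b hb => key b hb
  · exact (Nat.zero_le _).trans_lt (key s hs)

/-- Two homogeneous polynomials of the same positive degree that are not proportional modulo `f`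
are algebraically independent modulo `f`, because binary forms split into linear factors. -/
lemma not_dvd_bind_of_not_proportional {f A B : MvPolynomial (Fin 3) ℂ} {n d : ℕ}
    (hf : Irreducible f) (hfn : f.IsHomogeneous n) (hd : d ≠ 0) (hA : A.IsHomogeneous d)
    (hB : B.IsHomogeneous d) (hfB : ¬ f ∣ B) (hAB : ∀ c : ℂ, ¬ f ∣ A - C c * B)
    {F : MvPolynomial (Fin 2) ℂ} (hF : F ≠ 0) : ¬ f ∣ bind₁ ![A, B] F := by
  intro hfF
  obtain ⟨k, hk⟩ : ∃ k, homogeneousComponent k F ≠ 0 := by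
    by_contra hall
    push Not at hall
    exact hF (by rw [← sum_homogeneousComponent F]; exact Finset.sum_eq_zero fun i _ => hall i)
  have h1 := dvd_bind_homogeneousComponent hfn hd
    (fun i => by fin_cases i; exacts [hA, hB]) hfF k
  set Fk := homogeneousComponent k F
  have hFk : Fk.IsHomogeneous k := homogeneousComponent_isHomogeneous k F
  let I := Ideal.span {f}
  have hp : I.IsPrime := (Ideal.span_singleton_prime hf.ne_zero).2 hf.prime
  let R := MvPolynomial (Fin 3) ℂ ⧸ I
  let K := FractionRing R
  let π : MvPolynomial (Fin 3) ℂ →ₐ[ℂ] K :=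
    (IsScalarTower.toAlgHom ℂ R K).comp (Ideal.Quotient.mkₐ ℂ I)
  have hπ : ∀ G, π G = 0 ↔ f ∣ G := fun G => by
    rw [← Ideal.mem_span_singleton]
    refine Iff.trans ?_ Ideal.Quotient.eq_zero_iff_mem
    exact (map_eq_zero_iff _ (IsFractionRing.injective R K))
  have hB0 : π B ≠ 0 := fun h => hfB ((hπ B).1 h)
  set c : K := π A / π B with hc
  have h2 : aeval ![c, 1] Fk = 0 := by
    have h3 : aeval (fun i => π B * (![c, 1] : Fin 2 → K) i) Fk = 0 := by
      have h4 : (fun i => π B * (![c, 1] : Fin 2 → K) i) = fun i => π (![A, B] i) := by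
        ext i
        fin_cases i
        · simp [hc, mul_div_cancel₀ _ hB0]
        · simp
      rw [h4, ← (hπ _).2 h1, bind₁, ← comp_aeval_apply]
    rw [aeval_mul_of_isHomogeneous hFk] at h3
    exact (mul_eq_zero.1 h3).resolve_left (pow_ne_zero _ hB0)
  let p : Polynomial ℂ := aeval ![Polynomial.X, 1] Fk
  have hpev : ∀ (S : Type) [CommRing S] [Algebra ℂ S] (y : S),
      Polynomial.aeval y p = aeval ![y, 1] Fk := by
    intro S _ _ y
    change Polynomial.aeval y (aeval ![Polynomial.X, 1] Fk) = _
    rw [comp_aeval_apply]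
    congr 2
    ext i
    fin_cases i <;> simp
  have hp0 : p ≠ 0 := by
    intro hp0
    have hX : Fk * X 1 = 0 := by
      refine MvPolynomial.funext fun y => ?_
      rw [map_mul, eval_X, map_zero]
      by_cases hy : y 1 = 0
      · rw [hy, mul_zero]
      · have h4 : eval ![y 0 / y 1, 1] Fk = 0 := by
          have := congrArg (Polynomial.aeval (y 0 / y 1)) hp0
          rwa [map_zero, hpev, aeval_eq_eval] at this
        have h5 : y = y 1 • ![y 0 / y 1, 1] := by
          ext i
          fin_cases i
          · simp [mul_div_cancel₀ _ hy]
          · simp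
        rw [h5, eval_smul_of_isHomogeneous hFk, h4, mul_zero, zero_mul]
    exact (mul_ne_zero hk (X_ne_zero 1)) hX
  have halg : IsAlgebraic ℂ c := by
    refine ⟨p, hp0, ?_⟩
    rw [hpev, h2]
  obtain ⟨r, hr⟩ := minpoly.mem_range_of_degree_eq_one ℂ c
    (IsAlgClosed.degree_eq_one_of_irreducible ℂ (minpoly.irreducible halg.isIntegral))
  refine hAB r ((hπ _).1 ?_)
  have h6 : π (C r) = c := by rw [← hr, ← algebraMap_eq, AlgHom.commutes]
  rw [map_sub, map_mul, h6, hc, div_mul_cancel₀ _ hB0, sub_self]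

/-- If `A` and `B` are not proportional modulo `f`, every polynomial is separably algebraic over
them modulo `f`. -/
lemma exists_separable_relation {f A B Y : MvPolynomial (Fin 3) ℂ} {n d : ℕ}
    (hf : Irreducible f) (hfn : f.IsHomogeneous n) (hd : d ≠ 0) (hA : A.IsHomogeneous d)
    (hB : B.IsHomogeneous d) (hfB : ¬ f ∣ B) (hAB : ∀ c : ℂ, ¬ f ∣ A - C c * B) :
    ∃ F : MvPolynomial (Fin 3) ℂ, f ∣ bind₁ ![A, B, Y] F ∧ ¬ f ∣ bind₁ ![A, B, Y] (pderiv 2 F) := by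
  classical
  let p : ℕ → Prop := fun k => ∃ F : MvPolynomial (Fin 3) ℂ, F ≠ 0 ∧ f ∣ bind₁ ![A, B, Y] F ∧
    F.totalDegree = k
  have hex : ∃ k, p k := by
    obtain ⟨F, hF0, hF⟩ := exists_relation_mod hf ![A, B, Y]
    exact ⟨_, F, hF0, hF, rfl⟩
  obtain ⟨F, hF0, hF, hFk⟩ := Nat.find_spec hex
  -- A relation of least degree is separable in `Y`: its derivative has smaller degree.
  refine ⟨F, hF, fun h => ?_⟩
  by_cases hz : pderiv 2 F = 0
  · have hvars : (F.vars : Set (Fin 3)) ⊆ Set.range (Fin.castSucc : Fin 2 → Fin 3) := by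
      intro i hi
      fin_cases i
      · exact ⟨0, rfl⟩
      · exact ⟨1, rfl⟩
      · exfalso
        obtain ⟨s, hs, hsi⟩ := (mem_vars_iff_mem_support _).1 (Finset.mem_coe.1 hi)
        have h1 := congrArg (coeff (s - Finsupp.single 2 1)) hz
        have h2 : s - Finsupp.single 2 1 + Finsupp.single 2 1 = s :=
          tsub_add_cancel_of_le (Finsupp.single_le_iff.2
            (Nat.one_le_iff_ne_zero.2 (Finsupp.mem_support_iff.1 hsi)))
        rw [coeff_pderiv, coeff_zero, h2] at h1
        rcases mul_eq_zero.1 h1 with h1 | h1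
        · exact (mem_support_iff.1 hs) h1
        · exact Nat.cast_add_one_ne_zero _ h1
    obtain ⟨q, rfl⟩ := exists_rename_eq_of_vars_subset_range F _ (Fin.castSucc_injective 2) hvars
    have hq0 : q ≠ 0 := by
      rintro rfl
      exact hF0 (map_zero _)
    refine not_dvd_bind_of_not_proportional hf hfn hd hA hB hfB hAB hq0 ?_
    rw [bind₁_rename] at hF
    convert hF using 3
    ext i
    fin_cases i <;> rfl
  · exact Nat.find_min hex (hFk ▸ totalDegree_pderiv_lt hz) ⟨_, hz, h, rfl⟩

section Domain

variable {R : Type*} [CommRing R] [IsDomain R]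

/-- Two vectors orthogonal to two independent vectors are parallel. -/
lemma parallel_of_orthogonal {U V W x : Fin 3 → R} (hN : ∃ i j, U i * V j ≠ U j * V i)
    (hWU : ∑ i, W i * U i = 0) (hWV : ∑ i, W i * V i = 0) (hxU : ∑ i, x i * U i = 0)
    (hxV : ∑ i, x i * V i = 0) (i j : Fin 3) : W i * x j = W j * x i := by
  let N : Fin 3 → R := ![U 1 * V 2 - U 2 * V 1, U 2 * V 0 - U 0 * V 2, U 0 * V 1 - U 1 * V 0]
  have key : ∀ Z : Fin 3 → R, ∑ i, Z i * U i = 0 → ∑ i, Z i * V i = 0 →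
      ∀ i j, Z i * N j = Z j * N i := by
    intro Z hU hV
    rw [Fin.sum_univ_three] at hU hV
    have h01 : Z 0 * N 1 = Z 1 * N 0 := by
      simp only [N, Matrix.cons_val]; linear_combination U 2 * hV - V 2 * hU
    have h12 : Z 1 * N 2 = Z 2 * N 1 := by
      simp only [N, Matrix.cons_val]; linear_combination U 0 * hV - V 0 * hU
    have h20 : Z 2 * N 0 = Z 0 * N 2 := by
      simp only [N, Matrix.cons_val]; linear_combination U 1 * hV - V 1 * hU
    intro i j
    fin_cases i <;> fin_cases j <;> first | rfl | assumption | (symm; assumption)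
  obtain ⟨k, hk⟩ : ∃ k, N k ≠ 0 := by
    by_contra hall
    push Not at hall
    have h0 := hall 0
    have h1 := hall 1
    have h2 := hall 2
    simp only [N, Matrix.cons_val, sub_eq_zero] at h0 h1 h2
    obtain ⟨a, b, hab⟩ := hN
    apply hab
    fin_cases a <;> fin_cases b <;> first | rfl | assumption | (symm; assumption)
  have h1 := key W hWU hWV
  have h2 := key x hxU hxV
  refine mul_left_cancel₀ hk (mul_left_cancel₀ hk ?_)
  linear_combination N k * x j * h1 i k + W k * N i * h2 j k
    - N k * x i * h1 j k - W k * N j * h2 i k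

/-- If the three vectors `U × e_m` are parallel to one vector, then `U = 0`. -/
lemma eq_zero_of_cross_parallel {U n s t : Fin 3 → R} (hs : ∀ m, s m ≠ 0)
    (h0 : t 0 * n 0 = 0 ∧ t 0 * n 1 + s 0 * U 2 = 0 ∧ t 0 * n 2 - s 0 * U 1 = 0)
    (h1 : t 1 * n 0 - s 1 * U 2 = 0 ∧ t 1 * n 1 = 0 ∧ t 1 * n 2 + s 1 * U 0 = 0)
    (h2 : t 2 * n 0 + s 2 * U 1 = 0 ∧ t 2 * n 1 - s 2 * U 0 = 0 ∧ t 2 * n 2 = 0) :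
    ∀ m, U m = 0 := by
  have e2 : U 2 = 0 := by
    have : (s 0 * s 1) * U 2 * U 2 = 0 := by
      linear_combination s 1 * U 2 * h0.2.1 + t 0 * n 1 * h1.1 - t 0 * n 0 * h1.2.1
    simpa [hs] using this
  have e1 : U 1 = 0 := by
    have : (s 0 * s 2) * U 1 * U 1 = 0 := by
      linear_combination - s 2 * U 1 * h0.2.2 + t 0 * n 2 * h2.1 - t 0 * n 0 * h2.2.2
    simpa [hs] using this
  have e0 : U 0 = 0 := by
    have : (s 1 * s 2) * U 0 * U 0 = 0 := by
      linear_combination s 2 * U 0 * h1.2.2 + t 1 * n 2 * h2.2.1 - t 1 * n 1 * h2.2.2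
    simpa [hs] using this
  intro m
  fin_cases m <;> assumption

end Domain

/-- The Gauss map of an irreducible plane curve `f` of degree at least `2` is not constant: its
differential, given in `hcross` by the derivatives of the ratios of the partial derivatives of `f`
along the tangent vectors of the curve, does not vanish identically. Otherwise these ratios would be
constants, and `f` would have a linear factor by Euler's formula. -/
lemma false_of_gauss_differential_eq_zero {f : MvPolynomial (Fin 3) ℂ} {n : ℕ} (hf : Irreducible f)
    (hfn : f.IsHomogeneous n) (hn : 2 ≤ n) {R : Type*} [CommRing R] [IsDomain R]
    (π : MvPolynomial (Fin 3) ℂ →+* R) (hπ : ∀ G, π G = 0 ↔ f ∣ G)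
    (hcross : ∀ i j k l : Fin 3, π (pderiv i f) *
        (π (pderiv k f) * π (pderiv l (pderiv j f)) - π (pderiv l f) * π (pderiv k (pderiv j f)))
      = π (pderiv j f) *
        (π (pderiv k f) * π (pderiv l (pderiv i f)) - π (pderiv l f) * π (pderiv k (pderiv i f)))) :
    False := by
  have hd : n - 1 ≠ 0 := by omega
  have hgr : ∀ i, (pderiv i f).IsHomogeneous (n - 1) := fun i => hfn.pderiv
  have small : ∀ G : MvPolynomial (Fin 3) ℂ, G.IsHomogeneous (n - 1) → f ∣ G → G = 0 := by
    intro G hG ⟨q, hq⟩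
    by_contra h0
    rw [hq] at h0 hG
    have h1 := hG.totalDegree h0
    rw [totalDegree_mul_of_isDomain (left_ne_zero_of_mul h0) (right_ne_zero_of_mul h0),
      hfn.totalDegree (left_ne_zero_of_mul h0)] at h1
    omega
  have euler := hfn.sum_X_mul_pderiv
  obtain ⟨j, hj⟩ : ∃ j, ¬ f ∣ pderiv j f := by
    by_contra hall
    push Not at hall
    rw [Finset.sum_eq_zero fun i _ => by rw [small _ (hgr i) (hall i), mul_zero]] at euler
    exact (smul_ne_zero (by omega) hf.ne_zero) euler.symm
  have hprop : ∀ i, ∃ c : ℂ, f ∣ pderiv i f - C c * pderiv j f := by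
    intro i
    by_contra hall
    push Not at hall
    -- Otherwise every coordinate is separably algebraic over the ratio, so that its differential
    -- vanishes with that of the ratio.
    choose F hF hF3 using fun m : Fin 3 =>
      exists_separable_relation (Y := X m) hf hfn hd (hgr i) (hgr j) hj hall
    have hB0 : π (pderiv j f) ≠ 0 := fun h => hj ((hπ _).1 h)
    let U : Fin 3 → R := fun k => π (pderiv k f)
    let H : Fin 3 → Fin 3 → R := fun k l => π (pderiv l (pderiv k f))
    let a : Fin 3 → Fin 3 → MvPolynomial (Fin 3) ℂ := fun m => ![pderiv i f, pderiv j f, X m]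
    let p : Fin 3 → Fin 3 → R := fun m k => π (bind₁ (a m) (pderiv k (F m)))
    -- The gradient of the relation for the coordinate `m` is a multiple of the gradient of `f`.
    have hrel : ∀ m, ∃ Q : R, ∀ l, p m 0 * H i l + p m 1 * H j l + (if m = l then p m 2 else 0)
        = Q * U l := by
      intro m
      obtain ⟨q, hq⟩ := hF m
      refine ⟨π q, fun l => ?_⟩
      have h1 := congrArg (fun G => π (pderiv l G)) hq
      have hf0 : π f = 0 := (hπ f).2 dvd_rfl
      simp only [pderiv_bind, Fin.sum_univ_three, Matrix.cons_val, pderiv_mul, map_add, map_mul,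
        hf0, zero_mul, add_zero] at h1
      rw [mul_comm (π q), ← h1]
      simp only [p, a, H]
      congr 1
      split_ifs with hml
      · subst hml
        rw [pderiv_X_self, map_one, mul_one]
      · rw [pderiv_X_of_ne hml, map_zero, mul_zero]
    choose Q hQ using hrel
    have hs : ∀ m, p m 2 * U j ≠ 0 := fun m =>
      mul_ne_zero (fun h => hF3 m ((hπ _).1 h)) hB0
    have hcr : ∀ k l, U i * (U k * H j l - U l * H j k) = U j * (U k * H i l - U l * H i k) :=
      fun k l => hcross i j k l
    refine hB0 (eq_zero_of_cross_parallel (U := U)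
      (n := ![U 1 * H j 2 - U 2 * H j 1, U 2 * H j 0 - U 0 * H j 2, U 0 * H j 1 - U 1 * H j 0])
      (s := fun m => p m 2 * U j) (t := fun m => p m 0 * U i + p m 1 * U j) hs ?_ ?_ ?_ j)
    all_goals
      simp only [Matrix.cons_val]
    · have e0 := hQ 0 0
      have e1 := hQ 0 1
      have e2 := hQ 0 2
      simp only [reduceIte, Fin.reduceEq] at e0 e1 e2
      refine ⟨?_, ?_, ?_⟩
      · linear_combination p 0 0 * hcr 1 2 + U j * U 1 * e2 - U j * U 2 * e1
      · linear_combination p 0 0 * hcr 2 0 + U j * U 2 * e0 - U j * U 0 * e2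
      · linear_combination p 0 0 * hcr 0 1 + U j * U 0 * e1 - U j * U 1 * e0
    · have e0 := hQ 1 0
      have e1 := hQ 1 1
      have e2 := hQ 1 2
      simp only [reduceIte, Fin.reduceEq] at e0 e1 e2
      refine ⟨?_, ?_, ?_⟩
      · linear_combination p 1 0 * hcr 1 2 + U j * U 1 * e2 - U j * U 2 * e1
      · linear_combination p 1 0 * hcr 2 0 + U j * U 2 * e0 - U j * U 0 * e2
      · linear_combination p 1 0 * hcr 0 1 + U j * U 0 * e1 - U j * U 1 * e0
    · have e0 := hQ 2 0
      have e1 := hQ 2 1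
      have e2 := hQ 2 2
      simp only [reduceIte, Fin.reduceEq] at e0 e1 e2
      refine ⟨?_, ?_, ?_⟩
      · linear_combination p 2 0 * hcr 1 2 + U j * U 1 * e2 - U j * U 2 * e1
      · linear_combination p 2 0 * hcr 2 0 + U j * U 2 * e0 - U j * U 0 * e2
      · linear_combination p 2 0 * hcr 0 1 + U j * U 0 * e1 - U j * U 1 * e0
  choose c hc using hprop
  have heq : ∀ i, pderiv i f = C (c i) * pderiv j f := fun i =>
    sub_eq_zero.1 (small _ ((hgr i).sub ((hgr j).C_mul (c i))) (hc i))
  have hprod : f = ((∑ i, C ((n : ℂ)⁻¹ * c i) * X i) * pderiv j f) := by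
    have h1 : (C ((n : ℂ)⁻¹) : MvPolynomial (Fin 3) ℂ) * (n • f) = f := by
      rw [nsmul_eq_mul, ← mul_assoc, ← C_eq_coe_nat, ← C_mul,
        inv_mul_cancel₀ (Nat.cast_ne_zero.2 (by omega)), C_1, one_mul]
    conv_lhs => rw [← h1, ← euler]
    rw [Finset.mul_sum, Finset.sum_mul]
    refine Finset.sum_congr rfl fun i _ => ?_
    rw [heq i, C_mul]
    ring
  rcases hf.isUnit_or_isUnit hprod with h | h
  · exact not_isUnit_of_isHomogeneous
      (IsHomogeneous.sum _ _ 1 fun i _ => (isHomogeneous_X ℂ i).C_mul _) one_ne_zero h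
  · exact not_isUnit_of_isHomogeneous (hgr j) hd h

/-- Biduality: if `h` vanishes on the tangent lines of the irreducible curve `f`, which is not a
line, then the gradient of `h` at the tangent line `grad f P` is proportional to `P`. It may be
zero. -/
lemma biduality {f h : MvPolynomial (Fin 3) ℂ} {n e : ℕ} (hf : Irreducible f)
    (hfn : f.IsHomogeneous n) (hn : 2 ≤ n) (hh : h.IsHomogeneous e)
    (hfh : f ∣ bind₁ (gradPoly f) h) {P : Fin 3 → ℂ} (hP : eval P f = 0) (i j : Fin 3) :
    grad h (grad f P) i * P j = grad h (grad f P) j * P i := by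
  let I := Ideal.span {f}
  have hp : I.IsPrime := (Ideal.span_singleton_prime hf.ne_zero).2 hf.prime
  let π : MvPolynomial (Fin 3) ℂ →+* MvPolynomial (Fin 3) ℂ ⧸ I := Ideal.Quotient.mk I
  have hπ : ∀ G, π G = 0 ↔ f ∣ G := fun G => by
    rw [← Ideal.mem_span_singleton]; exact Ideal.Quotient.eq_zero_iff_mem
  have hf0 : π f = 0 := (hπ f).2 dvd_rfl
  let w : Fin 3 → MvPolynomial (Fin 3) ℂ := fun i => bind₁ (gradPoly f) (pderiv i h)
  -- Both `w` and the generic point are orthogonal to the gradient of `f` by Euler's formula, and to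
  -- the derivative of the gradient along the curve by Euler's formula for the partial derivatives
  -- of `f` and by differentiation of `hfh`.
  have key : π (w i) * π (X j) = π (w j) * π (X i) := by
    obtain ⟨a, b, k, l, habk⟩ : ∃ a b k l : Fin 3, π (pderiv a f) *
        (π (pderiv k f) * π (pderiv l (pderiv b f)) - π (pderiv l f) * π (pderiv k (pderiv b f)))
      ≠ π (pderiv b f) *
        (π (pderiv k f) * π (pderiv l (pderiv a f))
          - π (pderiv l f) * π (pderiv k (pderiv a f))) := by
      by_contra hall
      push Not at hall
      exact false_of_gauss_differential_eq_zero hf hfn hn π hπ fun i j k l => hall i j k l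
    have eulerf : ∑ i, π (X i) * π (pderiv i f) = 0 := by
      have := congrArg π hfn.sum_X_mul_pderiv
      simpa [map_sum, map_mul, hf0] using this
    have eulerh : ∑ i, π (w i) * π (pderiv i f) = 0 := by
      have := congrArg (fun G => π (bind₁ (gradPoly f) G)) hh.sum_X_mul_pderiv
      simp only [map_sum, map_mul, bind₁_X_right, map_nsmul, (hπ _).2 hfh, smul_zero] at this
      rw [← this]
      exact Finset.sum_congr rfl fun i _ => mul_comm _ _
    have hessx : ∀ i, ∑ m, π (X m) * π (pderiv i (pderiv m f))
        = ((n - 1 : ℕ) : MvPolynomial (Fin 3) ℂ ⧸ I) * π (pderiv i f) := by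
      intro i
      have := congrArg π (hfn.pderiv (i := i)).sum_X_mul_pderiv
      simp only [map_sum, map_mul, nsmul_eq_mul, map_natCast] at this
      rw [← this]
      exact Finset.sum_congr rfl fun m _ => by rw [pderiv_comm]
    obtain ⟨q, hq⟩ := hfh
    have hessw : ∀ i, ∑ m, π (w m) * π (pderiv i (pderiv m f)) = π q * π (pderiv i f) := by
      intro i
      have := congrArg (fun G => π (pderiv i G)) hq
      simp only [pderiv_bind, pderiv_mul, map_add, map_mul, map_sum, hf0, zero_mul,
        add_zero] at this
      rw [mul_comm (π q), ← this]
      rfl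
    refine parallel_of_orthogonal (U := fun i => π (pderiv i f))
      (V := fun m => π (pderiv k f) * π (pderiv l (pderiv m f))
        - π (pderiv l f) * π (pderiv k (pderiv m f)))
      (W := fun i => π (w i)) (x := fun i => π (X i)) ⟨a, b, habk⟩ eulerh ?_ eulerf ?_ i j
    · have h1 := hessw k
      have h2 := hessw l
      simp only [Fin.sum_univ_three] at h1 h2 ⊢
      linear_combination π (pderiv k f) * h2 - π (pderiv l f) * h1
    · have h1 := hessx k
      have h2 := hessx l
      simp only [Fin.sum_univ_three] at h1 h2 ⊢
      linear_combination π (pderiv k f) * h2 - π (pderiv l f) * h1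
  obtain ⟨q, hq⟩ := (hπ (w i * X j - w j * X i)).1
    (by rw [map_sub, map_mul, map_mul, key, sub_self])
  have h1 := congrArg (eval P) hq
  simp only [map_sub, map_mul, hP, zero_mul, eval_X, w, eval_bind_gradPoly] at h1
  exact sub_eq_zero.1 h1

/-! ### Linear changes of coordinates -/

/-- The polynomial `P ↦ f (T P)`. -/
def linSubst (T : Matrix (Fin 3) (Fin 3) ℂ) (f : MvPolynomial (Fin 3) ℂ) : MvPolynomial (Fin 3) ℂ :=
  bind₁ (fun i => ∑ j, C (T i j) * X j) f

lemma eval_linSubst (T : Matrix (Fin 3) (Fin 3) ℂ) (f : MvPolynomial (Fin 3) ℂ) (P : Fin 3 → ℂ) :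
    eval P (linSubst T f) = eval (T.mulVec P) f := by
  rw [linSubst, eval_bind]
  congr 2
  ext i
  simp [Matrix.mulVec, dotProduct]

lemma grad_linSubst (T : Matrix (Fin 3) (Fin 3) ℂ) (f : MvPolynomial (Fin 3) ℂ) (P : Fin 3 → ℂ) :
    grad (linSubst T f) P = T.transpose.mulVec (grad f (T.mulVec P)) := by
  ext i
  rw [grad, linSubst, pderiv_bind, map_sum, Matrix.mulVec, dotProduct]
  refine Finset.sum_congr rfl fun j _ => ?_
  rw [map_mul, Matrix.transpose_apply, mul_comm]
  congr 1
  · rw [map_sum, map_sum, Finset.sum_eq_single i]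
    · simp
    · intro k _ hk
      simp [pderiv_X_of_ne hk]
    · simp
  · exact eval_linSubst T (pderiv j f) P

lemma isHomogeneous_linSubst {T : Matrix (Fin 3) (Fin 3) ℂ} {f : MvPolynomial (Fin 3) ℂ} {n : ℕ}
    (hf : f.IsHomogeneous n) : (linSubst T f).IsHomogeneous n := by
  have := hf.aeval (n := 1) (fun i => ∑ j, C (T i j) * X j : Fin 3 → MvPolynomial (Fin 3) ℂ)
    fun i => IsHomogeneous.sum _ _ 1 fun j _ => isHomogeneous_C_mul_X _ _
  rwa [one_mul] at this

lemma linSubst_linSubst {T T' : Matrix (Fin 3) (Fin 3) ℂ} (h : T * T' = 1)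
    (f : MvPolynomial (Fin 3) ℂ) : linSubst T' (linSubst T f) = f := by
  refine MvPolynomial.funext fun P => ?_
  rw [eval_linSubst, eval_linSubst, Matrix.mulVec_mulVec, h, Matrix.one_mulVec]

lemma irreducible_linSubst {T T' : Matrix (Fin 3) (Fin 3) ℂ} (h : T * T' = 1)
    {f : MvPolynomial (Fin 3) ℂ} (hf : Irreducible f) : Irreducible (linSubst T f) := by
  have h' := mul_eq_one_comm.1 h
  let e : MvPolynomial (Fin 3) ℂ ≃* MvPolynomial (Fin 3) ℂ :=
    { toFun := linSubst T
      invFun := linSubst T'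
      left_inv := linSubst_linSubst h
      right_inv := linSubst_linSubst h'
      map_mul' := fun p q => map_mul _ p q }
  exact (MulEquiv.irreducible_iff e).2 hf

lemma mulVec_mem_dualCurve {T T' : Matrix (Fin 3) (Fin 3) ℂ} (h : T * T' = 1)
    {f : MvPolynomial (Fin 3) ℂ} {u : Fin 3 → ℂ} (hu : u ∈ dualCurve (linSubst T f)) :
    T'.transpose.mulVec u ∈ dualCurve f := by
  have h' := mul_eq_one_comm.1 h
  have e1 : T.transpose * T'.transpose = 1 := by
    rw [← Matrix.transpose_mul, h', Matrix.transpose_one]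
  have e2 : T'.transpose * T.transpose = 1 := by
    rw [← Matrix.transpose_mul, h, Matrix.transpose_one]
  refine ⟨fun h0 => hu.1 ?_, fun d G hG hvan => ?_⟩
  · rw [← Matrix.one_mulVec u, ← e1, ← Matrix.mulVec_mulVec, h0, Matrix.mulVec_zero]
  · rw [← eval_linSubst]
    refine hu.2 d _ (isHomogeneous_linSubst hG) fun P hP0 hP hgr => ?_
    rw [eval_linSubst, grad_linSubst, Matrix.mulVec_mulVec, e2, Matrix.one_mulVec]
    refine hvan _ (fun h0 => hP0 ?_) (by rwa [eval_linSubst] at hP) (fun h0 => hgr ?_)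
    · rw [← Matrix.one_mulVec P, ← h', ← Matrix.mulVec_mulVec, h0, Matrix.mulVec_zero]
    · rw [grad_linSubst, h0, Matrix.mulVec_zero]

/-- Lines are transformed contragrediently to points. -/
lemma mem_dualCurve_linSubst {T T' : Matrix (Fin 3) (Fin 3) ℂ} (h : T * T' = 1)
    {f : MvPolynomial (Fin 3) ℂ} {u : Fin 3 → ℂ} :
    u ∈ dualCurve (linSubst T f) ↔ T'.transpose.mulVec u ∈ dualCurve f := by
  refine ⟨mulVec_mem_dualCurve h, fun hu => ?_⟩
  have h' := mul_eq_one_comm.1 h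
  rw [← linSubst_linSubst h f] at hu
  have := mulVec_mem_dualCurve h' hu
  rwa [Matrix.mulVec_mulVec, ← Matrix.transpose_mul, h', Matrix.transpose_one,
    Matrix.one_mulVec] at this

/-- Every equation for the tangent lines holds on the dual curve. -/
lemma eval_eq_zero_of_mem_dualCurve {f G : MvPolynomial (Fin 3) ℂ} {d : ℕ} (hG : G.IsHomogeneous d)
    (h : ∀ P, eval P f = 0 → eval (grad f P) G = 0) {u : Fin 3 → ℂ} (hu : u ∈ dualCurve f) :
    eval u G = 0 :=
  hu.2 d G hG fun P _ hP _ => h P hP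

/-! ### Ternary forms of low degree -/

/-- A ternary form as an explicit combination of monomials. -/
lemma eval_eq_sum_of_isHomogeneous {p : MvPolynomial (Fin 3) ℂ} {n : ℕ} (hp : p.IsHomogeneous n) :
    ∃ c : ℕ → ℕ → ℂ, ∀ P : Fin 3 → ℂ, eval P p =
      ∑ i ∈ Finset.range (n + 1), ∑ j ∈ Finset.range (n + 1),
        if i + j ≤ n then c i j * (P 0 ^ i * P 1 ^ j * P 2 ^ (n - i - j)) else 0 := by
  let e : ℕ × ℕ → Fin 3 →₀ ℕ := fun x =>
    Finsupp.equivFunOnFinite.symm ![x.1, x.2, n - x.1 - x.2]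
  let S := (Finset.range (n + 1) ×ˢ Finset.range (n + 1)).filter fun x => x.1 + x.2 ≤ n
  have he : ∀ x, (e x 0 = x.1) ∧ (e x 1 = x.2) ∧ (e x 2 = n - x.1 - x.2) := fun x =>
    ⟨rfl, rfl, rfl⟩
  refine ⟨fun i j => coeff (e (i, j)) p, fun P => ?_⟩
  have hinj : Set.InjOn e S := by
    intro x _ y _ hxy
    exact Prod.ext (by rw [← (he x).1, hxy, (he y).1]) (by rw [← (he x).2.1, hxy, (he y).2.1])
  have hsub : p.support ⊆ S.image e := by
    intro s hs
    have h1 := hp (mem_support_iff.1 hs)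
    rw [Finsupp.weight_apply, Finsupp.sum_fintype _ _ (by simp)] at h1
    simp only [Pi.one_apply, smul_eq_mul, mul_one, Fin.sum_univ_three] at h1
    refine Finset.mem_image.2 ⟨(s 0, s 1), ?_, ?_⟩
    · simp only [S, Finset.mem_filter, Finset.mem_product, Finset.mem_range]
      omega
    · ext i
      fin_cases i
      · rfl
      · rfl
      · change n - s 0 - s 1 = s 2
        omega
  rw [eval_eq', Finset.sum_subset hsub fun s _ hs => by
    rw [notMem_support_iff.1 hs, zero_mul], Finset.sum_image hinj, Finset.sum_filter,
    Finset.sum_product]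
  refine Finset.sum_congr rfl fun i _ => Finset.sum_congr rfl fun j _ => ?_
  simp only [Fin.prod_univ_three, (he (i, j)).1, (he (i, j)).2.1, (he (i, j)).2.2]

lemma exists_linear_eq {p : MvPolynomial (Fin 3) ℂ} (hp : p.IsHomogeneous 1) :
    ∃ l : Fin 3 → ℂ, ∀ P, eval P p = l 0 * P 0 + l 1 * P 1 + l 2 * P 2 := by
  obtain ⟨c, hc⟩ := eval_eq_sum_of_isHomogeneous hp
  refine ⟨![c 1 0, c 0 1, c 0 0], fun P => ?_⟩
  rw [hc]
  simp [Finset.sum_range_succ]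
  ring

lemma exists_quadratic_eq {p : MvPolynomial (Fin 3) ℂ} (hp : p.IsHomogeneous 2) :
    ∃ c : Fin 6 → ℂ, ∀ P, eval P p = c 0 * P 0 ^ 2 + c 1 * P 1 ^ 2 + c 2 * P 2 ^ 2
      + c 3 * (P 1 * P 2) + c 4 * (P 0 * P 2) + c 5 * (P 0 * P 1) := by
  obtain ⟨c, hc⟩ := eval_eq_sum_of_isHomogeneous hp
  refine ⟨![c 2 0, c 0 2, c 0 0, c 0 1, c 1 0, c 1 1], fun P => ?_⟩
  rw [hc]
  simp [Finset.sum_range_succ]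
  ring

lemma exists_cubic_eq {p : MvPolynomial (Fin 3) ℂ} (hp : p.IsHomogeneous 3) :
    ∃ c : Fin 10 → ℂ, ∀ P, eval P p = c 0 * P 0 ^ 3 + c 1 * (P 0 ^ 2 * P 1) + c 2 * (P 0 ^ 2 * P 2)
      + c 3 * (P 0 * P 1 ^ 2) + c 4 * (P 0 * P 1 * P 2) + c 5 * (P 0 * P 2 ^ 2)
      + c 6 * P 1 ^ 3 + c 7 * (P 1 ^ 2 * P 2) + c 8 * (P 1 * P 2 ^ 2) + c 9 * P 2 ^ 3 := by
  obtain ⟨c, hc⟩ := eval_eq_sum_of_isHomogeneous hp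
  refine ⟨![c 3 0, c 2 1, c 2 0, c 1 2, c 1 1, c 1 0, c 0 3, c 0 2, c 0 1, c 0 0], fun P => ?_⟩
  rw [hc]
  simp [Finset.sum_range_succ]
  ring

/-! ### Conics -/

/-- The ternary quadratic form with given coefficients. -/
def conic (c : Fin 6 → ℂ) : MvPolynomial (Fin 3) ℂ :=
  C (c 0) * X 0 ^ 2 + C (c 1) * X 1 ^ 2 + C (c 2) * X 2 ^ 2
    + C (c 3) * (X 1 * X 2) + C (c 4) * (X 0 * X 2) + C (c 5) * (X 0 * X 1)

/-- Half the Hessian determinant of a ternary quadratic form. -/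
def conicDisc (c : Fin 6 → ℂ) : ℂ :=
  4 * c 0 * c 1 * c 2 + c 3 * c 4 * c 5 - c 0 * c 3 ^ 2 - c 1 * c 4 ^ 2 - c 2 * c 5 ^ 2

/-- The coefficients of the dual form, given by the adjugate of the Hessian matrix. -/
def dualCoeff (c : Fin 6 → ℂ) : Fin 6 → ℂ :=
  ![4 * c 1 * c 2 - c 3 ^ 2, 4 * c 0 * c 2 - c 4 ^ 2, 4 * c 0 * c 1 - c 5 ^ 2,
    2 * (c 4 * c 5 - 2 * c 0 * c 3), 2 * (c 3 * c 5 - 2 * c 1 * c 4),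
    2 * (c 3 * c 4 - 2 * c 2 * c 5)]

lemma isHomogeneous_conic (c : Fin 6 → ℂ) : (conic c).IsHomogeneous 2 := by
  have hX : ∀ i : Fin 3, (X i : MvPolynomial (Fin 3) ℂ).IsHomogeneous 1 := isHomogeneous_X ℂ
  refine ((((IsHomogeneous.add ?_ ?_).add ?_).add ?_).add ?_).add ?_
  · exact ((hX 0).pow 2).C_mul _
  · exact ((hX 1).pow 2).C_mul _
  · exact ((hX 2).pow 2).C_mul _
  · exact ((hX 1).mul (hX 2)).C_mul _
  · exact ((hX 0).mul (hX 2)).C_mul _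
  · exact ((hX 0).mul (hX 1)).C_mul _

lemma eval_conic (c : Fin 6 → ℂ) (P : Fin 3 → ℂ) : eval P (conic c) =
    c 0 * P 0 ^ 2 + c 1 * P 1 ^ 2 + c 2 * P 2 ^ 2
      + c 3 * (P 1 * P 2) + c 4 * (P 0 * P 2) + c 5 * (P 0 * P 1) := by
  simp [conic]

lemma grad_conic (c : Fin 6 → ℂ) (P : Fin 3 → ℂ) : grad (conic c) P =
    ![2 * c 0 * P 0 + c 4 * P 2 + c 5 * P 1, 2 * c 1 * P 1 + c 3 * P 2 + c 5 * P 0,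
      2 * c 2 * P 2 + c 3 * P 1 + c 4 * P 0] := by
  ext i
  fin_cases i <;>
    simp [grad, conic, pderiv_X, Derivation.leibniz, Derivation.leibniz_pow] <;>
    ring

lemma eval_dualCoeff_grad (c : Fin 6 → ℂ) (P : Fin 3 → ℂ) :
    eval (grad (conic c) P) (conic (dualCoeff c)) = 4 * conicDisc c * eval P (conic c) := by
  rw [eval_conic, eval_conic, grad_conic]
  simp only [dualCoeff, conicDisc, Matrix.cons_val]
  ring

/-- The dual of a smooth conic is the conic with the adjugate matrix. -/
lemma mem_dualCurve_conic {c : Fin 6 → ℂ} (hc : conicDisc c ≠ 0) {u : Fin 3 → ℂ} :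
    u ∈ dualCurve (conic c) ↔ u ≠ 0 ∧ eval u (conic (dualCoeff c)) = 0 := by
  refine ⟨fun hu =>
    ⟨hu.1, eval_eq_zero_of_mem_dualCurve (isHomogeneous_conic _) (fun P hP => ?_) hu⟩,
    fun ⟨hu0, hu⟩ => ⟨hu0, fun d G hG hvan => ?_⟩⟩
  · rw [eval_dualCoeff_grad, hP, mul_zero]
  · -- The point of contact of the tangent `u` is its pole `P`.
    have h2 : (2 * conicDisc c : ℂ) ≠ 0 := mul_ne_zero two_ne_zero hc
    let P : Fin 3 → ℂ := (2 : ℂ)⁻¹ • grad (conic (dualCoeff c)) u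
    have hg : grad (conic c) P = (2 * conicDisc c) • u := by
      rw [grad_conic]
      ext i
      fin_cases i <;>
        simp only [P, grad_conic, dualCoeff, conicDisc, Pi.smul_apply, smul_eq_mul,
          Matrix.cons_val, Fin.zero_eta, Fin.mk_one, Fin.reduceFinMk] <;> ring
    have hP : eval P (conic c) = conicDisc c * eval u (conic (dualCoeff c)) := by
      rw [eval_conic, eval_conic]
      simp only [P, grad_conic, dualCoeff, conicDisc, Pi.smul_apply, smul_eq_mul,
          Matrix.cons_val]
      ring
    have hg0 : grad (conic c) P ≠ 0 := by
      rw [hg]; exact smul_ne_zero h2 hu0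
    have h3 := hvan P (fun h0 => hg0 ?_) (by rw [hP, hu, mul_zero]) hg0
    · rw [hg, eval_smul_of_isHomogeneous hG] at h3
      exact (mul_eq_zero.1 h3).resolve_left (pow_ne_zero _ h2)
    · rw [h0, grad_conic]
      ext i
      fin_cases i <;> simp

lemma conic_eq_zero_of_grad_eq_zero {c : Fin 6 → ℂ} (hc : conicDisc c ≠ 0) {P : Fin 3 → ℂ}
    (h : grad (conic c) P = 0) : P = 0 := by
  have h0 := congrFun h 0
  have h1 := congrFun h 1
  have h2 := congrFun h 2
  simp only [grad_conic, Matrix.cons_val, Pi.zero_apply] at h0 h1 h2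
  ext i
  refine (mul_eq_zero.1 (?_ : (2 * conicDisc c) * P i = 0)).resolve_left
    (mul_ne_zero two_ne_zero hc)
  fin_cases i <;> simp only [conicDisc, Fin.zero_eta, Fin.mk_one, Fin.reduceFinMk]
  · linear_combination (4 * c 1 * c 2 - c 3 ^ 2) * h0 + (c 3 * c 4 - 2 * c 2 * c 5) * h1
      + (c 3 * c 5 - 2 * c 1 * c 4) * h2
  · linear_combination (c 3 * c 4 - 2 * c 2 * c 5) * h0 + (4 * c 0 * c 2 - c 4 ^ 2) * h1
      + (c 4 * c 5 - 2 * c 0 * c 3) * h2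
  · linear_combination (c 3 * c 5 - 2 * c 1 * c 4) * h0 + (c 4 * c 5 - 2 * c 0 * c 3) * h1
      + (4 * c 0 * c 1 - c 5 ^ 2) * h2

/-- A smooth conic is irreducible: a common point of two factors would be singular. -/
lemma irreducible_conic {c : Fin 6 → ℂ} (hc : conicDisc c ≠ 0) : Irreducible (conic c) := by
  have h0 : conic c ≠ 0 := by
    intro h0
    have h1 : ∀ P, grad (conic c) P = 0 := fun P => by rw [h0]; ext i; simp [grad]
    have := congrFun (conic_eq_zero_of_grad_eq_zero hc (h1 ![1, 0, 0])) 0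
    simp at this
  refine ⟨not_isUnit_of_isHomogeneous (isHomogeneous_conic c) two_ne_zero, fun p q hpq => ?_⟩
  by_contra hu
  push Not at hu
  have hh := isHomogeneous_conic c
  rw [hpq] at hh h0
  obtain ⟨a, b, ha, hb, hab⟩ := isHomogeneous_mul_split hh h0
  have ha0 : a ≠ 0 := by
    rintro rfl
    exact hu.1 (isUnit_of_isHomogeneous_zero ha (left_ne_zero_of_mul h0))
  have hb0 : b ≠ 0 := by
    rintro rfl
    exact hu.2 (isUnit_of_isHomogeneous_zero hb (right_ne_zero_of_mul h0))
  obtain rfl : a = 1 := by omega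
  obtain rfl : b = 1 := by omega
  obtain ⟨l, hl⟩ := exists_linear_eq ha
  obtain ⟨m, hm⟩ := exists_linear_eq hb
  have hdet : (Matrix.of ![l, m, m]).det = 0 :=
    Matrix.det_zero_of_row_eq (i := 1) (j := 2) (by decide) rfl
  obtain ⟨P, hP0, hP⟩ := Matrix.exists_mulVec_eq_zero_iff.2 hdet
  have hp : eval P p = 0 := by
    rw [hl]
    have := congrFun hP 0
    simpa [Matrix.mulVec, dotProduct, Fin.sum_univ_three] using this
  have hq : eval P q = 0 := by
    rw [hm]
    have := congrFun hP 1
    simpa [Matrix.mulVec, dotProduct, Fin.sum_univ_three] using this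
  refine hP0 (conic_eq_zero_of_grad_eq_zero hc ?_)
  ext i
  rw [hpq, grad, pderiv_mul, map_add, map_mul, map_mul, hp, hq, mul_zero, zero_mul, add_zero]
  rfl

/-! ### The nodal cubic and its dual quartic -/

/-- A normal form of nodal cubics: the node is `(0, 0, 1)`, with branches tangent to the first two
coordinate axes. -/
def nodalCubic (a b : ℂ) : MvPolynomial (Fin 3) ℂ :=
  X 0 * X 1 * X 2 + C a * X 0 ^ 3 + C b * X 1 ^ 3

/-- The dual of `nodalCubic a b`: the discriminant of the binary cubic that is obtained by
restricting a line to the parametrization `nodalPoint a b` of the cubic. -/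
def dualQuartic (a b : ℂ) : MvPolynomial (Fin 3) ℂ :=
  X 0 ^ 2 * X 1 ^ 2 + C (4 * a) * (X 2 * X 1 ^ 3) + C (4 * b) * (X 0 ^ 3 * X 2)
    - C (27 * a ^ 2 * b ^ 2) * X 2 ^ 4 + C (18 * a * b) * (X 0 * X 1 * X 2 ^ 2)

/-- The rational parametrization of `nodalCubic a b`. -/
def nodalPoint (a b s t : ℂ) : Fin 3 → ℂ := ![s ^ 2 * t, s * t ^ 2, -(a * s ^ 3 + b * t ^ 3)]

/-- The parametrization of the tangent lines of `nodalCubic a b`. -/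
def nodalTangent (a b s t : ℂ) : Fin 3 → ℂ :=
  ![2 * a * s ^ 3 * t - b * t ^ 4, 2 * b * s * t ^ 3 - a * s ^ 4, s ^ 2 * t ^ 2]

lemma eval_nodalCubic (a b : ℂ) (P : Fin 3 → ℂ) :
    eval P (nodalCubic a b) = P 0 * P 1 * P 2 + a * P 0 ^ 3 + b * P 1 ^ 3 := by
  simp [nodalCubic]

lemma eval_dualQuartic (a b : ℂ) (P : Fin 3 → ℂ) :
    eval P (dualQuartic a b) = P 0 ^ 2 * P 1 ^ 2 + 4 * a * (P 2 * P 1 ^ 3)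
      + 4 * b * (P 0 ^ 3 * P 2) - 27 * a ^ 2 * b ^ 2 * P 2 ^ 4
      + 18 * a * b * (P 0 * P 1 * P 2 ^ 2) := by
  simp [dualQuartic]

lemma isHomogeneous_nodalCubic (a b : ℂ) : (nodalCubic a b).IsHomogeneous 3 := by
  have hX : ∀ i : Fin 3, (X i : MvPolynomial (Fin 3) ℂ).IsHomogeneous 1 := isHomogeneous_X ℂ
  refine IsHomogeneous.add (IsHomogeneous.add ?_ ?_) ?_
  · exact ((hX 0).mul (hX 1)).mul (hX 2)
  · exact ((hX 0).pow 3).C_mul _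
  · exact ((hX 1).pow 3).C_mul _

lemma isHomogeneous_dualQuartic (a b : ℂ) : (dualQuartic a b).IsHomogeneous 4 := by
  have hX : ∀ i : Fin 3, (X i : MvPolynomial (Fin 3) ℂ).IsHomogeneous 1 := isHomogeneous_X ℂ
  refine IsHomogeneous.add
    (IsHomogeneous.sub (IsHomogeneous.add (IsHomogeneous.add ?_ ?_) ?_) ?_) ?_
  · exact ((hX 0).pow 2).mul ((hX 1).pow 2)
  · exact ((hX 2).mul ((hX 1).pow 3)).C_mul _
  · exact (((hX 0).pow 3).mul (hX 2)).C_mul _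
  · exact ((hX 2).pow 4).C_mul _
  · exact (((hX 0).mul (hX 1)).mul ((hX 2).pow 2)).C_mul _

lemma grad_nodalCubic (a b : ℂ) (P : Fin 3 → ℂ) : grad (nodalCubic a b) P =
    ![P 1 * P 2 + 3 * a * P 0 ^ 2, P 0 * P 2 + 3 * b * P 1 ^ 2, P 0 * P 1] := by
  ext i
  fin_cases i <;>
    simp [grad, nodalCubic, pderiv_X, Derivation.leibniz, Derivation.leibniz_pow] <;>
    ring

lemma grad_dualQuartic (a b : ℂ) (P : Fin 3 → ℂ) : grad (dualQuartic a b) P =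
    ![2 * P 0 * P 1 ^ 2 + 12 * b * (P 0 ^ 2 * P 2) + 18 * a * b * (P 1 * P 2 ^ 2),
      2 * P 0 ^ 2 * P 1 + 12 * a * (P 2 * P 1 ^ 2) + 18 * a * b * (P 0 * P 2 ^ 2),
      4 * a * P 1 ^ 3 + 4 * b * P 0 ^ 3 - 108 * a ^ 2 * b ^ 2 * P 2 ^ 3
        + 36 * a * b * (P 0 * P 1 * P 2)] := by
  ext i
  fin_cases i <;>
    simp [grad, dualQuartic, pderiv_X, Derivation.leibniz, Derivation.leibniz_pow] <;>
    ring

lemma grad_nodalPoint (a b s t : ℂ) :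
    grad (nodalCubic a b) (nodalPoint a b s t) = (s * t) • nodalTangent a b s t := by
  rw [grad_nodalCubic]
  ext i
  fin_cases i <;> simp only [nodalPoint, nodalTangent, Pi.smul_apply, smul_eq_mul,
    Matrix.cons_val, Fin.zero_eta, Fin.mk_one, Fin.reduceFinMk] <;> ring

lemma grad_nodalTangent (a b s t : ℂ) :
    grad (dualQuartic a b) (nodalTangent a b s t)
      = (4 * (a * s ^ 3 + b * t ^ 3) ^ 3) • nodalPoint a b s t := by
  rw [grad_dualQuartic]
  ext i
  fin_cases i <;> simp only [nodalPoint, nodalTangent, Pi.smul_apply, smul_eq_mul,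
    Matrix.cons_val, Fin.zero_eta, Fin.mk_one, Fin.reduceFinMk] <;> ring

lemma eval_nodalPoint (a b s t : ℂ) : eval (nodalPoint a b s t) (nodalCubic a b) = 0 := by
  rw [eval_nodalCubic]
  simp only [nodalPoint, Matrix.cons_val]
  ring

lemma eval_nodalTangent (a b s t : ℂ) : eval (nodalTangent a b s t) (dualQuartic a b) = 0 := by
  rw [eval_dualQuartic]
  simp only [nodalTangent, Matrix.cons_val]
  ring

lemma eval_grad_nodalCubic {a b : ℂ} {P : Fin 3 → ℂ} (h : eval P (nodalCubic a b) = 0) :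
    eval (grad (nodalCubic a b) P) (dualQuartic a b) = 0 := by
  rw [eval_nodalCubic] at h
  rw [eval_dualQuartic, grad_nodalCubic]
  simp only [Matrix.cons_val]
  linear_combination (108 * P 0 ^ 4 * P 1 * a ^ 2 * b + 9 * P 0 ^ 3 * P 2 ^ 2 * a
    + 108 * P 0 ^ 2 * P 1 ^ 2 * P 2 * a * b + 108 * P 0 * P 1 ^ 4 * a * b ^ 2
    + P 0 * P 1 * P 2 ^ 3 + 9 * P 1 ^ 3 * P 2 ^ 2 * b) * h

lemma eval_grad_dualQuartic {a b : ℂ} {P : Fin 3 → ℂ} (h : eval P (dualQuartic a b) = 0) :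
    eval (grad (dualQuartic a b) P) (nodalCubic a b) = 0 := by
  rw [eval_dualQuartic] at h
  rw [eval_nodalCubic, grad_dualQuartic]
  simp only [Matrix.cons_val]
  linear_combination (24 * P 0 ^ 4 * P 1 * b + 648 * P 0 ^ 3 * P 2 ^ 2 * a * b ^ 2
    + 432 * P 0 ^ 2 * P 1 ^ 2 * P 2 * a * b + 24 * P 0 * P 1 ^ 4 * a
    + 1296 * P 0 * P 1 * P 2 ^ 3 * a ^ 2 * b ^ 2 + 648 * P 1 ^ 3 * P 2 ^ 2 * a ^ 2 * b) * h

/-- The factorization of a complex cubic polynomial. -/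
lemma exists_roots_of_cubic (A B D E : ℂ) (hA : A ≠ 0) : ∃ x y z : ℂ,
    B = A * -(x + y + z) ∧ D = A * (x * y + x * z + y * z) ∧ E = A * -(x * y * z) := by
  let P : Cubic ℂ := ⟨A, B, D, E⟩
  have hs : (P.toPoly.map (RingHom.id ℂ)).Splits := IsAlgClosed.splits _
  obtain ⟨x, y, z, h⟩ := (Cubic.splits_iff_roots_eq_three (P := P) (φ := RingHom.id ℂ) hA).1 hs
  exact ⟨x, y, z, Cubic.b_eq_three_roots (P := P) hA h, Cubic.c_eq_three_roots (P := P) hA h,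
    Cubic.d_eq_three_roots (P := P) hA h⟩

/-- The zeros of the dual quartic are the multiples of the tangents of the cubic. -/
lemma exists_nodalTangent {a b : ℂ} (ha : a ≠ 0) (hb : b ≠ 0) {u : Fin 3 → ℂ}
    (hu : eval u (dualQuartic a b) = 0) : ∃ k s t : ℂ, u = k • nodalTangent a b s t := by
  rw [eval_dualQuartic] at hu
  by_cases hz : u 2 = 0
  · rw [hz] at hu
    have h1 : u 0 ^ 2 * u 1 ^ 2 = 0 := by linear_combination hu
    rcases mul_eq_zero.1 h1 with h | h
    · have h0 : u 0 = 0 := by simpa using h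
      refine ⟨-(u 1 / a), 1, 0, ?_⟩
      ext i
      fin_cases i <;> simp [nodalTangent, h0, hz, ha]
    · have h0 : u 1 = 0 := by simpa using h
      refine ⟨-(u 0 / b), 0, 1, ?_⟩
      ext i
      fin_cases i <;> simp [nodalTangent, h0, hz, hb]
  · -- The discriminant of `-b Z t³ + Y t² + X t - a Z` vanishes, so this cubic has a double root.
    have hA : -b * u 2 ≠ 0 := mul_ne_zero (neg_ne_zero.2 hb) hz
    obtain ⟨x, y, z, h1, h2, h3⟩ := exists_roots_of_cubic (-b * u 2) (u 1) (u 0) (-a * u 2) hA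
    have hdisc : ((-b * u 2) ^ 2 * ((x - y) * (x - z) * (y - z))) ^ 2 = 0 := by
      have h4 : ((-b * u 2) ^ 2 * ((x - y) * (x - z) * (y - z))) ^ 2
          = u 1 ^ 2 * u 0 ^ 2 - 4 * (-b * u 2) * u 0 ^ 3 - 4 * u 1 ^ 3 * (-a * u 2)
            - 27 * (-b * u 2) ^ 2 * (-a * u 2) ^ 2 + 18 * (-b * u 2) * u 1 * u 0 * (-a * u 2) := by
        rw [h3, h2, h1]; ring
      rw [h4]
      linear_combination hu
    obtain ⟨τ, σ, e1, e2, e3⟩ : ∃ τ σ : ℂ, u 1 = -b * u 2 * -(2 * τ + σ) ∧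
        u 0 = -b * u 2 * (τ ^ 2 + 2 * τ * σ) ∧ -a * u 2 = -b * u 2 * -(τ ^ 2 * σ) := by
      have h5 := (mul_eq_zero.1 (pow_eq_zero_iff two_ne_zero |>.1 hdisc)).resolve_left
        (pow_ne_zero 2 hA)
      rcases mul_eq_zero.1 h5 with h5 | h5
      · rcases mul_eq_zero.1 h5 with h5 | h5
        · rw [sub_eq_zero] at h5
          exact ⟨x, z, by rw [h1, ← h5]; ring, by rw [h2, ← h5]; ring, by rw [h3, ← h5]; ring⟩
        · rw [sub_eq_zero] at h5
          exact ⟨x, y, by rw [h1, ← h5]; ring, by rw [h2, ← h5]; ring, by rw [h3, ← h5]; ring⟩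
      · rw [sub_eq_zero] at h5
        exact ⟨y, x, by rw [h1, ← h5]; ring, by rw [h2, ← h5]; ring, by rw [h3, ← h5]; ring⟩
    have ea : a = -(b * (τ ^ 2 * σ)) := by
      have : u 2 * (a + b * (τ ^ 2 * σ)) = 0 := by linear_combination -e3
      linear_combination (mul_eq_zero.1 this).resolve_left hz
    have hτ : τ ≠ 0 := by
      rintro rfl
      apply ha
      rw [ea]; ring
    refine ⟨u 2 / τ ^ 2, 1, τ, ?_⟩
    ext i
    fin_cases i <;> simp only [nodalTangent, Pi.smul_apply, smul_eq_mul,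
      Matrix.cons_val, Fin.zero_eta, Fin.mk_one, Fin.reduceFinMk]
    · rw [e2, ea]; field_simp; ring
    · rw [e1, ea]; field_simp; ring
    · field_simp

/-- The zeros of the nodal cubic are given by its parametrization. -/
lemma exists_nodalPoint {a b : ℂ} (ha : a ≠ 0) (hb : b ≠ 0) {u : Fin 3 → ℂ}
    (hu : eval u (nodalCubic a b) = 0) : ∃ k s t : ℂ, u = k • nodalPoint a b s t := by
  rw [eval_nodalCubic] at hu
  by_cases h : u 0 * u 1 = 0
  · have h01 : u 0 = 0 ∧ u 1 = 0 := by
      rcases mul_eq_zero.1 h with h | h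
      · refine ⟨h, ?_⟩
        rw [h] at hu
        simpa [hb] using hu
      · refine ⟨?_, h⟩
        rw [h] at hu
        simpa [ha] using hu
    refine ⟨-(u 2 / a), 1, 0, ?_⟩
    ext i
    fin_cases i <;> simp [nodalPoint, h01, ha]
  · refine ⟨(u 0 * u 1)⁻¹, u 0, u 1, ?_⟩
    ext i
    fin_cases i <;> simp only [nodalPoint, Pi.smul_apply, smul_eq_mul,
      Matrix.cons_val, Fin.zero_eta, Fin.mk_one, Fin.reduceFinMk]
    · field_simp [left_ne_zero_of_mul h, right_ne_zero_of_mul h]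
    · field_simp [left_ne_zero_of_mul h, right_ne_zero_of_mul h]
    · rw [eq_inv_mul_iff_mul_eq₀ h]
      linear_combination hu

lemma isHomogeneous_eval_eq_zero_of_smul {G : MvPolynomial (Fin 3) ℂ} {d : ℕ}
    (hG : G.IsHomogeneous d) {c : ℂ} (hc : c ≠ 0) {u : Fin 3 → ℂ} (h : eval (c • u) G = 0) :
    eval u G = 0 := by
  rw [eval_smul_of_isHomogeneous hG] at h
  exact (mul_eq_zero.1 h).resolve_left (pow_ne_zero _ hc)

/-- A binary polynomial that vanishes outside the zeros of a nonzero polynomial is zero. -/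
lemma eval_eq_zero_of_forall_ne {K N : MvPolynomial (Fin 2) ℂ} (hN : N ≠ 0)
    (h : ∀ y, eval y N ≠ 0 → eval y K = 0) (y : Fin 2 → ℂ) : eval y K = 0 := by
  have : K * N = 0 := by
    refine MvPolynomial.funext fun y => ?_
    rw [map_mul, map_zero]
    by_cases hy : eval y N = 0
    · rw [hy, mul_zero]
    · rw [h y hy, zero_mul]
  rw [(mul_eq_zero.1 this).resolve_right hN, map_zero]

/-- The tangents at the smooth points of the parametrization, where `s t ≠ 0`, are dense in the
parametrized quartic. -/
lemma mem_dualCurve_nodalCubic {a b : ℂ} (ha : a ≠ 0) (hb : b ≠ 0) {u : Fin 3 → ℂ} :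
    u ∈ dualCurve (nodalCubic a b) ↔ u ≠ 0 ∧ eval u (dualQuartic a b) = 0 := by
  refine ⟨fun hu => ⟨hu.1, eval_eq_zero_of_mem_dualCurve (isHomogeneous_dualQuartic a b)
    (fun P hP => eval_grad_nodalCubic hP) hu⟩, fun ⟨hu0, hu⟩ => ⟨hu0, fun d G hG hvan => ?_⟩⟩
  obtain ⟨k, s, t, rfl⟩ := exists_nodalTangent ha hb hu
  rw [eval_smul_of_isHomogeneous hG]
  let D : Fin 3 → MvPolynomial (Fin 2) ℂ :=
    ![C (2 * a) * X 0 ^ 3 * X 1 - C b * X 1 ^ 4, C (2 * b) * X 0 * X 1 ^ 3 - C a * X 0 ^ 4,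
      X 0 ^ 2 * X 1 ^ 2]
  have hD : ∀ y, eval y (bind₁ D G) = eval (nodalTangent a b (y 0) (y 1)) G := by
    intro y
    rw [eval_bind]
    congr 2
    ext i
    fin_cases i <;> simp [D, nodalTangent]
  have hN : (X 0 * X 1 : MvPolynomial (Fin 2) ℂ) ≠ 0 := mul_ne_zero (X_ne_zero 0) (X_ne_zero 1)
  have := eval_eq_zero_of_forall_ne (K := bind₁ D G) hN (fun y hy => ?_) ![s, t]
  · rw [hD] at this
    exact mul_eq_zero_of_right _ this
  · rw [map_mul, eval_X, eval_X] at hy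
    rw [hD]
    have hT : nodalTangent a b (y 0) (y 1) ≠ 0 := fun h => by
      have := congrFun h 2
      simp only [nodalTangent, Matrix.cons_val, Pi.zero_apply] at this
      exact hy (pow_eq_zero_iff two_ne_zero |>.1 (by rw [mul_pow]; exact this))
    refine isHomogeneous_eval_eq_zero_of_smul hG hy ?_
    rw [← grad_nodalPoint]
    refine hvan _ (fun h => ?_) (eval_nodalPoint _ _ _ _) ?_
    · have := congrFun h 0
      simp only [nodalPoint, Matrix.cons_val, Pi.zero_apply] at this
      exact hy (by simpa using this)
    · rw [grad_nodalPoint]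
      exact smul_ne_zero hy hT

/-- The quartic parametrized by `nodalTangent` is smooth where `a s³ + b t³ ≠ 0`; the tangents at
these points are dense in the cubic. -/
lemma mem_dualCurve_dualQuartic {a b : ℂ} (ha : a ≠ 0) (hb : b ≠ 0) {u : Fin 3 → ℂ} :
    u ∈ dualCurve (dualQuartic a b) ↔ u ≠ 0 ∧ eval u (nodalCubic a b) = 0 := by
  refine ⟨fun hu => ⟨hu.1, eval_eq_zero_of_mem_dualCurve (isHomogeneous_nodalCubic a b)
    (fun P hP => eval_grad_dualQuartic hP) hu⟩, fun ⟨hu0, hu⟩ => ⟨hu0, fun d G hG hvan => ?_⟩⟩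
  obtain ⟨k, s, t, rfl⟩ := exists_nodalPoint ha hb hu
  rw [eval_smul_of_isHomogeneous hG]
  let D : Fin 3 → MvPolynomial (Fin 2) ℂ :=
    ![X 0 ^ 2 * X 1, X 0 * X 1 ^ 2, -(C a * X 0 ^ 3 + C b * X 1 ^ 3)]
  have hD : ∀ y, eval y (bind₁ D G) = eval (nodalPoint a b (y 0) (y 1)) G := by
    intro y
    rw [eval_bind]
    congr 2
    ext i
    fin_cases i <;> simp [D, nodalPoint]
  have hN : (X 0 * X 1 * (C a * X 0 ^ 3 + C b * X 1 ^ 3) : MvPolynomial (Fin 2) ℂ) ≠ 0 := by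
    refine mul_ne_zero (mul_ne_zero (X_ne_zero 0) (X_ne_zero 1)) fun h => ha ?_
    have := congrArg (eval ![1, 0]) h
    simpa using this
  have := eval_eq_zero_of_forall_ne (K := bind₁ D G) hN (fun y hy => ?_) ![s, t]
  · rw [hD] at this
    exact mul_eq_zero_of_right _ this
  · simp only [map_mul, eval_X, map_add, eval_C, map_pow] at hy
    have hy1 := left_ne_zero_of_mul hy
    have hc : (4 * (a * y 0 ^ 3 + b * y 1 ^ 3) ^ 3 : ℂ) ≠ 0 :=
      mul_ne_zero (by norm_num) (pow_ne_zero _ (right_ne_zero_of_mul hy))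
    rw [hD]
    refine isHomogeneous_eval_eq_zero_of_smul hG hc ?_
    rw [← grad_nodalTangent]
    refine hvan _ (fun h => ?_) (eval_nodalTangent _ _ _ _) ?_
    · have := congrFun h 2
      simp only [nodalTangent, Matrix.cons_val, Pi.zero_apply] at this
      exact hy1 (pow_eq_zero_iff two_ne_zero |>.1 (by rw [mul_pow]; exact this))
    · rw [grad_nodalTangent]
      refine smul_ne_zero hc fun h => ?_
      have := congrFun h 0
      simp only [nodalPoint, Matrix.cons_val, Pi.zero_apply] at this
      exact hy1 (by simpa using this)

/-- The parametrization of the dual quartic in the chart `s = 1`, as polynomials in `t`. -/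
def tangentPoly (a b : ℂ) : Fin 3 → Polynomial ℂ :=
  ![Polynomial.C (2 * a) * Polynomial.X - Polynomial.C b * Polynomial.X ^ 4,
    Polynomial.C (2 * b) * Polynomial.X ^ 3 - Polynomial.C a, Polynomial.X ^ 2]

lemma eval_aeval_tangentPoly (a b : ℂ) (p : MvPolynomial (Fin 3) ℂ) (τ : ℂ) :
    (aeval (tangentPoly a b) p).eval τ = eval (nodalTangent a b 1 τ) p := by
  rw [← Polynomial.coe_aeval_eq_eval, comp_aeval_apply, ← aeval_eq_eval]
  congr 2
  ext i
  fin_cases i <;> simp [tangentPoly, nodalTangent]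

/-- The dual quartic lies on no cubic: the cubic monomials are linearly independent on the
parametrization. -/
lemma eq_zero_of_isHomogeneous_three {a b : ℂ} (ha : a ≠ 0) (hb : b ≠ 0)
    {p : MvPolynomial (Fin 3) ℂ} (hp : p.IsHomogeneous 3)
    (h : aeval (tangentPoly a b) p = 0) : p = 0 := by
  obtain ⟨c, hc⟩ := exists_cubic_eq hp
  let Q : Polynomial ℂ :=
    Polynomial.C (-b ^ 3 * c 0) * Polynomial.X ^ 12
    + Polynomial.C (2 * b ^ 3 * c 1) * Polynomial.X ^ 11
    + Polynomial.C (b ^ 2 * c 2 - 4 * b ^ 3 * c 3) * Polynomial.X ^ 10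
    + Polynomial.C (6 * a * b ^ 2 * c 0 - 2 * b ^ 2 * c 4 + 8 * b ^ 3 * c 6) * Polynomial.X ^ 9
    + Polynomial.C (-9 * a * b ^ 2 * c 1 - b * c 5 + 4 * b ^ 2 * c 7) * Polynomial.X ^ 8
    + Polynomial.C (-4 * a * b * c 2 + 12 * a * b ^ 2 * c 3 + 2 * b * c 8) * Polynomial.X ^ 7
    + Polynomial.C (-12 * a ^ 2 * b * c 0 + 5 * a * b * c 4 - 12 * a * b ^ 2 * c 6 + c 9)
      * Polynomial.X ^ 6
    + Polynomial.C (12 * a ^ 2 * b * c 1 + 2 * a * c 5 - 4 * a * b * c 7) * Polynomial.X ^ 5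
    + Polynomial.C (4 * a ^ 2 * c 2 - 9 * a ^ 2 * b * c 3 - a * c 8) * Polynomial.X ^ 4
    + Polynomial.C (8 * a ^ 3 * c 0 - 2 * a ^ 2 * c 4 + 6 * a ^ 2 * b * c 6) * Polynomial.X ^ 3
    + Polynomial.C (-4 * a ^ 3 * c 1 + a ^ 2 * c 7) * Polynomial.X ^ 2
    + Polynomial.C (2 * a ^ 3 * c 3) * Polynomial.X
    + Polynomial.C (-a ^ 3 * c 6)
  have hQ : Q = 0 := by
    rw [← h]
    refine Polynomial.funext fun τ => ?_
    rw [eval_aeval_tangentPoly, hc]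
    simp only [Q, nodalTangent, Matrix.cons_val, Polynomial.eval_add, Polynomial.eval_mul,
      Polynomial.eval_C, Polynomial.eval_pow, Polynomial.eval_X]
    ring
  have hk : ∀ k, Q.coeff k = 0 := fun k => by rw [hQ, Polynomial.coeff_zero]
  have hcoeff : ∀ k, Q.coeff k = _ := fun k => by
    simp only [Q, Polynomial.coeff_add, Polynomial.coeff_C_mul, Polynomial.coeff_X_pow,
      Polynomial.coeff_X, Polynomial.coeff_C]
    rfl
  have hb2 : b ^ 2 ≠ 0 := pow_ne_zero 2 hb
  have ha2 : a ^ 2 ≠ 0 := pow_ne_zero 2 ha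
  have cancel : ∀ {x y : ℂ}, x ≠ 0 → x * y = 0 → y = 0 := fun hx h =>
    (mul_eq_zero.1 h).resolve_left hx
  have e : ∀ k, _ := fun k => (hcoeff k).symm.trans (hk k)
  have e0 := e 0
  have e1 := e 1
  have e2 := e 2
  have e6 := e 6
  have e7 := e 7
  have e8 := e 8
  have e9 := e 9
  have e10 := e 10
  have e11 := e 11
  have e12 := e 12
  norm_num at e0 e1 e2 e6 e7 e8 e9 e10 e11 e12
  replace e0 := e0.resolve_left ha
  replace e1 := e1.resolve_left ha
  replace e11 := e11.resolve_left hb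
  replace e12 := e12.resolve_left hb
  have c2 : c 2 = 0 := cancel hb2 (by rw [e1] at e10; linear_combination e10)
  have c4 : c 4 = 0 := cancel hb2 (by rw [e12, e0] at e9; linear_combination -e9 / 2)
  have c7 : c 7 = 0 := cancel ha2 (by rw [e11] at e2; linear_combination e2)
  have c5 : c 5 = 0 := cancel hb (by rw [e11, c7] at e8; linear_combination -e8)
  have c8 : c 8 = 0 := cancel hb (by rw [c2, e1] at e7; linear_combination e7 / 2)
  have c9 : c 9 = 0 := by rw [e12, c4, e0] at e6; linear_combination e6
  refine MvPolynomial.funext fun P => ?_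
  rw [hc, e12, e11, c2, e1, c4, c5, e0, c7, c8, c9, map_zero]
  ring

lemma eq_zero_of_isHomogeneous_le_three {a b : ℂ} (ha : a ≠ 0) (hb : b ≠ 0) {m : ℕ} (hm : m ≤ 3)
    {p : MvPolynomial (Fin 3) ℂ} (hp : p.IsHomogeneous m)
    (h : aeval (tangentPoly a b) p = 0) : p = 0 := by
  have h1 : (p * X 2 ^ (3 - m)).IsHomogeneous 3 := by
    have := hp.mul (isHomogeneous_X_pow (R := ℂ) (2 : Fin 3) (3 - m))
    rwa [Nat.add_sub_cancel' hm] at this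
  have h2 := eq_zero_of_isHomogeneous_three ha hb h1 (by rw [map_mul, h, zero_mul])
  exact (mul_eq_zero.1 h2).resolve_right (pow_ne_zero _ (X_ne_zero 2))

/-- The polynomials that vanish on the parametrization form a prime ideal, which contains no nonzero
forms of degree less than `4`. -/
lemma irreducible_dualQuartic {a b : ℂ} (ha : a ≠ 0) (hb : b ≠ 0) :
    Irreducible (dualQuartic a b) := by
  have h0 : dualQuartic a b ≠ 0 := by
    intro h0
    have := congrArg (eval ![1, 1, 0]) h0
    simp [eval_dualQuartic] at this
  refine ⟨not_isUnit_of_isHomogeneous (isHomogeneous_dualQuartic a b) four_ne_zero,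
    fun p q hpq => ?_⟩
  by_contra hu
  push Not at hu
  have hh := isHomogeneous_dualQuartic a b
  rw [hpq] at hh h0
  obtain ⟨m, n, hm, hn, hmn⟩ := isHomogeneous_mul_split hh h0
  have hm0 : m ≠ 0 := by
    rintro rfl
    exact hu.1 (isUnit_of_isHomogeneous_zero hm (left_ne_zero_of_mul h0))
  have hn0 : n ≠ 0 := by
    rintro rfl
    exact hu.2 (isUnit_of_isHomogeneous_zero hn (right_ne_zero_of_mul h0))
  have hv : aeval (tangentPoly a b) (p * q) = 0 := by
    refine Polynomial.funext fun τ => ?_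
    rw [← hpq, eval_aeval_tangentPoly, eval_nodalTangent, Polynomial.eval_zero]
  rw [map_mul] at hv
  rcases mul_eq_zero.1 hv with h | h
  · exact left_ne_zero_of_mul h0 (eq_zero_of_isHomogeneous_le_three ha hb (by omega) hm h)
  · exact right_ne_zero_of_mul h0 (eq_zero_of_isHomogeneous_le_three ha hb (by omega) hn h)

/-! ### Expansion of the sums over tuples of indices -/

/-- A sum over tuples of indices as the sum over an explicit list of these tuples. For numerical
lists the hypothesis `h` is decidable. -/
lemma dsum_eq_list {M : Type*} [AddCommMonoid M]
    {R : Fin 5 → Fin 5 → Fin 5 → Fin 5 → Fin 5 → Prop}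
    [∀ i j k l m, Decidable (R i j k l m)] (F : Fin 5 → Fin 5 → Fin 5 → Fin 5 → Fin 5 → M)
    (s : List (Fin 5 × Fin 5 × Fin 5 × Fin 5 × Fin 5))
    (h : (Finset.univ.filter fun x : Fin 5 × Fin 5 × Fin 5 × Fin 5 × Fin 5 =>
      [x.1, x.2.1, x.2.2.1, x.2.2.2.1, x.2.2.2.2].Nodup ∧
        R x.1 x.2.1 x.2.2.1 x.2.2.2.1 x.2.2.2.2).val = ↑s) :
    dsum R F = (s.map fun x => F x.1 x.2.1 x.2.2.1 x.2.2.2.1 x.2.2.2.2).sum := by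
  have h1 : dsum R F = ∑ x ∈ Finset.univ.filter fun x : Fin 5 × Fin 5 × Fin 5 × Fin 5 × Fin 5 =>
      [x.1, x.2.1, x.2.2.1, x.2.2.2.1, x.2.2.2.2].Nodup ∧ R x.1 x.2.1 x.2.2.1 x.2.2.2.1 x.2.2.2.2,
      F x.1 x.2.1 x.2.2.1 x.2.2.2.1 x.2.2.2.2 := by
    rw [Finset.sum_filter]
    simp only [dsum, Fintype.sum_prod_type]
  rw [h1, Finset.sum, h, Multiset.map_coe, Multiset.sum_coe]

lemma sum32_eq (F : Fin 5 → Fin 5 → Fin 5 → Fin 5 → Fin 5 → ℂ) :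
    sum32 F =
      F 0 1 2 3 4 + F 0 1 3 2 4 + F 0 1 4 2 3 + F 0 2 3 1 4 + F 0 2 4 1 3 + F 0 3 4 1 2 +
      F 1 2 3 0 4 + F 1 2 4 0 3 + F 1 3 4 0 2 + F 2 3 4 0 1 := by
  rw [sum32, dsum_eq_list F
      [(0, 1, 2, 3, 4), (0, 1, 3, 2, 4), (0, 1, 4, 2, 3), (0, 2, 3, 1, 4), (0, 2, 4, 1, 3),
      (0, 3, 4, 1, 2), (1, 2, 3, 0, 4), (1, 2, 4, 0, 3), (1, 3, 4, 0, 2), (2, 3, 4, 0, 1)]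
      (by decide +kernel)]
  simp only [List.map_cons, List.map_nil, List.sum_cons, List.sum_nil, add_zero, add_assoc]

lemma sum23_eq (F : Fin 5 → Fin 5 → Fin 5 → Fin 5 → Fin 5 → ℂ) :
    sum23 F =
      F 0 1 2 3 4 + F 0 2 1 3 4 + F 0 3 1 2 4 + F 0 4 1 2 3 + F 1 2 0 3 4 + F 1 3 0 2 4 +
      F 1 4 0 2 3 + F 2 3 0 1 4 + F 2 4 0 1 3 + F 3 4 0 1 2 := by
  rw [sum23, dsum_eq_list F
      [(0, 1, 2, 3, 4), (0, 2, 1, 3, 4), (0, 3, 1, 2, 4), (0, 4, 1, 2, 3), (1, 2, 0, 3, 4),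
      (1, 3, 0, 2, 4), (1, 4, 0, 2, 3), (2, 3, 0, 1, 4), (2, 4, 0, 1, 3), (3, 4, 0, 1, 2)]
      (by decide +kernel)]
  simp only [List.map_cons, List.map_nil, List.sum_cons, List.sum_nil, add_zero, add_assoc]

lemma sum14_eq (F : Fin 5 → Fin 5 → Fin 5 → Fin 5 → Fin 5 → ℂ) :
    sum14 F =
      F 0 1 2 3 4 + F 1 0 2 3 4 + F 2 0 1 3 4 + F 3 0 1 2 4 + F 4 0 1 2 3 := by
  rw [sum14, dsum_eq_list F
      [(0, 1, 2, 3, 4), (1, 0, 2, 3, 4), (2, 0, 1, 3, 4), (3, 0, 1, 2, 4), (4, 0, 1, 2, 3)]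
      (by decide +kernel)]
  simp only [List.map_cons, List.map_nil, List.sum_cons, List.sum_nil, add_zero, add_assoc]

lemma dsum_cycU_eq (F : Fin 5 → Fin 5 → Fin 5 → Fin 5 → Fin 5 → ℂ) :
    dsum (fun i j k l m => (i < j ∧ j < k ∧ k < l) ∧ (i < m ∧ m < l)) F =
      F 0 1 2 4 3 + F 0 1 3 4 2 + F 0 2 3 4 1 := by
  rw [dsum_eq_list F
      [(0, 1, 2, 4, 3), (0, 1, 3, 4, 2), (0, 2, 3, 4, 1)]
      (by decide +kernel)]
  simp only [List.map_cons, List.map_nil, List.sum_cons, List.sum_nil, add_zero, add_assoc]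

lemma dsum_cycV_eq (F : Fin 5 → Fin 5 → Fin 5 → Fin 5 → Fin 5 → ℂ) :
    dsum (fun i j k l m => (i < j ∧ j < k) ∧ l < m ∧ i < m ∧ l < k) F =
      F 0 1 3 2 4 + F 0 1 4 2 3 + F 0 2 3 1 4 + F 0 2 4 1 3 + F 0 3 4 1 2 + F 1 2 3 0 4 +
      F 1 2 4 0 3 + F 1 3 4 0 2 := by
  rw [dsum_eq_list F
      [(0, 1, 3, 2, 4), (0, 1, 4, 2, 3), (0, 2, 3, 1, 4), (0, 2, 4, 1, 3), (0, 3, 4, 1, 2),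
      (1, 2, 3, 0, 4), (1, 2, 4, 0, 3), (1, 3, 4, 0, 2)]
      (by decide +kernel)]
  simp only [List.map_cons, List.map_nil, List.sum_cons, List.sum_nil, add_zero, add_assoc]

lemma dsum_norm_norm_eq (F : Fin 5 → Fin 5 → Fin 5 → Fin 5 → Fin 5 → ℂ) :
    dsum (fun _ j k l m => (j < k ∧ k < m) ∧ l < m) F =
      F 0 1 2 3 4 + F 0 1 3 2 4 + F 0 2 3 1 4 + F 1 0 2 3 4 + F 1 0 3 2 4 + F 1 2 3 0 4 +
      F 2 0 1 3 4 + F 2 0 3 1 4 + F 2 1 3 0 4 + F 3 0 1 2 4 + F 3 0 2 1 4 + F 3 1 2 0 4 +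
      F 4 0 1 2 3 + F 4 0 2 1 3 + F 4 1 2 0 3 := by
  rw [dsum_eq_list F
      [(0, 1, 2, 3, 4), (0, 1, 3, 2, 4), (0, 2, 3, 1, 4), (1, 0, 2, 3, 4), (1, 0, 3, 2, 4),
      (1, 2, 3, 0, 4), (2, 0, 1, 3, 4), (2, 0, 3, 1, 4), (2, 1, 3, 0, 4), (3, 0, 1, 2, 4),
      (3, 0, 2, 1, 4), (3, 1, 2, 0, 4), (4, 0, 1, 2, 3), (4, 0, 2, 1, 3), (4, 1, 2, 0, 3)]
      (by decide +kernel)]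
  simp only [List.map_cons, List.map_nil, List.sum_cons, List.sum_nil, add_zero, add_assoc]

lemma dsum_path_path_eq (F : Fin 5 → Fin 5 → Fin 5 → Fin 5 → Fin 5 → ℂ) :
    dsum (fun _ j k l m => (j < k ∧ k < l) ∧ (j < m ∧ m < l)) F =
      F 0 1 2 4 3 + F 0 1 3 4 2 + F 1 0 2 4 3 + F 1 0 3 4 2 + F 2 0 1 4 3 + F 2 0 3 4 1 +
      F 3 0 1 4 2 + F 3 0 2 4 1 + F 4 0 1 3 2 + F 4 0 2 3 1 := by
  rw [dsum_eq_list F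
      [(0, 1, 2, 4, 3), (0, 1, 3, 4, 2), (1, 0, 2, 4, 3), (1, 0, 3, 4, 2), (2, 0, 1, 4, 3),
      (2, 0, 3, 4, 1), (3, 0, 1, 4, 2), (3, 0, 2, 4, 1), (4, 0, 1, 3, 2), (4, 0, 2, 3, 1)]
      (by decide +kernel)]
  simp only [List.map_cons, List.map_nil, List.sum_cons, List.sum_nil, add_zero, add_assoc]

lemma dsum_square_eq (F : Fin 5 → Fin 5 → Fin 5 → Fin 5 → Fin 5 → ℂ) :
    dsum (fun _ j k l m => j < k ∧ (l < k ∧ k < m)) F =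
      F 0 1 3 2 4 + F 0 2 3 1 4 + F 1 0 3 2 4 + F 1 2 3 0 4 + F 2 0 3 1 4 + F 2 1 3 0 4 +
      F 3 0 2 1 4 + F 3 1 2 0 4 + F 4 0 2 1 3 + F 4 1 2 0 3 := by
  rw [dsum_eq_list F
      [(0, 1, 3, 2, 4), (0, 2, 3, 1, 4), (1, 0, 3, 2, 4), (1, 2, 3, 0, 4), (2, 0, 3, 1, 4),
      (2, 1, 3, 0, 4), (3, 0, 2, 1, 4), (3, 1, 2, 0, 4), (4, 0, 2, 1, 3), (4, 1, 2, 0, 3)]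
      (by decide +kernel)]
  simp only [List.map_cons, List.map_nil, List.sum_cons, List.sum_nil, add_zero, add_assoc]

lemma sum2_eq (F : Fin 5 → Fin 5 → ℂ) : sum2 F =
      F 0 1 + F 0 2 + F 0 3 + F 0 4 + F 1 2 + F 1 3 + F 1 4 + F 2 3 + F 2 4 + F 3 4 := by
  simp [sum2, Fin.sum_univ_five]
  ring

lemma sum3_eq (F : Fin 5 → Fin 5 → Fin 5 → ℂ) : sum3 F =
      F 0 1 2 + F 0 1 3 + F 0 1 4 + F 0 2 3 + F 0 2 4 + F 0 3 4 + F 1 2 3 + F 1 2 4 + F 1 3 4 +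
      F 2 3 4 := by
  simp [sum3, Fin.sum_univ_five]
  ring

lemma sum4_eq (F : Fin 5 → Fin 5 → Fin 5 → Fin 5 → ℂ) : sum4 F =
      F 0 1 2 3 + F 0 1 2 4 + F 0 1 3 4 + F 0 2 3 4 + F 1 2 3 4 := by
  simp [sum4, Fin.sum_univ_five]

/-! ### The coefficients of the Kippenhahn polynomial -/

/-
The determinant is expanded over independent variables: `L` and `M` stand for the eigenvalues and
their conjugates, `a` and `b` for the entries above the diagonal and their conjugates, and `w`, `w'`
for `(x + i y) / 2` and `(x - i y) / 2`. The following sums are the coefficients in these variables.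
-/

section Coefficients

variable (L M : Fin 5 → ℂ) (a b : Fin 5 → Fin 5 → ℂ)

/-- The sum of the `2`-cycles `a_ln b_ln`. -/
def polA : ℂ := sum2 fun l n => a l n * b l n

/-- The coefficient of `z² w'` in the cofactor of `-w w'`; the one of `z² w` is `polB M b a`. -/
def polB : ℂ := sum32 (fun i j k l n => a l n * b l n * (L i + L j + L k))
  - sum3 fun k l n => a k l * a l n * b k n

/-- The coefficient of `z w'²` in the cofactor of `-w w'`; the one of `z w²` is `polC M b a`. -/
def polC : ℂ := sum32 (fun i j k l n => a l n * b l n * (L i * L j + L i * L k + L j * L k))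
  - sum23 (fun i j k l n => (L i + L j) * (a k l * a l n * b k n))
  + sum4 fun j k l n => a j k * a k l * a l n * b j n

/-- The coefficient of `w'³` in the cofactor of `-w w'`; the one of `w³` is `polD M b a`. -/
def polD : ℂ := sum32 (fun i j k l n => a l n * b l n * (L i * L j * L k))
  - sum23 (fun i j k l n => L i * L j * (a k l * a l n * b k n))
  + sum14 (fun i j k l n => a j k * a k l * a l n * b j n * L i)
  - a 0 1 * a 1 2 * a 2 3 * a 3 4 * b 0 4

/-- The sum `U` with independent entries `b` in place of the conjugates. -/
def polU : ℂ := dsum (fun i j k l m => (i < j ∧ j < k ∧ k < l) ∧ (i < m ∧ m < l))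
  fun i j k l m => a i j * a j k * a k l * b i m * b m l

/-- The sum `V` with independent entries `b` in place of the conjugates. -/
def polV : ℂ := dsum (fun i j k l m => (i < j ∧ j < k) ∧ l < m ∧ i < m ∧ l < k)
  fun i j k l m => a i j * a j k * a l m * b i m * b l k

/-- The sum of `P_i y_i`, with independent entries `b` in place of the conjugates. -/
def polP (y : Fin 5 → ℂ) : ℂ :=
  dsum (fun _ j k l m => (j < k ∧ k < m) ∧ l < m)
      (fun i j k l m => a j k * b j k * (a l m * b l m) * y i)
    - dsum (fun _ j k l m => (j < k ∧ k < l) ∧ (j < m ∧ m < l))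
      (fun i j k l m => (a j k * a k l * b j m * b m l + b j k * b k l * a j m * a m l) / 2 * y i)
    - dsum (fun _ j k l m => j < k ∧ (l < k ∧ k < m))
      (fun i j k l m => (a j k * a l m * b j m * b l k + b j k * b l m * a j m * a l k) / 2 * y i)

end Coefficients

set_option maxHeartbeats 4000000 in
/-- The determinant of the pencil with independent entries. The cubic cofactor of `-w w'` is written
in the form that specializes to `cofactor`: with `w + w' = x`, `w - w' = i y` and
`4 w w' = x² + y²`, the coefficients of `x³` and `y³` come from the terms with the factors
`4 w w' (w + w')` and `4 w w' (w - w')`, and the last two terms are multiples of `x² y` and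
`x y²`. -/
theorem det_expansion (L M : Fin 5 → ℂ) (a b : Fin 5 → Fin 5 → ℂ) (w w' z : ℂ) :
    (Matrix.of fun i j : Fin 5 => if i = j then z + (M i * w + L i * w') else
      if i < j then w' * a i j else w * b j i).det
    = (∏ i, (z + (M i * w + L i * w'))) - w * w' * (
      polA a b * z ^ 3 + z ^ 2 * (polB M b a * w + polB L a b * w')
      + z * (4 * w * w' * (sum32 (fun i j k l n => a l n * b l n *
          ((L i + M i) / 2 * ((L j + M j) / 2) + (L i + M i) / 2 * ((L k + M k) / 2)
            + (L j + M j) / 2 * ((L k + M k) / 2)))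
        - sum23 (fun i j k l n => (a k l * a l n * b k n + b k l * b l n * a k n) / 2 *
            ((L i + M i) / 2 + (L j + M j) / 2))
        - 1 / 4 * polP a b (fun _ => 1)
        + 1 / 2 * sum4 (fun j k l n =>
          (a j k * a k l * a l n * b j n + b j k * b k l * b l n * a j n) / 2))
        + polC L a b * w' ^ 2 + polC M b a * w ^ 2 - (polC L a b + polC M b a) * w * w')
      + 4 * w * w' * (w + w') * (
        sum32 (fun i j k l n => a l n * b l n *
          ((L i + M i) / 2 * ((L j + M j) / 2) * ((L k + M k) / 2)))
        - sum23 (fun i j k l n => (a k l * a l n * b k n + b k l * b l n * a k n) / 2 *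
            ((L i + M i) / 2 * ((L j + M j) / 2)))
        - 1 / 4 * polP a b (fun i => (L i + M i) / 2)
        + 1 / 2 * sum14 (fun i j k l n =>
          (a j k * a k l * a l n * b j n + b j k * b k l * b l n * a j n) / 2 * ((L i + M i) / 2))
        + 1 / 4 * sum23 (fun i j k l n => (a k l * a l n * b k n + b k l * b l n * a k n) / 2 *
            (a i j * b i j))
        - 1 / 4 * ((polU a b + polU b a) / 2) - 1 / 4 * ((polV a b + polV b a) / 2)
        - 1 / 4 * ((a 0 1 * a 1 2 * a 2 3 * a 3 4 * b 0 4
          + b 0 1 * b 1 2 * b 2 3 * b 3 4 * a 0 4) / 2))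
      - 4 * w * w' * (w - w') * (
        - sum32 (fun i j k l n => a l n * b l n *
          ((L i - M i) / 2 * ((L j - M j) / 2) * ((L k - M k) / 2)))
        + sum23 (fun i j k l n => (a k l * a l n * b k n - b k l * b l n * a k n) / 2 *
            ((L i - M i) / 2 * ((L j - M j) / 2)))
        - 1 / 4 * polP a b (fun i => (L i - M i) / 2)
        - 1 / 2 * sum14 (fun i j k l n =>
          (a j k * a k l * a l n * b j n + b j k * b k l * b l n * a j n) / 2 * ((L i - M i) / 2))
        + 1 / 4 * sum23 (fun i j k l n => (a k l * a l n * b k n - b k l * b l n * a k n) / 2 *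
            (a i j * b i j))
        - 1 / 4 * ((polU a b - polU b a) / 2) - 1 / 4 * ((polV a b - polV b a) / 2)
        + 1 / 4 * ((a 0 1 * a 1 2 * a 2 3 * a 3 4 * b 0 4
          - b 0 1 * b 1 2 * b 2 3 * b 3 4 * a 0 4) / 2))
      - (w + w') ^ 2 * (w - w') * (polD L a b - polD M b a) / 2
      + (w + w') * (w - w') ^ 2 * (polD L a b + polD M b a) / 2) := by
  simp only [polA, polB, polC, polD, polP, polU, polV, sum32_eq, sum23_eq, sum14_eq, sum2_eq,
    sum3_eq, sum4_eq, dsum_cycU_eq, dsum_cycV_eq, dsum_norm_norm_eq, dsum_path_path_eq,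
    dsum_square_eq]
  simp [Matrix.det_succ_row_zero, Fin.sum_univ_succ, Fin.prod_univ_five, Fin.succAbove]
  ring

lemma map_dsum {M N F : Type*} [AddCommMonoid M] [AddCommMonoid N] [FunLike F M N]
    [AddMonoidHomClass F M N] (φ : F) (R : Fin 5 → Fin 5 → Fin 5 → Fin 5 → Fin 5 → Prop)
    [∀ i j k l m, Decidable (R i j k l m)] (G : Fin 5 → Fin 5 → Fin 5 → Fin 5 → Fin 5 → M) :
    φ (dsum R G) = dsum R fun i j k l m => φ (G i j k l m) := by
  simp only [dsum, map_sum, apply_ite φ, map_zero]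

lemma map_sum32 {M N F : Type*} [AddCommMonoid M] [AddCommMonoid N] [FunLike F M N]
    [AddMonoidHomClass F M N] (φ : F) (G : Fin 5 → Fin 5 → Fin 5 → Fin 5 → Fin 5 → M) :
    φ (sum32 G) = sum32 fun i j k l m => φ (G i j k l m) := map_dsum φ _ G

lemma map_sum23 {M N F : Type*} [AddCommMonoid M] [AddCommMonoid N] [FunLike F M N]
    [AddMonoidHomClass F M N] (φ : F) (G : Fin 5 → Fin 5 → Fin 5 → Fin 5 → Fin 5 → M) :
    φ (sum23 G) = sum23 fun i j k l m => φ (G i j k l m) := map_dsum φ _ G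

lemma map_sum14 {M N F : Type*} [AddCommMonoid M] [AddCommMonoid N] [FunLike F M N]
    [AddMonoidHomClass F M N] (φ : F) (G : Fin 5 → Fin 5 → Fin 5 → Fin 5 → Fin 5 → M) :
    φ (sum14 G) = sum14 fun i j k l m => φ (G i j k l m) := map_dsum φ _ G

lemma map_sum2 {M N F : Type*} [AddCommMonoid M] [AddCommMonoid N] [FunLike F M N]
    [AddMonoidHomClass F M N] (φ : F) (G : Fin 5 → Fin 5 → M) :
    φ (sum2 G) = sum2 fun l m => φ (G l m) := by
  simp only [sum2, map_sum, apply_ite φ, map_zero]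

lemma map_sum3 {M N F : Type*} [AddCommMonoid M] [AddCommMonoid N] [FunLike F M N]
    [AddMonoidHomClass F M N] (φ : F) (G : Fin 5 → Fin 5 → Fin 5 → M) :
    φ (sum3 G) = sum3 fun k l m => φ (G k l m) := by
  simp only [sum3, map_sum, apply_ite φ, map_zero]

lemma map_sum4 {M N F : Type*} [AddCommMonoid M] [AddCommMonoid N] [FunLike F M N]
    [AddMonoidHomClass F M N] (φ : F) (G : Fin 5 → Fin 5 → Fin 5 → Fin 5 → M) :
    φ (sum4 G) = sum4 fun j k l m => φ (G j k l m) := by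
  simp only [sum4, map_sum, apply_ite φ, map_zero]

lemma ofReal_sum32 (G : Fin 5 → Fin 5 → Fin 5 → Fin 5 → Fin 5 → ℝ) :
    ((sum32 G : ℝ) : ℂ) = sum32 fun i j k l m => (G i j k l m : ℂ) := map_sum32 Complex.ofRealHom G

lemma ofReal_sum23 (G : Fin 5 → Fin 5 → Fin 5 → Fin 5 → Fin 5 → ℝ) :
    ((sum23 G : ℝ) : ℂ) = sum23 fun i j k l m => (G i j k l m : ℂ) := map_sum23 Complex.ofRealHom G

lemma ofReal_sum14 (G : Fin 5 → Fin 5 → Fin 5 → Fin 5 → Fin 5 → ℝ) :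
    ((sum14 G : ℝ) : ℂ) = sum14 fun i j k l m => (G i j k l m : ℂ) := map_sum14 Complex.ofRealHom G

lemma mul_sum32 (c : ℂ) (G : Fin 5 → Fin 5 → Fin 5 → Fin 5 → Fin 5 → ℂ) :
    c * sum32 G = sum32 fun i j k l m => c * G i j k l m := map_sum32 (AddMonoidHom.mulLeft c) G

lemma mul_sum23 (c : ℂ) (G : Fin 5 → Fin 5 → Fin 5 → Fin 5 → Fin 5 → ℂ) :
    c * sum23 G = sum23 fun i j k l m => c * G i j k l m := map_sum23 (AddMonoidHom.mulLeft c) G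

lemma mul_sum14 (c : ℂ) (G : Fin 5 → Fin 5 → Fin 5 → Fin 5 → Fin 5 → ℂ) :
    c * sum14 G = sum14 fun i j k l m => c * G i j k l m := map_sum14 (AddMonoidHom.mulLeft c) G

lemma sum_dsum_mul (R : Fin 5 → Fin 5 → Fin 5 → Fin 5 → Prop)
    [∀ j k l m, Decidable (R j k l m)] (G : Fin 5 → Fin 5 → Fin 5 → Fin 5 → Fin 5 → ℂ)
    (y : Fin 5 → ℂ) :
    ∑ i, dsum (fun i' j k l m => i' = i ∧ R j k l m) G * y i
      = dsum (fun _ j k l m => R j k l m) fun i j k l m => G i j k l m * y i := by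
  have h : ∀ i, dsum (fun i' j k l m => i' = i ∧ R j k l m) G
      = ∑ j, ∑ k, ∑ l, ∑ m, if [i, j, k, l, m].Nodup ∧ R j k l m then G i j k l m else 0 := by
    intro i
    rw [dsum, Finset.sum_eq_single i]
    · simp only [true_and]
    · intro b _ hb
      simp only [hb, false_and, and_false, if_false, Finset.sum_const_zero]
    · simp
  simp_rw [h]
  simp only [dsum, Finset.sum_mul, ite_mul, zero_mul]

section

variable (A : Matrix (Fin 5) (Fin 5) ℂ)

/-- The coefficient of `z³` in the cubic `R` for which the Kippenhahn polynomial is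
`∏ (z + α_j x + β_j y) - (x² + y²) R / 4`. -/
def coeffA : ℝ := sum2 (fun l n => ‖A l n‖ ^ 2)

/-- The coefficients of `z² x` and `z² y` in `R` are the real and imaginary parts of this. -/
def coeffB : ℂ :=
  sum32 (fun i j k l n => (‖A l n‖ : ℂ) ^ 2 * (A i i + A j j + A k k))
    - sum3 (fun k l n => cyc3 A k l n)

/-- In terms of the coefficients of `R`, the real part is that of `z x²` minus that of `z y²`, and
the imaginary part is that of `z x y`. -/
def coeffC : ℂ :=
  sum32 (fun i j k l n => (‖A l n‖ : ℂ) ^ 2 * (A i i * A j j + A i i * A k k + A j j * A k k))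
    - sum23 (fun i j k l n => (A i i + A j j) * cyc3 A k l n)
    + sum4 (fun j k l n => cyc4 A j k l n)

/-- The value of `R` at `(1, i, 0)`. -/
def coeffD : ℂ :=
  sum32 (fun i j k l n => (‖A l n‖ : ℂ) ^ 2 * (A i i * A j j * A k k))
    - sum23 (fun i j k l n => A i i * A j j * cyc3 A k l n)
    + sum14 (fun i j k l n => cyc4 A j k l n * A i i)
    - cyc5 A

/-- The coefficient of `x³` in `R`. -/
def coeffE : ℝ :=
  sum32 (fun i j k l n => ‖A l n‖ ^ 2 * ((A i i).re * (A j j).re * (A k k).re))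
    - sum23 (fun i j k l n => (cyc3 A k l n).re * ((A i i).re * (A j j).re))
    - 1 / 4 * ∑ i, Pcoef A i * (A i i).re
    + 1 / 2 * sum14 (fun i j k l n => (cyc4 A j k l n).re * (A i i).re)
    + 1 / 4 * sum23 (fun i j k l n => (cyc3 A k l n).re * ‖A i j‖ ^ 2)
    - 1 / 4 * (cycU A).re
    - 1 / 4 * (cycV A).re
    - 1 / 4 * (cyc5 A).re

/-- The coefficient of `y³` in `R`. -/
def coeffF : ℝ :=
  sum32 (fun i j k l n => ‖A l n‖ ^ 2 * ((A i i).im * (A j j).im * (A k k).im))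
    - sum23 (fun i j k l n => (cyc3 A k l n).im * ((A i i).im * (A j j).im))
    - 1 / 4 * ∑ i, Pcoef A i * (A i i).im
    - 1 / 2 * sum14 (fun i j k l n => (cyc4 A j k l n).re * (A i i).im)
    + 1 / 4 * sum23 (fun i j k l n => (cyc3 A k l n).im * ‖A i j‖ ^ 2)
    - 1 / 4 * (cycU A).im
    - 1 / 4 * (cycV A).im
    + 1 / 4 * (cyc5 A).im

/-- The coefficient of `z x²` in `R`. -/
def coeffG : ℝ :=
  sum32 (fun i j k l n => ‖A l n‖ ^ 2 *
      ((A i i).re * (A j j).re + (A i i).re * (A k k).re + (A j j).re * (A k k).re))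
    - sum23 (fun i j k l n => (cyc3 A k l n).re * ((A i i).re + (A j j).re))
    - 1 / 4 * ∑ i, Pcoef A i
    + 1 / 2 * sum4 (fun j k l n => (cyc4 A j k l n).re)

/-- The entrywise conjugate of `A`. -/
def conjEntry (i j : Fin 5) : ℂ := starRingEnd ℂ (A i j)

lemma norm_sq_eq (i j : Fin 5) : (‖A i j‖ : ℂ) ^ 2 = A i j * conjEntry A i j :=
  (Complex.mul_conj' _).symm

lemma conj_norm_sq (i j : Fin 5) :
    starRingEnd ℂ ((‖A i j‖ : ℂ) ^ 2) = conjEntry A i j * A i j := by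
  rw [map_pow, Complex.conj_ofReal, norm_sq_eq, mul_comm]

lemma conj_conjEntry (i j : Fin 5) : starRingEnd ℂ (conjEntry A i j) = A i j :=
  Complex.conj_conj _

lemma cyc3_eq (k l n : Fin 5) : cyc3 A k l n = A k l * A l n * conjEntry A k n := rfl

lemma cyc4_eq (j k l n : Fin 5) : cyc4 A j k l n = A j k * A k l * A l n * conjEntry A j n := rfl

lemma coeffA_eq : (coeffA A : ℂ) = polA A (conjEntry A) := by
  rw [coeffA, ← Complex.ofRealHom_eq_coe, map_sum2]
  unfold polA
  simp only [Complex.ofRealHom_eq_coe, Complex.ofReal_pow, norm_sq_eq]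

lemma coeffB_eq : coeffB A = polB (fun i => A i i) A (conjEntry A) := by
  simp only [coeffB, polB, norm_sq_eq, cyc3_eq]

lemma conj_coeffB : starRingEnd ℂ (coeffB A)
    = polB (fun i => conjEntry A i i) (conjEntry A) A := by
  simp only [coeffB, polB, cyc3_eq, map_sub, map_sum32, map_sum3, map_mul, map_add, conj_norm_sq,
    conj_conjEntry]
  rfl

lemma coeffC_eq : coeffC A = polC (fun i => A i i) A (conjEntry A) := by
  simp only [coeffC, polC, norm_sq_eq, cyc3_eq, cyc4_eq]

lemma conj_coeffC : starRingEnd ℂ (coeffC A)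
    = polC (fun i => conjEntry A i i) (conjEntry A) A := by
  simp only [coeffC, polC, cyc3_eq, cyc4_eq, map_sub, map_sum32, map_sum23, map_sum4, map_mul,
    map_add, conj_norm_sq, conj_conjEntry]
  rfl

lemma coeffD_eq : coeffD A = polD (fun i => A i i) A (conjEntry A) := by
  simp only [coeffD, polD, norm_sq_eq, cyc3_eq, cyc4_eq, cyc5]
  rfl

lemma conj_coeffD : starRingEnd ℂ (coeffD A)
    = polD (fun i => conjEntry A i i) (conjEntry A) A := by
  simp only [coeffD, polD, cyc3_eq, cyc4_eq, cyc5, map_sub, map_sum32, map_sum23, map_sum14,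
    map_mul, map_add, conj_norm_sq, conj_conjEntry, Complex.conj_conj]
  rfl

lemma conj_cycU : starRingEnd ℂ (cycU A) = polU (conjEntry A) A := by
  simp only [cycU, polU, map_dsum, map_mul, Complex.conj_conj]
  rfl

lemma conj_cycV : starRingEnd ℂ (cycV A) = polV (conjEntry A) A := by
  simp only [cycV, polV, map_dsum, map_mul, Complex.conj_conj]
  rfl

lemma ofReal_re_eq (z : ℂ) : (z.re : ℂ) = (z + starRingEnd ℂ z) / 2 := Complex.re_eq_add_conj z

lemma I_mul_ofReal_im (z : ℂ) : Complex.I * (z.im : ℂ) = (z - starRingEnd ℂ z) / 2 := by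
  rw [Complex.im_eq_sub_conj]
  field_simp

lemma ofReal_sum_Pcoef (y : Fin 5 → ℂ) :
    ∑ i, (Pcoef A i : ℂ) * y i = polP A (conjEntry A) y := by
  have h : ∀ i, (Pcoef A i : ℂ) =
      dsum (fun i' j k l m => i' = i ∧ (j < k ∧ k < m) ∧ l < m)
        (fun _ j k l m => A j k * conjEntry A j k * (A l m * conjEntry A l m))
      - dsum (fun i' j k l m => i' = i ∧ (j < k ∧ k < l) ∧ (j < m ∧ m < l))
        (fun _ j k l m => (A j k * A k l * conjEntry A j m * conjEntry A m l
          + conjEntry A j k * conjEntry A k l * A j m * A m l) / 2)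
      - dsum (fun i' j k l m => i' = i ∧ j < k ∧ (l < k ∧ k < m))
        (fun _ j k l m => (A j k * A l m * conjEntry A j m * conjEntry A l k
          + conjEntry A j k * conjEntry A l m * A j m * A l k) / 2) := by
    intro i
    rw [Pcoef, ← Complex.ofRealHom_eq_coe, map_sub, map_sub, map_dsum, map_dsum, map_dsum]
    simp only [Complex.ofRealHom_eq_coe, Complex.ofReal_pow, norm_sq_eq,
      ofReal_re_eq, map_mul, Complex.conj_conj]
    rfl
  simp only [h, sub_mul, Finset.sum_sub_distrib]
  rw [sum_dsum_mul (fun j k l m => (j < k ∧ k < m) ∧ l < m),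
    sum_dsum_mul (fun j k l m => (j < k ∧ k < l) ∧ (j < m ∧ m < l)),
    sum_dsum_mul (fun j k l m => j < k ∧ (l < k ∧ k < m))]
  rfl

lemma coeffG_eq : (coeffG A : ℂ) =
    sum32 (fun i j k l n => A l n * conjEntry A l n *
          ((A i i + conjEntry A i i) / 2 * ((A j j + conjEntry A j j) / 2)
            + (A i i + conjEntry A i i) / 2 * ((A k k + conjEntry A k k) / 2)
            + (A j j + conjEntry A j j) / 2 * ((A k k + conjEntry A k k) / 2)))
        - sum23 (fun i j k l n => (A k l * A l n * conjEntry A k n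
            + conjEntry A k l * conjEntry A l n * A k n) / 2 *
            ((A i i + conjEntry A i i) / 2 + (A j j + conjEntry A j j) / 2))
        - 1 / 4 * polP A (conjEntry A) (fun _ => 1)
        + 1 / 2 * sum4 (fun j k l n =>
          (A j k * A k l * A l n * conjEntry A j n
            + conjEntry A j k * conjEntry A k l * conjEntry A l n * A j n) / 2) := by
  rw [← ofReal_sum_Pcoef, coeffG, ← Complex.ofRealHom_eq_coe]
  simp only [map_add, map_sub, map_mul, map_sum32, map_sum23, map_sum4, map_sum, mul_one]
  simp only [Complex.ofRealHom_eq_coe, Complex.ofReal_pow, norm_sq_eq,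
      ofReal_re_eq, map_mul, Complex.conj_conj, cyc3, cyc4]
  norm_num
  rfl

lemma coeffE_eq : (coeffE A : ℂ) =
    sum32 (fun i j k l n => A l n * conjEntry A l n *
          ((A i i + conjEntry A i i) / 2 * ((A j j + conjEntry A j j) / 2)
            * ((A k k + conjEntry A k k) / 2)))
        - sum23 (fun i j k l n => (A k l * A l n * conjEntry A k n
            + conjEntry A k l * conjEntry A l n * A k n) / 2 *
            ((A i i + conjEntry A i i) / 2 * ((A j j + conjEntry A j j) / 2)))
        - 1 / 4 * polP A (conjEntry A) (fun i => (A i i + conjEntry A i i) / 2)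
        + 1 / 2 * sum14 (fun i j k l n =>
          (A j k * A k l * A l n * conjEntry A j n
            + conjEntry A j k * conjEntry A k l * conjEntry A l n * A j n) / 2
            * ((A i i + conjEntry A i i) / 2))
        + 1 / 4 * sum23 (fun i j k l n => (A k l * A l n * conjEntry A k n
            + conjEntry A k l * conjEntry A l n * A k n) / 2 * (A i j * conjEntry A i j))
        - 1 / 4 * ((polU A (conjEntry A) + polU (conjEntry A) A) / 2)
        - 1 / 4 * ((polV A (conjEntry A) + polV (conjEntry A) A) / 2)
        - 1 / 4 * ((A 0 1 * A 1 2 * A 2 3 * A 3 4 * conjEntry A 0 4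
          + conjEntry A 0 1 * conjEntry A 1 2 * conjEntry A 2 3 * conjEntry A 3 4 * A 0 4)
            / 2) := by
  rw [← ofReal_sum_Pcoef, coeffE, ← Complex.ofRealHom_eq_coe]
  simp only [map_add, map_sub, map_mul, map_sum32, map_sum23, map_sum14, map_sum]
  simp only [Complex.ofRealHom_eq_coe, Complex.ofReal_pow, norm_sq_eq,
      ofReal_re_eq, map_mul, Complex.conj_conj, cyc3, cyc4, cyc5, conj_cycU, conj_cycV]
  norm_num
  rfl

lemma I_mul_coeffF : Complex.I * (coeffF A : ℂ) =
    - sum32 (fun i j k l n => A l n * conjEntry A l n *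
          ((A i i - conjEntry A i i) / 2 * ((A j j - conjEntry A j j) / 2)
            * ((A k k - conjEntry A k k) / 2)))
        + sum23 (fun i j k l n => (A k l * A l n * conjEntry A k n
            - conjEntry A k l * conjEntry A l n * A k n) / 2 *
            ((A i i - conjEntry A i i) / 2 * ((A j j - conjEntry A j j) / 2)))
        - 1 / 4 * polP A (conjEntry A) (fun i => (A i i - conjEntry A i i) / 2)
        - 1 / 2 * sum14 (fun i j k l n =>
          (A j k * A k l * A l n * conjEntry A j n
            + conjEntry A j k * conjEntry A k l * conjEntry A l n * A j n) / 2
            * ((A i i - conjEntry A i i) / 2))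
        + 1 / 4 * sum23 (fun i j k l n => (A k l * A l n * conjEntry A k n
            - conjEntry A k l * conjEntry A l n * A k n) / 2 * (A i j * conjEntry A i j))
        - 1 / 4 * ((polU A (conjEntry A) - polU (conjEntry A) A) / 2)
        - 1 / 4 * ((polV A (conjEntry A) - polV (conjEntry A) A) / 2)
        + 1 / 4 * ((A 0 1 * A 1 2 * A 2 3 * A 3 4 * conjEntry A 0 4
          - conjEntry A 0 1 * conjEntry A 1 2 * conjEntry A 2 3 * conjEntry A 3 4 * A 0 4)
            / 2) := by
  have hd : ∀ i, (A i i - conjEntry A i i) / 2 = Complex.I * ((A i i).im : ℂ) := fun i =>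
    (I_mul_ofReal_im _).symm
  have h3 : ∀ k l n, (A k l * A l n * conjEntry A k n
      - conjEntry A k l * conjEntry A l n * A k n) / 2 = Complex.I * ((cyc3 A k l n).im : ℂ) := by
    intro k l n
    rw [I_mul_ofReal_im, cyc3, map_mul, map_mul, Complex.conj_conj]
    rfl
  have h4 : ∀ j k l n, (A j k * A k l * A l n * conjEntry A j n
      + conjEntry A j k * conjEntry A k l * conjEntry A l n * A j n) / 2
        = ((cyc4 A j k l n).re : ℂ) := by
    intro j k l n
    rw [ofReal_re_eq, cyc4, map_mul, map_mul, map_mul, Complex.conj_conj]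
    rfl
  have h5 : (A 0 1 * A 1 2 * A 2 3 * A 3 4 * conjEntry A 0 4
      - conjEntry A 0 1 * conjEntry A 1 2 * conjEntry A 2 3 * conjEntry A 3 4 * A 0 4) / 2
        = Complex.I * ((cyc5 A).im : ℂ) := by
    rw [I_mul_ofReal_im, cyc5, map_mul, map_mul, map_mul, map_mul, Complex.conj_conj]
    rfl
  have hU : (polU A (conjEntry A) - polU (conjEntry A) A) / 2 = Complex.I * ((cycU A).im : ℂ) := by
    rw [I_mul_ofReal_im, conj_cycU]
    rfl
  have hV : (polV A (conjEntry A) - polV (conjEntry A) A) / 2 = Complex.I * ((cycV A).im : ℂ) := by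
    rw [I_mul_ofReal_im, conj_cycV]
    rfl
  rw [hU, hV, h5]
  simp only [h3, h4, hd, ← norm_sq_eq]
  have e1 : sum32 (fun i j k l n => (‖A l n‖ : ℂ) ^ 2 * (Complex.I * ((A i i).im : ℂ)
      * (Complex.I * ((A j j).im : ℂ)) * (Complex.I * ((A k k).im : ℂ))))
      = - (Complex.I * ((sum32 (fun i j k l n =>
        ‖A l n‖ ^ 2 * ((A i i).im * (A j j).im * (A k k).im)) : ℝ) : ℂ)) := by
    rw [ofReal_sum32, mul_sum32, ← neg_one_mul, mul_sum32]
    congr 1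
    ext i j k l n
    push_cast
    linear_combination (Complex.I * (‖A l n‖ : ℂ) ^ 2 * (A i i).im * (A j j).im * (A k k).im)
      * Complex.I_sq
  have e2 : sum23 (fun i j k l n => Complex.I * ((cyc3 A k l n).im : ℂ) *
      (Complex.I * ((A i i).im : ℂ) * (Complex.I * ((A j j).im : ℂ))))
      = - (Complex.I * ((sum23 (fun i j k l n =>
        (cyc3 A k l n).im * ((A i i).im * (A j j).im)) : ℝ) : ℂ)) := by
    rw [ofReal_sum23, mul_sum23, ← neg_one_mul, mul_sum23]
    congr 1
    ext i j k l n
    push_cast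
    linear_combination (Complex.I * (cyc3 A k l n).im * (A i i).im * (A j j).im) * Complex.I_sq
  have e3 : sum14 (fun i j k l n => ((cyc4 A j k l n).re : ℂ) * (Complex.I * ((A i i).im : ℂ)))
      = Complex.I * ((sum14 (fun i j k l n => (cyc4 A j k l n).re * (A i i).im) : ℝ) : ℂ) := by
    rw [ofReal_sum14, mul_sum14]
    congr 1
    ext i j k l n
    push_cast
    ring
  have e4 : sum23 (fun i j k l n => Complex.I * ((cyc3 A k l n).im : ℂ) * (‖A i j‖ : ℂ) ^ 2)
      = Complex.I * ((sum23 (fun i j k l n => (cyc3 A k l n).im * ‖A i j‖ ^ 2) : ℝ) : ℂ) := by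
    rw [ofReal_sum23, mul_sum23]
    congr 1
    ext i j k l n
    push_cast
    ring
  have e5 : polP A (conjEntry A) (fun i => Complex.I * ((A i i).im : ℂ))
      = Complex.I * ((∑ i, Pcoef A i * (A i i).im : ℝ) : ℂ) := by
    rw [← ofReal_sum_Pcoef]
    push_cast
    rw [Finset.mul_sum]
    exact Finset.sum_congr rfl fun i _ => by ring
  rw [e1, e2, e3, e4, e5, coeffF]
  push_cast
  ring

/-- The cubic `R` for which the Kippenhahn polynomial is
`∏ (z + α_j x + β_j y) - (x² + y²) R / 4`. -/
def cofactor (P : Fin 3 → ℂ) : ℂ :=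
  coeffA A * P 2 ^ 3 + P 2 ^ 2 * ((coeffB A).re * P 0 + (coeffB A).im * P 1)
    + P 2 * (coeffG A * P 0 ^ 2 + (coeffG A - (coeffC A).re) * P 1 ^ 2
      + (coeffC A).im * (P 0 * P 1))
    + coeffE A * P 0 ^ 3 + coeffF A * P 1 ^ 3 + (coeffE A - (coeffD A).re) * (P 0 * P 1 ^ 2)
    + ((coeffD A).im + coeffF A) * (P 0 ^ 2 * P 1)

end

/-- The value of the Kippenhahn polynomial as a determinant with the entries of the Hermitian
pencil. -/
lemma eval_kippenhahnPoly_eq_det {n : ℕ} (A : Matrix (Fin n) (Fin n) ℂ) (P : Fin 3 → ℂ) :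
    eval P (kippenhahnPoly A) = (P 0 • reMat A + P 1 • imMat A + P 2 • 1).det := by
  rw [kippenhahnPoly, RingHom.map_det]
  congr 1
  ext i j
  by_cases h : i = j <;>
    simp [Matrix.add_apply, Matrix.smul_apply, Matrix.map_apply, h]

/-- The expansion of the Kippenhahn polynomial of an upper triangular `5 × 5` matrix. -/
lemma eval_kippenhahnPoly {A : Matrix (Fin 5) (Fin 5) ℂ} (hA : A.BlockTriangular id)
    (P : Fin 3 → ℂ) : eval P (kippenhahnPoly A) =
      (∏ j, (P 2 + ((A j j).re * P 0 + (A j j).im * P 1)))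
        - (P 0 ^ 2 + P 1 ^ 2) / 4 * cofactor A P := by
  have hdiag : ∀ i, ((A i i).re * P 0 + (A i i).im * P 1 : ℂ) =
      conjEntry A i i * ((P 0 + Complex.I * P 1) / 2) + A i i * ((P 0 - Complex.I * P 1) / 2) := by
    intro i
    have h1 : conjEntry A i i = (A i i).re - (A i i).im * Complex.I := by
      apply Complex.ext <;> simp [conjEntry]
    have h2 : A i i = (A i i).re + (A i i).im * Complex.I := (Complex.re_add_im _).symm
    rw [h1]
    nth_rewrite 5 [h2]
    linear_combination ((A i i).im * P 1) * Complex.I_sq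
  have hmat : P 0 • reMat A + P 1 • imMat A + P 2 • 1 = Matrix.of fun i j : Fin 5 =>
      if i = j then P 2 + (conjEntry A i i * ((P 0 + Complex.I * P 1) / 2)
        + A i i * ((P 0 - Complex.I * P 1) / 2)) else
      if i < j then (P 0 - Complex.I * P 1) / 2 * A i j
        else (P 0 + Complex.I * P 1) / 2 * conjEntry A j i := by
    have hinv : (1 / (2 * Complex.I) : ℂ) = -Complex.I / 2 := by
      rw [div_eq_iff (by simp)]
      linear_combination Complex.I_sq
    ext i j
    rw [Matrix.of_apply]
    simp only [Matrix.add_apply, Matrix.smul_apply, reMat, imMat, Matrix.sub_apply,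
      Matrix.conjTranspose_apply, smul_eq_mul, hinv, Matrix.one_apply]
    change P 0 * (1 / 2 * (A i j + conjEntry A j i)) + P 1 * (-Complex.I / 2 *
      (A i j - conjEntry A j i)) + P 2 * (if i = j then 1 else 0) = _
    split_ifs with h1 h2
    · subst h1
      ring
    · have : A j i = 0 := hA h2
      simp only [conjEntry, this, map_zero]
      ring
    · have : A i j = 0 := hA (lt_of_le_of_ne (not_lt.1 h2) (Ne.symm h1))
      rw [this]
      ring
  rw [eval_kippenhahnPoly_eq_det, hmat, det_expansion (fun i => A i i) (fun i => conjEntry A i i) A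
    (conjEntry A), ← coeffA_eq, ← coeffB_eq, ← conj_coeffB, ← coeffC_eq, ← conj_coeffC,
    ← coeffD_eq, ← conj_coeffD, ← coeffG_eq, ← coeffE_eq, ← I_mul_coeffF]
  simp only [← hdiag]
  have hre : ∀ z : ℂ, starRingEnd ℂ z = z.re - z.im * Complex.I := fun z => by
    apply Complex.ext <;> simp
  set x := P 0
  set y := P 1
  set z := P 2
  have h1 : (x + Complex.I * y) / 2 * ((x - Complex.I * y) / 2) = (x ^ 2 + y ^ 2) / 4 := by
    linear_combination (-(y ^ 2) / 4) * Complex.I_sq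
  have h2 : starRingEnd ℂ (coeffB A) * ((x + Complex.I * y) / 2)
      + coeffB A * ((x - Complex.I * y) / 2) = (coeffB A).re * x + (coeffB A).im * y := by
    rw [hre]
    nth_rewrite 3 [← Complex.re_add_im (coeffB A)]
    linear_combination (-((coeffB A).im * y)) * Complex.I_sq
  have h3 : coeffC A * ((x - Complex.I * y) / 2) ^ 2
      + starRingEnd ℂ (coeffC A) * ((x + Complex.I * y) / 2) ^ 2
      - (coeffC A + starRingEnd ℂ (coeffC A)) * ((x ^ 2 + y ^ 2) / 4)
      = -((coeffC A).re * y ^ 2) + (coeffC A).im * (x * y) := by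
    have e : coeffC A = (coeffC A).re + (coeffC A).im * Complex.I := (Complex.re_add_im _).symm
    rw [hre]
    generalize ((coeffC A).re : ℂ) = Cr at *
    generalize ((coeffC A).im : ℂ) = Ci at *
    rw [e]
    linear_combination (Cr * y ^ 2 / 2 - Ci * (x * y)) * Complex.I_sq
  have h4 : -(x ^ 2 * (Complex.I * y) * (coeffD A - starRingEnd ℂ (coeffD A)) / 2)
      + x * (Complex.I * y) ^ 2 * (coeffD A + starRingEnd ℂ (coeffD A)) / 2
      = (coeffD A).im * (x ^ 2 * y) - (coeffD A).re * (x * y ^ 2) := by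
    have e : coeffD A = (coeffD A).re + (coeffD A).im * Complex.I := (Complex.re_add_im _).symm
    rw [hre]
    generalize ((coeffD A).re : ℂ) = Dr at *
    generalize ((coeffD A).im : ℂ) = Di at *
    rw [e]
    linear_combination (x * y ^ 2 * Dr - x ^ 2 * y * Di) * Complex.I_sq
  rw [h2]
  simp only [cofactor]
  rw [h1]
  change _ = _ - (x ^ 2 + y ^ 2) / 4 * (coeffA A * z ^ 3
    + z ^ 2 * ((coeffB A).re * x + (coeffB A).im * y)
    + z * (coeffG A * x ^ 2 + (coeffG A - (coeffC A).re) * y ^ 2 + (coeffC A).im * (x * y))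
    + coeffE A * x ^ 3 + coeffF A * y ^ 3 + (coeffE A - (coeffD A).re) * (x * y ^ 2)
    + ((coeffD A).im + coeffF A) * (x ^ 2 * y))
  linear_combination (-(x ^ 2 + y ^ 2) / 4) * ((4 * z * coeffG A
    - z * (coeffC A + starRingEnd ℂ (coeffC A)) + 4 * x * coeffE A + 4 * y * coeffF A) * h1
    + z * h3 + h4
    - 4 * y * coeffF A * ((x + Complex.I * y) / 2 * ((x - Complex.I * y) / 2)) * Complex.I_sq)

/-! ### Ellipses -/

lemma homCoord_ne_zero (ζ : ℂ) : homCoord ζ ≠ 0 := fun h => by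
  simpa [homCoord] using congrFun h 2

/-- The coefficients of the dual equation of the ellipse with foci `a`, `b` and minor axis `r`. -/
def ellipseCoeff (a b : ℂ) (r : ℝ) : Fin 6 → ℂ :=
  ![a.re * b.re - r ^ 2 / 4, a.im * b.im - r ^ 2 / 4, 1, a.im + b.im, a.re + b.re,
    a.re * b.im + a.im * b.re]

lemma eval_ellipseCoeff (a b : ℂ) (r : ℝ) (P : Fin 3 → ℂ) : eval P (conic (ellipseCoeff a b r)) =
    (P 2 + (a.re * P 0 + a.im * P 1)) * (P 2 + (b.re * P 0 + b.im * P 1))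
      - r ^ 2 / 4 * (P 0 ^ 2 + P 1 ^ 2) := by
  rw [eval_conic]
  simp only [ellipseCoeff, Matrix.cons_val]
  ring

lemma norm_sub_sq (a b : ℂ) : ‖a - b‖ ^ 2 = (a.re - b.re) ^ 2 + (a.im - b.im) ^ 2 := by
  rw [Complex.sq_norm, Complex.normSq_apply, Complex.sub_re, Complex.sub_im]
  ring

lemma conicDisc_ellipseCoeff (a b : ℂ) {r : ℝ} (hr : 0 < r) :
    conicDisc (ellipseCoeff a b r) ≠ 0 := by
  have h : conicDisc (ellipseCoeff a b r) = ((r ^ 2 / 4 * (r ^ 2 + ‖a - b‖ ^ 2) : ℝ) : ℂ) := by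
    rw [norm_sub_sq]
    simp only [conicDisc, ellipseCoeff, Matrix.cons_val]
    push_cast
    ring
  rw [h]
  exact_mod_cast (by positivity)

lemma norm_sub_lt_sqrt (a b : ℂ) {r : ℝ} (hr : 0 < r) :
    ‖a - b‖ < Real.sqrt (‖a - b‖ ^ 2 + r ^ 2) :=
  Real.lt_sqrt_of_sq_lt (by have := pow_pos hr 2; linarith)

lemma homCoord_mem_dualCurve_ellipseCoeff {a b : ℂ} {r : ℝ} (hr : 0 < r) {ζ : ℂ} :
    homCoord ζ ∈ dualCurve (conic (ellipseCoeff a b r)) ↔ ζ ∈ ellipse a b r := by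
  rw [mem_dualCurve_conic (conicDisc_ellipseCoeff a b hr), and_iff_right (homCoord_ne_zero ζ),
    ellipse, Set.mem_ofPred_eq]
  set l := Real.sqrt (‖a - b‖ ^ 2 + r ^ 2) with hl
  have hl2 : l ^ 2 = ‖a - b‖ ^ 2 + r ^ 2 := Real.sq_sqrt (by positivity)
  have hlt : ‖a - b‖ < l := norm_sub_lt_sqrt a b hr
  have h1 : ‖ζ - a‖ ≤ ‖a - b‖ + ‖ζ - b‖ := by
    have := norm_sub_le (ζ - b) (a - b)
    rwa [sub_sub_sub_cancel_right, add_comm] at this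
  have h2 : ‖ζ - b‖ ≤ ‖a - b‖ + ‖ζ - a‖ := by
    have := norm_add_le (ζ - a) (a - b)
    rwa [sub_add_sub_cancel, add_comm] at this
  have hu := norm_nonneg (ζ - a)
  have hv := norm_nonneg (ζ - b)
  -- The dual equation is, up to a constant, the product of `l ± ‖ζ - a‖ ± ‖ζ - b‖`.
  have key : eval (homCoord ζ) (conic (dualCoeff (ellipseCoeff a b r))) =
      (((l - (‖ζ - a‖ + ‖ζ - b‖)) * (l + (‖ζ - a‖ + ‖ζ - b‖)) *
        ((l - (‖ζ - a‖ - ‖ζ - b‖)) * (l + (‖ζ - a‖ - ‖ζ - b‖))) / 4 : ℝ) : ℂ) := by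
    have e : (l - (‖ζ - a‖ + ‖ζ - b‖)) * (l + (‖ζ - a‖ + ‖ζ - b‖)) *
        ((l - (‖ζ - a‖ - ‖ζ - b‖)) * (l + (‖ζ - a‖ - ‖ζ - b‖))) =
        (l ^ 2) ^ 2 - 2 * l ^ 2 * (‖ζ - a‖ ^ 2 + ‖ζ - b‖ ^ 2)
          + (‖ζ - a‖ ^ 2 - ‖ζ - b‖ ^ 2) ^ 2 := by ring
    rw [e, hl2, norm_sub_sq, norm_sub_sq, norm_sub_sq, eval_conic]
    simp only [dualCoeff, ellipseCoeff, homCoord, Matrix.cons_val]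
    push_cast
    ring
  rw [key]
  constructor
  · intro h
    have h' := Complex.ofReal_eq_zero.1 h
    have p1 : 0 < l + (‖ζ - a‖ + ‖ζ - b‖) := by linarith [norm_nonneg (a - b)]
    have p2 : 0 < l - (‖ζ - a‖ - ‖ζ - b‖) := by linarith
    have p3 : 0 < l + (‖ζ - a‖ - ‖ζ - b‖) := by linarith
    have : l - (‖ζ - a‖ + ‖ζ - b‖) = 0 := by
      by_contra hne
      refine (div_ne_zero (mul_ne_zero (mul_ne_zero hne p1.ne') (mul_ne_zero p2.ne' p3.ne'))
        four_ne_zero) h'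
    linarith
  · intro h
    rw [h, sub_self]
    simp

lemma ellipse_infinite (a b : ℂ) {r : ℝ} (hr : 0 < r) : (ellipse a b r).Infinite := by
  -- Every ray from the focus `a` meets the ellipse.
  have h : ∀ s : ℝ, ∃ τ : ℝ, 0 < τ ∧ a + τ * (1 + s * Complex.I) ∈ ellipse a b r := by
    intro s
    set l := Real.sqrt (‖a - b‖ ^ 2 + r ^ 2)
    let φ : ℝ → ℝ := fun τ => ‖a + τ * (1 + s * Complex.I) - a‖ + ‖a + τ * (1 + s * Complex.I) - b‖
    have hc : Continuous φ := by fun_prop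
    have h0 : φ 0 < l := by
      simpa [φ] using norm_sub_lt_sqrt a b hr
    have hl0 : 0 ≤ l := Real.sqrt_nonneg _
    have h1 : l ≤ φ l := by
      have e : ‖a + l * (1 + s * Complex.I) - a‖ ≥ l := by
        have := Complex.abs_re_le_norm (a + l * (1 + s * Complex.I) - a)
        simp only [add_sub_cancel_left, Complex.mul_re, Complex.ofReal_re, Complex.add_re,
          Complex.one_re, Complex.I_re, mul_zero, Complex.ofReal_im, Complex.I_im, zero_mul,
          sub_zero, add_zero, mul_one] at this
        rw [abs_of_nonneg hl0] at this
        simpa using this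
      have := norm_nonneg (a + l * (1 + s * Complex.I) - b)
      simp only [φ]
      linarith
    obtain ⟨τ, hτ, hτl⟩ := intermediate_value_Icc hl0 hc.continuousOn ⟨h0.le, h1⟩
    refine ⟨τ, lt_of_le_of_ne hτ.1 ?_, hτl⟩
    rintro rfl
    exact h0.ne hτl
  choose τ hτ hmem using h
  refine Set.infinite_of_injective_forall_mem (f := fun s : ℝ => a + τ s * (1 + s * Complex.I))
    (fun s s' hss => ?_) hmem
  have hre := congrArg Complex.re hss
  have him := congrArg Complex.im hss
  simp at hre him
  rw [hre] at him
  exact mul_left_cancel₀ (hτ s').ne' him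

/-! ### Factorizations of the Kippenhahn polynomial -/

/-- The linear form `z + x Re l + y Im l`, the dual of the point `l` of the real plane. -/
def pointForm (l : ℂ) : MvPolynomial (Fin 3) ℂ := X 2 + (C (l.re : ℂ) * X 0 + C (l.im : ℂ) * X 1)

/-- The cubic `∏ (z + x Re l_i + y Im l_i) - (x² + y²) (a z + b x + c y)`. These are the monic
cubics in `z` with real foci `l_i`. -/
def focalCubic (l₁ l₂ l₃ a b c : ℂ) : MvPolynomial (Fin 3) ℂ :=
  pointForm l₁ * pointForm l₂ * pointForm l₃
    - (X 0 ^ 2 + X 1 ^ 2) * (C a * X 2 + C b * X 0 + C c * X 1)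

lemma eval_focalCubic (l₁ l₂ l₃ a b c : ℂ) (P : Fin 3 → ℂ) :
    eval P (focalCubic l₁ l₂ l₃ a b c) =
      (P 2 + (l₁.re * P 0 + l₁.im * P 1)) * (P 2 + (l₂.re * P 0 + l₂.im * P 1))
        * (P 2 + (l₃.re * P 0 + l₃.im * P 1))
      - (P 0 ^ 2 + P 1 ^ 2) * (a * P 2 + b * P 0 + c * P 1) := by
  simp [focalCubic, pointForm]

lemma isHomogeneous_focalCubic (l₁ l₂ l₃ a b c : ℂ) :
    (focalCubic l₁ l₂ l₃ a b c).IsHomogeneous 3 := by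
  have hX : ∀ i : Fin 3, (X i : MvPolynomial (Fin 3) ℂ).IsHomogeneous 1 := isHomogeneous_X ℂ
  have hp : ∀ l, (pointForm l).IsHomogeneous 1 := fun l =>
    (hX 2).add (((hX 0).C_mul _).add ((hX 1).C_mul _))
  exact (((hp l₁).mul (hp l₂)).mul (hp l₃)).sub ((((hX 0).pow 2).add ((hX 1).pow 2)).mul
    ((((hX 2).C_mul _).add ((hX 0).C_mul _)).add ((hX 1).C_mul _)))

/-- A cubic form that vanishes outside the isotropic lines is zero. -/
lemma cubic_coeff_eq_zero {c : Fin 10 → ℂ} (h : ∀ x y z : ℂ, x ^ 2 + y ^ 2 ≠ 0 →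
    c 0 * x ^ 3 + c 1 * (x ^ 2 * y) + c 2 * (x ^ 2 * z)
      + c 3 * (x * y ^ 2) + c 4 * (x * y * z) + c 5 * (x * z ^ 2)
      + c 6 * y ^ 3 + c 7 * (y ^ 2 * z) + c 8 * (y * z ^ 2) + c 9 * z ^ 3 = 0) :
    c = 0 := by
  have a0 := h 1 0 0 (by norm_num)
  have a1 := h 1 0 1 (by norm_num)
  have a2 := h 1 0 (-1) (by norm_num)
  have a3 := h 1 0 2 (by norm_num)
  have b0 := h 0 1 0 (by norm_num)
  have b1 := h 0 1 1 (by norm_num)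
  have b2 := h 0 1 (-1) (by norm_num)
  have d0 := h 1 1 0 (by norm_num)
  have d1 := h 1 1 1 (by norm_num)
  have e0 := h 1 (-1) 0 (by norm_num)
  ring_nf at a0 a1 a2 a3 b0 b1 b2 d0 d1 e0
  have h0 : c 0 = 0 := a0
  have h6 : c 6 = 0 := b0
  rw [h0] at a1 a2 a3 d0 d1 e0
  rw [h6] at b1 b2 d0 d1 e0
  have h5 : c 5 = 0 := by linear_combination (a1 + a2) / 2
  rw [h5] at a1 a2 a3 d1
  have h9 : c 9 = 0 := by linear_combination (a3 - 2 * a1) / 6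
  rw [h9] at a1 a2 a3 b1 b2 d1
  have h2 : c 2 = 0 := by linear_combination a1
  have h8 : c 8 = 0 := by linear_combination (b1 + b2) / 2
  rw [h8] at b1 d1
  have h7 : c 7 = 0 := by linear_combination b1
  have h3 : c 3 = 0 := by linear_combination (d0 + e0) / 2
  have h1 : c 1 = 0 := by linear_combination (d0 - e0) / 2
  have h4 : c 4 = 0 := by
    rw [h2, h7, h3, h1] at d1
    linear_combination d1
  ext i
  fin_cases i <;> assumption

lemma prod_eq_of_nodup {M : Type*} [CommMonoid M] (F : Fin 5 → M) {p q w t v : Fin 5}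
    (h : [p, q, w, t, v].Nodup) : ∏ j, F j = F p * F q * F w * F t * F v := by
  have hu : [p, q, w, t, v].toFinset = Finset.univ :=
    Finset.eq_univ_of_card _ (by rw [List.toFinset_card_of_nodup h]; rfl)
  rw [← hu, List.prod_toFinset _ h]
  simp [mul_assoc]

/-- The Kippenhahn polynomial is the product of the dual of an ellipse and a cubic with given real
foci if and only if the coefficients of the cofactor have the corresponding values. -/
lemma kippenhahnPoly_eq_mul_iff {A : Matrix (Fin 5) (Fin 5) ℂ} (hA : A.BlockTriangular id)
    {p q w t v : Fin 5} (hpq : [p, q, w, t, v].Nodup) (r a b c : ℝ) {κ : ℂ}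
    (hκ : κ = b + c * Complex.I) :
    kippenhahnPoly A = conic (ellipseCoeff (A p p) (A q q) r)
        * focalCubic (A w w) (A t t) (A v v) a b c ↔
      r ^ 2 + 4 * a = coeffA A ∧
      (r : ℂ) ^ 2 * (A w w + A t t + A v v) + 4 * (κ + (A p p + A q q) * a) = coeffB A ∧
      (r : ℂ) ^ 2 * (A w w * A t t + A t t * A v v + A w w * A v v)
        + 4 * (A p p * A q q * a + (A p p + A q q) * κ) = coeffC A ∧
      (r : ℂ) ^ 2 * (A w w * A t t * A v v) + 4 * (A p p * A q q * κ) = coeffD A ∧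
      r ^ 2 * ((A w w).re * (A t t).re * (A v v).re - b) + 4 * (A p p).re * (A q q).re * b
        = coeffE A ∧
      r ^ 2 * ((A w w).im * (A t t).im * (A v v).im - c) + 4 * (A p p).im * (A q q).im * c
        = coeffF A ∧
      r ^ 2 * ((A t t).re * (A v v).re + (A w w).re * (A v v).re + (A w w).re * (A t t).re - a)
        + 4 * (A p p).re * (A q q).re * a + 4 * ((A p p).re + (A q q).re) * b = coeffG A := by
  have hre : κ.re = b := by rw [hκ]; simp
  have him : κ.im = c := by rw [hκ]; simp
  have key : ∀ P : Fin 3 → ℂ, eval P (kippenhahnPoly A - conic (ellipseCoeff (A p p) (A q q) r)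
        * focalCubic (A w w) (A t t) (A v v) a b c) = (P 0 ^ 2 + P 1 ^ 2) / 4 *
      ((r : ℂ) ^ 2 * ((P 2 + ((A w w).re * P 0 + (A w w).im * P 1))
          * (P 2 + ((A t t).re * P 0 + (A t t).im * P 1))
          * (P 2 + ((A v v).re * P 0 + (A v v).im * P 1)))
        + 4 * (a * P 2 + b * P 0 + c * P 1) * ((P 2 + ((A p p).re * P 0 + (A p p).im * P 1))
          * (P 2 + ((A q q).re * P 0 + (A q q).im * P 1)))
        - (r : ℂ) ^ 2 * (P 0 ^ 2 + P 1 ^ 2) * (a * P 2 + b * P 0 + c * P 1)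
        - cofactor A P) := by
    intro P
    rw [map_sub, map_mul, eval_kippenhahnPoly hA, eval_ellipseCoeff, eval_focalCubic,
      prod_eq_of_nodup _ hpq]
    ring
  rw [← sub_eq_zero]
  constructor
  · intro h
    rw [h] at key
    generalize A p p = lp at *
    generalize A q q = lq at *
    generalize A w w = lw at *
    generalize A t t = lt at *
    generalize A v v = lv at *
    have hc := @cubic_coeff_eq_zero
      ![r ^ 2 * (lw.re * lt.re * lv.re - b) + 4 * lp.re * lq.re * b - coeffE A,
        r ^ 2 * (lw.im * lt.re * lv.re + lw.re * lt.im * lv.re + lw.re * lt.re * lv.im - c)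
          + 4 * (b * (lp.re * lq.im + lp.im * lq.re) + c * (lp.re * lq.re))
          - ((coeffD A).im + coeffF A),
        r ^ 2 * (lw.re * lt.re + lw.re * lv.re + lt.re * lv.re - a)
          + 4 * (a * (lp.re * lq.re) + b * (lp.re + lq.re)) - coeffG A,
        r ^ 2 * (lw.im * lt.im * lv.re + lw.im * lt.re * lv.im + lw.re * lt.im * lv.im - b)
          + 4 * (b * (lp.im * lq.im) + c * (lp.re * lq.im + lp.im * lq.re))
          - (coeffE A - (coeffD A).re),
        r ^ 2 * (lw.re * lt.im + lw.im * lt.re + lw.re * lv.im + lw.im * lv.re + lt.re * lv.im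
            + lt.im * lv.re)
          + 4 * (a * (lp.re * lq.im + lp.im * lq.re) + b * (lp.im + lq.im) + c * (lp.re + lq.re))
          - (coeffC A).im,
        r ^ 2 * (lw.re + lt.re + lv.re) + 4 * (a * (lp.re + lq.re) + b) - (coeffB A).re,
        r ^ 2 * (lw.im * lt.im * lv.im - c) + 4 * lp.im * lq.im * c - coeffF A,
        r ^ 2 * (lw.im * lt.im + lw.im * lv.im + lt.im * lv.im - a)
          + 4 * (a * (lp.im * lq.im) + c * (lp.im + lq.im)) - (coeffG A - (coeffC A).re),
        r ^ 2 * (lw.im + lt.im + lv.im) + 4 * (a * (lp.im + lq.im) + c) - (coeffB A).im,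
        r ^ 2 + 4 * a - coeffA A] (fun x y z hxy => by
          have h1 := key ![x, y, z]
          rw [map_zero] at h1
          have h2 := (mul_eq_zero.1 h1.symm).resolve_left
            (div_ne_zero (b := (4 : ℂ)) (by simpa using hxy) (by norm_num))
          simp only [cofactor, Matrix.cons_val] at h2 ⊢
          linear_combination h2)
    have c0 := congrFun hc 0
    have c1 := congrFun hc 1
    have c2 := congrFun hc 2
    have c3 := congrFun hc 3
    have c4 := congrFun hc 4
    have c5 := congrFun hc 5
    have c6 := congrFun hc 6
    have c7 := congrFun hc 7
    have c8 := congrFun hc 8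
    have c9 := congrFun hc 9
    simp only [Matrix.cons_val, Pi.zero_apply] at c0 c1 c2 c3 c4 c5 c6 c7 c8 c9
    norm_cast at c0 c1 c2 c3 c4 c5 c6 c7 c8 c9
    refine ⟨by linarith, ?_, ?_, ?_, by linarith, by linarith, by linarith⟩
    · apply Complex.ext
      · simp [hre, him, pow_two]
        linear_combination c5
      · simp [hre, him, pow_two]
        linear_combination c8
    · apply Complex.ext
      · simp [hre, him, pow_two]
        linear_combination c2 - c7
      · simp [hre, him, pow_two]
        linear_combination c4
    · apply Complex.ext
      · simp [hre, him, pow_two]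
        linear_combination c0 - c3
      · simp [hre, him, pow_two]
        linear_combination c1 - c6
  · rintro ⟨h1, h2, h3, h4, h5, h6, h7⟩
    refine MvPolynomial.funext fun P => ?_
    rw [key, map_zero, mul_eq_zero]
    right
    generalize A p p = lp at *
    generalize A q q = lq at *
    generalize A w w = lw at *
    generalize A t t = lt at *
    generalize A v v = lv at *
    have h2r := congrArg Complex.re h2
    have h2i := congrArg Complex.im h2
    have h3r := congrArg Complex.re h3
    have h3i := congrArg Complex.im h3
    have h4r := congrArg Complex.re h4
    have h4i := congrArg Complex.im h4
    simp [hre, him, pow_two] at h2r h2i h3r h3i h4r h4i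
    rw [cofactor, ← h1, ← h5, ← h6, ← h7, ← h2r, ← h2i, ← h3r, ← h3i, ← h4r, ← h4i]
    push_cast
    ring

/-! ### Hyperbolicity -/

lemma isHermitian_reMat {n : ℕ} (A : Matrix (Fin n) (Fin n) ℂ) : (reMat A).IsHermitian := by
  ext i j
  simp [reMat]
  ring

lemma isHermitian_imMat {n : ℕ} (A : Matrix (Fin n) (Fin n) ℂ) : (imMat A).IsHermitian := by
  ext i j
  simp [imMat]
  ring

open scoped ComplexOrder in
/-- The Kippenhahn polynomial is hyperbolic with respect to `(0, 0, 1)`, since the eigenvalues of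
Hermitian matrices are real. -/
lemma im_eq_zero_of_eval_kippenhahnPoly {n : ℕ} (A : Matrix (Fin n) (Fin n) ℂ) {x y : ℝ} {z : ℂ}
    (h : eval ![(x : ℂ), y, z] (kippenhahnPoly A) = 0) : z.im = 0 := by
  rw [eval_kippenhahnPoly_eq_det] at h
  simp only [Matrix.cons_val] at h
  set H := (x : ℂ) • reMat A + (y : ℂ) • imMat A with hH
  have hHerm : H.IsHermitian := by
    rw [Matrix.IsHermitian, hH, Matrix.conjTranspose_add, Matrix.conjTranspose_smul,
      Matrix.conjTranspose_smul, isHermitian_reMat, isHermitian_imMat]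
    simp
  obtain ⟨v, hv, hvz⟩ := Matrix.exists_mulVec_eq_zero_iff.2 h
  rw [Matrix.add_mulVec, Matrix.smul_mulVec, Matrix.one_mulVec] at hvz
  have h1 : star v ⬝ᵥ H.mulVec v + z * (star v ⬝ᵥ v) = 0 := by
    rw [← smul_eq_mul, ← dotProduct_smul, ← dotProduct_add, hvz, dotProduct_zero]
  have h2 : (star v ⬝ᵥ H.mulVec v).im = 0 := hHerm.im_star_dotProduct_mulVec_self v
  have h3 : 0 < star v ⬝ᵥ v := Matrix.dotProduct_star_self_pos_iff.2 hv
  have h4 := Complex.pos_iff.1 h3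
  have h5 := congrArg Complex.im h1
  rw [Complex.add_im, h2, Complex.mul_im, ← h4.2] at h5
  simp at h5
  exact h5.resolve_right h4.1.ne'

/-! ### Hyperbolic cubics with a real node -/

/-- The discriminant of a cubic polynomial with only real roots is a square. -/
lemma cubic_disc_nonneg {b c d : ℝ}
    (h : ∀ z : ℂ, z ^ 3 + b * z ^ 2 + c * z + d = 0 → z.im = 0) :
    0 ≤ b ^ 2 * c ^ 2 - 4 * c ^ 3 - 4 * b ^ 3 * d - 27 * d ^ 2 + 18 * b * c * d := by
  obtain ⟨x, y, z, hb, hc, hd⟩ := exists_roots_of_cubic 1 b c d one_ne_zero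
  have real : ∀ u : ℂ, u.im = 0 → u = (u.re : ℂ) := fun u hu => by
    apply Complex.ext <;> simp [hu]
  have hx := real x (h x (by rw [hb, hc, hd]; ring))
  have hy := real y (h y (by rw [hb, hc, hd]; ring))
  have hz := real z (h z (by rw [hb, hc, hd]; ring))
  rw [hx, hy, hz] at hb hc hd
  norm_cast at hb hc hd
  rw [hb, hc, hd]
  have := sq_nonneg ((x.re - y.re) * (x.re - z.re) * (y.re - z.re))
  linarith

/-- A quartic polynomial that is nonnegative for all positive arguments has a nonnegative leading
coefficient. -/
lemma leadingCoeff_nonneg {p₄ p₃ p₂ p₁ p₀ : ℝ}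
    (h : ∀ s : ℝ, 0 < s → 0 ≤ p₄ * s ^ 4 + p₃ * s ^ 3 + p₂ * s ^ 2 + p₁ * s + p₀) : 0 ≤ p₄ := by
  let φ : ℝ → ℝ := fun τ => p₄ + p₃ * τ + p₂ * τ ^ 2 + p₁ * τ ^ 3 + p₀ * τ ^ 4
  have hc : Continuous φ := by fun_prop
  have ht : Filter.Tendsto φ (nhdsWithin 0 (Set.Ioi 0)) (nhds p₄) := by
    have := (hc.tendsto 0).mono_left (nhdsWithin_le_nhds (s := Set.Ioi (0 : ℝ)))
    simpa [φ] using this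
  refine ge_of_tendsto ht (Filter.eventually_of_mem self_mem_nhdsWithin fun τ hτ => ?_)
  have hτ' : 0 < τ := hτ
  have h1 := mul_nonneg (h τ⁻¹ (inv_pos.2 hτ')) (pow_pos hτ' 4).le
  have e : (p₄ * τ⁻¹ ^ 4 + p₃ * τ⁻¹ ^ 3 + p₂ * τ⁻¹ ^ 2 + p₁ * τ⁻¹ + p₀) * τ ^ 4 = φ τ := by
    simp only [φ]
    field_simp
  rwa [e] at h1

/-- A nonnegative polynomial of degree at most `3` has no cubic term. -/
lemma second_coeff_eq_zero {p₃ p₂ p₁ p₀ : ℝ}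
    (h : ∀ s : ℝ, 0 ≤ p₃ * s ^ 3 + p₂ * s ^ 2 + p₁ * s + p₀) : p₃ = 0 := by
  refine le_antisymm ?_ ?_
  · have := leadingCoeff_nonneg (p₄ := -p₃) (p₃ := p₂) (p₂ := -p₁) (p₁ := p₀) (p₀ := 0)
      fun s hs => by
        have := mul_nonneg (h (-s)) hs.le
        linarith
    linarith
  · exact leadingCoeff_nonneg (p₃ := p₂) (p₂ := p₁) (p₁ := p₀) (p₀ := 0) fun s hs => by
        have := mul_nonneg (h s) hs.le
        linarith

/-- A hyperbolic cubic `S Q(a, B) + K(a, B)` with a double point at `a = B = 0` has an ordinary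
double point with two real tangents, unless it is reducible: the discriminant with respect to `a`
is nonnegative for all real values of `S`. -/
lemma exists_node_tangents {q₀ q₁ q₂ k₁ k₂ k₃ : ℝ}
    (hyp : ∀ (S : ℝ) (a : ℂ),
      S * (q₀ * a ^ 2 + q₁ * a + q₂) + (a ^ 3 + k₁ * a ^ 2 + k₂ * a + k₃) = 0 → a.im = 0)
    (hQK : ∀ b : ℂ, q₀ * b ^ 2 + q₁ * b + q₂ = 0 → b ^ 3 + k₁ * b ^ 2 + k₂ * b + k₃ ≠ 0) :
    ∃ ρ₁ ρ₂ : ℝ, q₀ ≠ 0 ∧ ρ₁ ≠ ρ₂ ∧ q₁ = -(q₀ * (ρ₁ + ρ₂)) ∧ q₂ = q₀ * (ρ₁ * ρ₂) := by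
  have hdisc : ∀ S : ℝ,
      0 ≤ (q₀ ^ 2 * q₁ ^ 2 - 4 * q₀ ^ 3 * q₂) * S ^ 4
        + (2 * q₀ ^ 2 * q₁ * k₂ + 2 * q₀ * q₁ ^ 2 * k₁ - 4 * q₁ ^ 3 - 4 * (q₀ ^ 3 * k₃
          + 3 * q₀ ^ 2 * k₁ * q₂) + 18 * q₀ * q₁ * q₂) * S ^ 3
        + (q₀ ^ 2 * k₂ ^ 2 + 4 * q₀ * q₁ * k₁ * k₂ + k₁ ^ 2 * q₁ ^ 2 - 12 * q₁ ^ 2 * k₂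
          - 4 * (3 * q₀ ^ 2 * k₁ * k₃ + 3 * q₀ * k₁ ^ 2 * q₂) - 27 * q₂ ^ 2
          + 18 * (q₀ * q₁ * k₃ + q₀ * k₂ * q₂ + k₁ * q₁ * q₂)) * S ^ 2
        + (2 * q₀ * k₁ * k₂ ^ 2 + 2 * k₁ ^ 2 * q₁ * k₂ - 12 * q₁ * k₂ ^ 2
          - 4 * (3 * q₀ * k₁ ^ 2 * k₃ + k₁ ^ 3 * q₂) - 54 * q₂ * k₃
          + 18 * (q₀ * k₂ * k₃ + k₁ * q₁ * k₃ + k₁ * k₂ * q₂)) * S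
        + (k₁ ^ 2 * k₂ ^ 2 - 4 * k₂ ^ 3 - 4 * k₁ ^ 3 * k₃ - 27 * k₃ ^ 2 + 18 * k₁ * k₂ * k₃) := by
    intro S
    have := @cubic_disc_nonneg (q₀ * S + k₁) (q₁ * S + k₂) (q₂ * S + k₃) fun z hz =>
      hyp S z (by push_cast at hz; linear_combination hz)
    linarith
  -- The leading coefficient is `q₀²` times the discriminant of `Q`.
  have h4 := leadingCoeff_nonneg fun S _ => hdisc S
  by_cases hq0 : q₀ = 0
  · -- The discriminant has cubic term `-4 q₁³ S³`, and quadratic term `-27 q₂² S²` if `q₁ = 0`.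
    -- So `Q = 0`, and the cubic consists of three lines.
    exfalso
    subst hq0
    have h3 := second_coeff_eq_zero fun S => by
      have := hdisc S
      simp only [zero_pow two_ne_zero, zero_pow three_ne_zero, zero_mul, mul_zero, sub_self,
        zero_add, add_zero, zero_sub] at this
      exact this
    have hq1 : q₁ = 0 := by simpa using h3
    subst hq1
    have h2 := leadingCoeff_nonneg (p₄ := -27 * q₂ ^ 2) (p₁ := 0) (p₀ := 0)
      (p₃ := - 4 * k₁ ^ 3 * q₂ - 54 * q₂ * k₃ + 18 * k₁ * k₂ * q₂)
      (p₂ := k₁ ^ 2 * k₂ ^ 2 - 4 * k₂ ^ 3 - 4 * k₁ ^ 3 * k₃ - 27 * k₃ ^ 2 + 18 * k₁ * k₂ * k₃)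
      fun S hS => by
        have := mul_nonneg (hdisc S) (sq_nonneg S)
        linarith
    have hq2 : q₂ = 0 := by
      have : q₂ ^ 2 = 0 := le_antisymm (by linarith) (sq_nonneg _)
      exact pow_eq_zero_iff two_ne_zero |>.1 this
    subst hq2
    obtain ⟨x, y, z, h1, h2, h3⟩ := exists_roots_of_cubic 1 k₁ k₂ k₃ one_ne_zero
    refine hQK x (by push_cast; ring) ?_
    rw [h1, h2, h3]
    ring
  have hD : 0 ≤ q₁ ^ 2 - 4 * q₀ * q₂ := by
    have : 0 ≤ q₀ ^ 2 * (q₁ ^ 2 - 4 * q₀ * q₂) := by linarith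
    exact nonneg_of_mul_nonneg_right this (by positivity)
  rcases hD.eq_or_lt with hD | hD
  · -- If `Q` has a double root `ρ`, then the cubic coefficient of the discriminant is a multiple
    -- of `K(ρ)`, so `Q` and `K` have a common root.
    exfalso
    obtain ⟨ρ, hρ⟩ : ∃ ρ, q₁ = -(2 * q₀ * ρ) := ⟨-q₁ / (2 * q₀), by field_simp⟩
    have hq2 : q₂ = q₀ * ρ ^ 2 := by
      refine mul_left_cancel₀ (mul_ne_zero four_ne_zero hq0) ?_
      rw [hρ] at hD
      linarith
    subst hρ hq2
    have h3 := second_coeff_eq_zero (p₃ := -4 * q₀ ^ 3 * (ρ ^ 3 + k₁ * ρ ^ 2 + k₂ * ρ + k₃))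
      (p₂ := q₀ ^ 2 * (-8 * ρ * k₁ * k₂ - 36 * ρ * k₃ - 30 * ρ ^ 2 * k₂ - 8 * ρ ^ 2 * k₁ ^ 2
        - 36 * ρ ^ 3 * k₁ - 27 * ρ ^ 4 + k₂ ^ 2 - 12 * k₁ * k₃))
      (p₁ := q₀ * (-4 * ρ * k₂ * k₁ ^ 2 + 24 * ρ * k₂ ^ 2 - 36 * ρ * k₁ * k₃ + 18 * ρ ^ 2 * k₁ * k₂
        - 4 * ρ ^ 2 * k₁ ^ 3 - 54 * ρ ^ 2 * k₃ + 18 * k₂ * k₃ + 2 * k₂ ^ 2 * k₁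
        - 12 * k₁ ^ 2 * k₃))
      (p₀ := k₁ ^ 2 * k₂ ^ 2 - 4 * k₂ ^ 3 - 4 * k₁ ^ 3 * k₃ - 27 * k₃ ^ 2 + 18 * k₁ * k₂ * k₃)
      fun S => by
        have := hdisc S
        linarith
    have hK : ρ ^ 3 + k₁ * ρ ^ 2 + k₂ * ρ + k₃ = 0 :=
      (mul_eq_zero.1 h3).resolve_left (mul_ne_zero (by norm_num) (pow_ne_zero _ hq0))
    refine hQK ρ ?_ (by exact_mod_cast hK)
    push_cast
    ring
  · have hs : 0 < Real.sqrt (q₁ ^ 2 - 4 * q₀ * q₂) := Real.sqrt_pos.2 hD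
    have hs2 := Real.sq_sqrt hD.le
    set s := Real.sqrt (q₁ ^ 2 - 4 * q₀ * q₂)
    refine ⟨(-q₁ + s) / (2 * q₀), (-q₁ - s) / (2 * q₀), hq0, ?_, ?_, ?_⟩
    · intro h
      rw [div_left_inj' (mul_ne_zero two_ne_zero hq0)] at h
      linarith
    · field_simp
      ring
    · field_simp
      linarith

/-- The normal form of a nodal cubic with given tangents `a = ρ₁ B` and `a = ρ₂ B` at the node: the
binary cubic `K` is written in the linear forms `a - ρ₁ B` and `a - ρ₂ B`, and the mixed terms are
absorbed into the third coordinate. -/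
lemma exists_node_form {q₀ ρ₁ ρ₂ k₁ k₂ k₃ : ℝ} (hρ : ρ₁ ≠ ρ₂)
    (h₁ : ρ₁ ^ 3 + k₁ * ρ₁ ^ 2 + k₂ * ρ₁ + k₃ ≠ 0) (h₂ : ρ₂ ^ 3 + k₁ * ρ₂ ^ 2 + k₂ * ρ₂ + k₃ ≠ 0) :
    ∃ κ₀ κ₁ κ₂ κ₃ : ℝ, κ₀ ≠ 0 ∧ κ₃ ≠ 0 ∧ ∀ a S B : ℂ,
      S * (q₀ * (a - ρ₁ * B) * (a - ρ₂ * B)) + (a ^ 3 + k₁ * (a ^ 2 * B) + k₂ * (a * B ^ 2)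
        + k₃ * B ^ 3) = (a - ρ₁ * B) * (a - ρ₂ * B) * (q₀ * S + κ₁ * (a - ρ₁ * B)
          + κ₂ * (a - ρ₂ * B)) + κ₀ * (a - ρ₁ * B) ^ 3 + κ₃ * (a - ρ₂ * B) ^ 3 := by
  have hd : ρ₂ - ρ₁ ≠ 0 := sub_ne_zero.2 hρ.symm
  have hd' : (ρ₂ - ρ₁ : ℂ) ≠ 0 := by exact_mod_cast hd
  refine ⟨(ρ₂ ^ 3 + k₁ * ρ₂ ^ 2 + k₂ * ρ₂ + k₃) / (ρ₂ - ρ₁) ^ 3,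
    (-3 * ρ₂ ^ 2 * ρ₁ + k₁ * (-ρ₂ ^ 2 - 2 * ρ₁ * ρ₂) + k₂ * (-2 * ρ₂ - ρ₁) - 3 * k₃)
      / (ρ₂ - ρ₁) ^ 3,
    (3 * ρ₂ * ρ₁ ^ 2 + k₁ * (2 * ρ₁ * ρ₂ + ρ₁ ^ 2) + k₂ * (ρ₂ + 2 * ρ₁) + 3 * k₃)
      / (ρ₂ - ρ₁) ^ 3,
    -(ρ₁ ^ 3 + k₁ * ρ₁ ^ 2 + k₂ * ρ₁ + k₃) / (ρ₂ - ρ₁) ^ 3,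
    div_ne_zero h₂ (pow_ne_zero _ hd), div_ne_zero (neg_ne_zero.2 h₁) (pow_ne_zero _ hd),
    fun a S B => ?_⟩
  push_cast
  field_simp
  ring

/-! ### Irreducibility of focal cubics -/

/-- A ternary cubic without a linear factor is irreducible. Since the cubic does not vanish at
`(0, 0, 1)`, its linear factors are multiples of `z - u x - v y`. -/
lemma irreducible_of_no_line {f : MvPolynomial (Fin 3) ℂ} (hf : f.IsHomogeneous 3)
    (h1 : eval ![0, 0, 1] f ≠ 0)
    (h : ∀ u v : ℂ, ¬ ∀ x y : ℂ, eval ![x, y, u * x + v * y] f = 0) : Irreducible f := by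
  have h0 : f ≠ 0 := fun h0 => h1 (by rw [h0, map_zero])
  have noLin : ∀ p : MvPolynomial (Fin 3) ℂ, p.IsHomogeneous 1 → ¬ p ∣ f := by
    rintro p hp ⟨g, rfl⟩
    obtain ⟨l, hl⟩ := exists_linear_eq hp
    have hl2 : l 2 ≠ 0 := by
      intro hl2
      apply h1
      rw [map_mul, hl, hl2]
      simp
    refine h (-(l 0) / l 2) (-(l 1) / l 2) fun x y => ?_
    rw [map_mul, hl]
    simp only [Matrix.cons_val]
    field_simp
    ring
  refine ⟨not_isUnit_of_isHomogeneous hf three_ne_zero, fun p q hpq => ?_⟩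
  subst hpq
  obtain ⟨m, n, hm, hn, hmn⟩ := isHomogeneous_mul_split hf h0
  by_contra hu
  rw [not_or] at hu
  have hm0 : m ≠ 0 := by
    rintro rfl
    exact hu.1 (isUnit_of_isHomogeneous_zero hm (left_ne_zero_of_mul h0))
  have hn0 : n ≠ 0 := by
    rintro rfl
    exact hu.2 (isUnit_of_isHomogeneous_zero hn (right_ne_zero_of_mul h0))
  rcases (by omega : m = 1 ∨ n = 1) with rfl | rfl
  · exact noLin p hm (dvd_mul_right _ _)
  · exact noLin q hn (dvd_mul_left _ _)

/-- A linear factor of a hyperbolic focal cubic is real, so by its value at `(1, i)` it is the dual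
line of one of the foci; this line is contained in the cubic only if `b + i c = a l_j`. -/
lemma focalCubic_no_line {l₁ l₂ l₃ : ℂ} {a b c : ℝ}
    (hyp : ∀ (x y : ℝ) (z : ℂ), eval ![(x : ℂ), y, z] (focalCubic l₁ l₂ l₃ a b c) = 0 → z.im = 0)
    (h₁ : (b + c * Complex.I : ℂ) ≠ a * l₁) (h₂ : (b + c * Complex.I : ℂ) ≠ a * l₂)
    (h₃ : (b + c * Complex.I : ℂ) ≠ a * l₃) (u v : ℂ) :
    ¬ ∀ x y : ℂ, eval ![x, y, u * x + v * y] (focalCubic l₁ l₂ l₃ a b c) = 0 := by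
  intro h
  have hu : u.im = 0 := by simpa using hyp 1 0 (u * 1 + v * 0) (by simpa using h 1 0)
  have hv : v.im = 0 := by simpa using hyp 0 1 (u * 0 + v * 1) (by simpa using h 0 1)
  have real : ∀ u : ℂ, u.im = 0 → u = (u.re : ℂ) := fun u hu => by
    apply Complex.ext <;> simp [hu]
  rw [real u hu, real v hv] at h
  generalize u.re = s at h
  generalize v.re = t at h
  have hI :
      (s + t * Complex.I + l₁) * (s + t * Complex.I + l₂) * (s + t * Complex.I + l₃) = 0 := by
    have := h 1 Complex.I
    rw [eval_focalCubic] at this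
    simp only [Matrix.cons_val, mul_one, Complex.re_add_im] at this
    linear_combination this + (a * (s + t * Complex.I) + b + c * Complex.I) * Complex.I_sq
  have hx := h 1 0
  have hy := h 0 1
  rw [eval_focalCubic] at hx hy
  simp only [Matrix.cons_val, mul_one, mul_zero, add_zero, zero_add, one_pow,
    zero_pow two_ne_zero, one_mul] at hx hy
  have aux : ∀ l : ℂ, s + t * Complex.I + l = 0 → (s : ℂ) + l.re = 0 ∧ (t : ℂ) + l.im = 0 := by
    intro l hl
    have hr : s + l.re = 0 := by simpa using congrArg Complex.re hl
    have hi : t + l.im = 0 := by simpa using congrArg Complex.im hl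
    exact ⟨by exact_mod_cast hr, by exact_mod_cast hi⟩
  rcases mul_eq_zero.1 hI with hI | hI
  · rcases mul_eq_zero.1 hI with hI | hI
    · obtain ⟨e1, e2⟩ := aux _ hI
      rw [e1] at hx
      rw [e2] at hy
      exact h₁ (by linear_combination -hx - Complex.I * hy - a * hI)
    · obtain ⟨e1, e2⟩ := aux _ hI
      rw [e1] at hx
      rw [e2] at hy
      exact h₂ (by linear_combination -hx - Complex.I * hy - a * hI)
  · obtain ⟨e1, e2⟩ := aux _ hI
    rw [e1] at hx
    rw [e2] at hy
    exact h₃ (by linear_combination -hx - Complex.I * hy - a * hI)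

/-- A hyperbolic focal cubic without linear factors that has a double point at
`(cos θ, sin θ, μ)` is, up to a real change of coordinates, a nodal cubic with real tangents at
the node. Here `μ_j` are the values of the linear forms of the foci at the double point. The
tangents at the node have last coordinate `1`, so they are dual to affine points. -/
lemma exists_linSubst_nodalCubic {l₁ l₂ l₃ : ℂ} {a b c θ μ μ₁ μ₂ μ₃ : ℝ}
    (hμ₁ : μ₁ = (Complex.exp (-(Complex.I * θ)) * l₁).re + μ)
    (hμ₂ : μ₂ = (Complex.exp (-(Complex.I * θ)) * l₂).re + μ)
    (hμ₃ : μ₃ = (Complex.exp (-(Complex.I * θ)) * l₃).re + μ)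
    (ha : a = μ₂ * μ₃ + μ₁ * μ₃ + μ₁ * μ₂)
    (hb : b = l₁.re * μ₂ * μ₃ + l₂.re * μ₁ * μ₃ + l₃.re * μ₂ * μ₁ - 2 * μ₁ * μ₂ * μ₃ * Real.cos θ)
    (hc : c = l₁.im * μ₂ * μ₃ + l₂.im * μ₁ * μ₃ + l₃.im * μ₂ * μ₁ - 2 * μ₁ * μ₂ * μ₃ * Real.sin θ)
    (hyp : ∀ (x y : ℝ) (z : ℂ), eval ![(x : ℂ), y, z] (focalCubic l₁ l₂ l₃ a b c) = 0 → z.im = 0)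
    (hline : ∀ u v : ℂ, ¬ ∀ x y : ℂ, eval ![x, y, u * x + v * y] (focalCubic l₁ l₂ l₃ a b c) = 0) :
    ∃ (T : Matrix (Fin 3) (Fin 3) ℝ) (κ κ' : ℝ),
      T.det ≠ 0 ∧ T 0 2 = 1 ∧ T 1 2 = 1 ∧ κ ≠ 0 ∧ κ' ≠ 0 ∧
      focalCubic l₁ l₂ l₃ a b c = linSubst (T.map (↑)) (nodalCubic κ κ') := by
  set C := Real.cos θ with hC
  set s := Real.sin θ with hs
  have hCs : C ^ 2 + s ^ 2 = 1 := Real.cos_sq_add_sin_sq θ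
  have hCs' : (C : ℂ) ^ 2 + (s : ℂ) ^ 2 = 1 := by exact_mod_cast hCs
  have hexp : ∀ l : ℂ, (Complex.exp (-(Complex.I * θ)) * l).re = C * l.re + s * l.im := by
    intro l
    have : -(Complex.I * θ) = ((-θ : ℝ) : ℂ) * Complex.I := by push_cast; ring
    rw [this, Complex.mul_re, Complex.exp_ofReal_mul_I_re, Complex.exp_ofReal_mul_I_im,
      Real.cos_neg, Real.sin_neg]
    ring
  rw [hexp] at hμ₁ hμ₂ hμ₃
  set ν₁ := C * l₁.im - s * l₁.re with hν₁
  set ν₂ := C * l₂.im - s * l₂.re with hν₂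
  set ν₃ := C * l₃.im - s * l₃.re with hν₃
  have r₁ : l₁.re = C * (μ₁ - μ) - s * ν₁ := by
    rw [hμ₁, hν₁]; linear_combination (-l₁.re) * hCs
  have r₂ : l₂.re = C * (μ₂ - μ) - s * ν₂ := by
    rw [hμ₂, hν₂]; linear_combination (-l₂.re) * hCs
  have r₃ : l₃.re = C * (μ₃ - μ) - s * ν₃ := by
    rw [hμ₃, hν₃]; linear_combination (-l₃.re) * hCs
  have i₁ : l₁.im = s * (μ₁ - μ) + C * ν₁ := by
    rw [hμ₁, hν₁]; linear_combination (-l₁.im) * hCs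
  have i₂ : l₂.im = s * (μ₂ - μ) + C * ν₂ := by
    rw [hμ₂, hν₂]; linear_combination (-l₂.im) * hCs
  have i₃ : l₃.im = s * (μ₃ - μ) + C * ν₃ := by
    rw [hμ₃, hν₃]; linear_combination (-l₃.im) * hCs
  clear_value C s ν₁ ν₂ ν₃
  let q₀ := μ₁ + μ₂ + μ₃
  let q₁ := μ₁ * (ν₂ + ν₃) + μ₂ * (ν₁ + ν₃) + μ₃ * (ν₁ + ν₂)
  let q₂ := μ₁ * ν₂ * ν₃ + μ₂ * ν₁ * ν₃ + μ₃ * ν₁ * ν₂ - μ₁ * μ₂ * μ₃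
  let k₁ := ν₁ + ν₂ + ν₃
  let k₂ := ν₁ * ν₂ + ν₁ * ν₃ + ν₂ * ν₃ - (μ₂ * μ₃ + μ₁ * μ₃ + μ₁ * μ₂)
  let k₃ := ν₁ * ν₂ * ν₃ - (ν₁ * μ₂ * μ₃ + ν₂ * μ₁ * μ₃ + ν₃ * μ₁ * μ₂)
  -- In the coordinates `S`, `B` and `a = z - μ S` the double point is `(0, 1, 0)`.
  have form : ∀ x y a' S B : ℂ, S = C * x + s * y → B = C * y - s * x →
      eval ![x, y, a' + μ * S] (focalCubic l₁ l₂ l₃ a b c) =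
        S * (q₀ * a' ^ 2 + q₁ * (a' * B) + q₂ * B ^ 2)
          + (a' ^ 3 + k₁ * (a' ^ 2 * B) + k₂ * (a' * B ^ 2) + k₃ * B ^ 3) := by
    intro x y a' S B hS hB
    have hn : x ^ 2 + y ^ 2 = S ^ 2 + B ^ 2 := by
      rw [hS, hB]
      linear_combination (-(x ^ 2 + y ^ 2)) * hCs'
    have e₁ : (l₁.re : ℂ) * x + l₁.im * y = (μ₁ - μ) * S + ν₁ * B := by
      rw [r₁, i₁, hS, hB]; push_cast; ring
    have e₂ : (l₂.re : ℂ) * x + l₂.im * y = (μ₂ - μ) * S + ν₂ * B := by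
      rw [r₂, i₂, hS, hB]; push_cast; ring
    have e₃ : (l₃.re : ℂ) * x + l₃.im * y = (μ₃ - μ) * S + ν₃ * B := by
      rw [r₃, i₃, hS, hB]; push_cast; ring
    have e : (a : ℂ) * (a' + μ * S) + b * x + c * y =
        (μ₂ * μ₃ + μ₁ * μ₃ + μ₁ * μ₂) * a' + μ₁ * μ₂ * μ₃ * S
          + (ν₁ * μ₂ * μ₃ + ν₂ * μ₁ * μ₃ + ν₃ * μ₁ * μ₂) * B := by
      rw [ha, hb, hc, r₁, r₂, r₃, i₁, i₂, i₃, hS, hB]; push_cast; ring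
    rw [eval_focalCubic]
    simp only [Matrix.cons_val]
    rw [e₁, e₂, e₃, e, hn]
    simp only [q₀, q₁, q₂, k₁, k₂, k₃]
    push_cast
    ring
  have form' : ∀ a' S B : ℂ, eval ![C * S - s * B, s * S + C * B, a' + μ * S]
      (focalCubic l₁ l₂ l₃ a b c) = S * (q₀ * a' ^ 2 + q₁ * (a' * B) + q₂ * B ^ 2)
          + (a' ^ 3 + k₁ * (a' ^ 2 * B) + k₂ * (a' * B ^ 2) + k₃ * B ^ 3) := fun a' S B =>
    form _ _ _ _ _ (by linear_combination (-S) * hCs') (by linear_combination (-B) * hCs')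
  have hQK : ∀ β : ℂ, q₀ * β ^ 2 + q₁ * β + q₂ = 0 → β ^ 3 + k₁ * β ^ 2 + k₂ * β + k₃ ≠ 0 := by
    intro β hQ hK
    refine hline (μ * C - β * s) (μ * s + β * C) fun x y => ?_
    have := form x y (β * (C * y - s * x)) (C * x + s * y) (C * y - s * x) rfl rfl
    rw [show (μ * C - β * s) * x + (μ * s + β * C) * y
      = β * (C * y - s * x) + μ * (C * x + s * y) by ring, this]
    linear_combination (C * x + s * y) * (C * y - s * x) ^ 2 * hQ + (C * y - s * x) ^ 3 * hK
  obtain ⟨ρ₁, ρ₂, hq0, hρ, hq1, hq2⟩ := exists_node_tangents (q₀ := q₀) (q₁ := q₁) (q₂ := q₂)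
    (k₁ := k₁) (k₂ := k₂) (k₃ := k₃) (fun S a' h0 => by
      have h1 := form' a' S 1
      rw [show S * (q₀ * a' ^ 2 + q₁ * (a' * 1) + q₂ * 1 ^ 2) + (a' ^ 3 + k₁ * (a' ^ 2 * 1)
        + k₂ * (a' * 1 ^ 2) + k₃ * 1 ^ 3) = (0 : ℂ) by linear_combination h0] at h1
      have h2 := hyp (C * S - s * 1) (s * S + C * 1) (a' + μ * S) (by push_cast; exact h1)
      simpa using h2) hQK
  obtain ⟨κ₀, κ₁, κ₂, κ₃, hκ₀, hκ₃, hform⟩ := exists_node_form (q₀ := q₀) (k₁ := k₁) (k₂ := k₂)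
    (k₃ := k₃) hρ (by
      have := hQK ρ₁ (by rw [hq1, hq2]; push_cast; ring)
      exact_mod_cast this) (by
      have := hQK ρ₂ (by rw [hq1, hq2]; push_cast; ring)
      exact_mod_cast this)
  refine ⟨!![-(μ * C) + ρ₁ * s, -(μ * s) - ρ₁ * C, 1; -(μ * C) + ρ₂ * s, -(μ * s) - ρ₂ * C, 1;
    q₀ * C + κ₁ * (-(μ * C) + ρ₁ * s) + κ₂ * (-(μ * C) + ρ₂ * s),
    q₀ * s + κ₁ * (-(μ * s) - ρ₁ * C) + κ₂ * (-(μ * s) - ρ₂ * C), κ₁ + κ₂], κ₀, κ₃, ?_, rfl, rfl,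
    hκ₀, hκ₃, MvPolynomial.funext fun P => ?_⟩
  · have : Matrix.det !![-(μ * C) + ρ₁ * s, -(μ * s) - ρ₁ * C, 1; -(μ * C) + ρ₂ * s,
      -(μ * s) - ρ₂ * C, 1; q₀ * C + κ₁ * (-(μ * C) + ρ₁ * s) + κ₂ * (-(μ * C) + ρ₂ * s),
      q₀ * s + κ₁ * (-(μ * s) - ρ₁ * C) + κ₂ * (-(μ * s) - ρ₂ * C), κ₁ + κ₂]
        = q₀ * (ρ₂ - ρ₁) * (C ^ 2 + s ^ 2) := by
      rw [Matrix.det_fin_three]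
      simp
      ring
    rw [this, hCs, mul_one]
    exact mul_ne_zero hq0 (sub_ne_zero.2 hρ.symm)
  · have h1 := form (P 0) (P 1) (P 2 - μ * (C * P 0 + s * P 1)) _ _ rfl rfl
    rw [sub_add_cancel] at h1
    have hP : ![P 0, P 1, P 2] = P := by
      ext i
      fin_cases i <;> rfl
    rw [hP] at h1
    rw [h1, eval_linSubst, eval_nodalCubic]
    have h2 := hform (P 2 - μ * (C * P 0 + s * P 1)) (C * P 0 + s * P 1) (C * P 1 - s * P 0)
    have hm : ∀ i, ((Matrix.map !![-(μ * C) + ρ₁ * s, -(μ * s) - ρ₁ * C, 1; -(μ * C) + ρ₂ * s,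
      -(μ * s) - ρ₂ * C, 1; q₀ * C + κ₁ * (-(μ * C) + ρ₁ * s) + κ₂ * (-(μ * C) + ρ₂ * s),
      q₀ * s + κ₁ * (-(μ * s) - ρ₁ * C) + κ₂ * (-(μ * s) - ρ₂ * C), κ₁ + κ₂]
      (fun x : ℝ => (x : ℂ))).mulVec P) i =
        ![P 2 - μ * (C * P 0 + s * P 1) - ρ₁ * (C * P 1 - s * P 0),
        P 2 - μ * (C * P 0 + s * P 1) - ρ₂ * (C * P 1 - s * P 0), q₀ * (C * P 0 + s * P 1)
        + κ₁ * (P 2 - μ * (C * P 0 + s * P 1) - ρ₁ * (C * P 1 - s * P 0))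
        + κ₂ * (P 2 - μ * (C * P 0 + s * P 1) - ρ₂ * (C * P 1 - s * P 0))] i := by
      intro i
      fin_cases i <;> simp [Matrix.mulVec, dotProduct, Fin.sum_univ_three] <;> ring
    rw [hm, hm, hm]
    simp only [Matrix.cons_val]
    rw [← h2, hq1, hq2]
    push_cast
    ring

/-! ### The quartic dual to a real nodal cubic -/

lemma dualCurve_eq_of_associated {f g : MvPolynomial (Fin 3) ℂ} (h : Associated f g) :
    dualCurve f = dualCurve g := by
  have key : ∀ {f g : MvPolynomial (Fin 3) ℂ}, Associated f g → dualCurve f ⊆ dualCurve g := by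
    rintro f g ⟨u, rfl⟩ v ⟨hv0, hv⟩
    obtain ⟨c, hc, hu⟩ := isUnit_iff_eq_C_of_isReduced.1 u.isUnit
    have hgrad : ∀ P, grad (f * u) P = c • grad f P := by
      intro P
      ext i
      simp [grad, hu, Derivation.leibniz]
    refine ⟨hv0, fun d G hG hvan => hv d G hG fun P hP0 hP hPg => ?_⟩
    have := hvan P hP0 (by rw [map_mul, hP, zero_mul])
      (by rw [hgrad]; exact smul_ne_zero hc.ne_zero hPg)
    rw [hgrad] at this
    exact isHomogeneous_eval_eq_zero_of_smul hG hc.ne_zero this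
  exact (key h).antisymm (key h.symm)

/-- Only finitely many tangents of a nodal cubic, with real parameters, pass through a given real
point. -/
lemma finite_nodalTangent {κ κ' : ℝ} (hκ : κ ≠ 0) (hκ' : κ' ≠ 0) {c : Fin 3 → ℝ} (hc : c ≠ 0) :
    {τ : ℝ | c 0 * (2 * κ * τ - κ' * τ ^ 4) + c 1 * (2 * κ' * τ ^ 3 - κ)
      + c 2 * τ ^ 2 = 0}.Finite := by
  let p : Polynomial ℝ := Polynomial.C (-(κ' * c 0)) * Polynomial.X ^ 4
    + Polynomial.C (2 * κ' * c 1) * Polynomial.X ^ 3 + Polynomial.C (c 2) * Polynomial.X ^ 2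
    + Polynomial.C (2 * κ * c 0) * Polynomial.X + Polynomial.C (-(κ * c 1))
  have hp : p ≠ 0 := by
    intro hp
    apply hc
    have h4 : p.coeff 4 = -(κ' * c 0) := by
      simp only [p, Polynomial.coeff_add, Polynomial.coeff_C_mul, Polynomial.coeff_X_pow,
        Polynomial.coeff_X, Polynomial.coeff_C]
      norm_num
    have h2 : p.coeff 2 = c 2 := by
      simp only [p, Polynomial.coeff_add, Polynomial.coeff_C_mul, Polynomial.coeff_X_pow,
        Polynomial.coeff_X, Polynomial.coeff_C]
      norm_num
    have h0 : p.coeff 0 = -(κ * c 1) := by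
      simp [p, Polynomial.coeff_X]
    rw [hp, Polynomial.coeff_zero] at h4 h2 h0
    ext i
    fin_cases i
    · simpa [hκ'] using h4.symm
    · simpa [hκ] using h0.symm
    · exact h2.symm
  refine (Polynomial.finite_setOfPred_isRoot hp).subset fun τ hτ => ?_
  have h1 : c 0 * (2 * κ * τ - κ' * τ ^ 4) + c 1 * (2 * κ' * τ ^ 3 - κ) + c 2 * τ ^ 2 = 0 := hτ
  change p.eval τ = 0
  simp only [p, Polynomial.eval_add, Polynomial.eval_mul, Polynomial.eval_C, Polynomial.eval_pow,
    Polynomial.eval_X]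
  linear_combination h1

/-- The tangents with real parameters give infinitely many real affine points of the dual curve. -/
lemma infinite_dual_linSubst_nodalCubic {T : Matrix (Fin 3) (Fin 3) ℝ} (hT : T.det ≠ 0)
    {κ κ' : ℝ} (hκ : κ ≠ 0) (hκ' : κ' ≠ 0) :
    {ζ : ℂ | ∃ (k : ℂ) (τ : ℝ), k ≠ 0 ∧
      (T.map ((↑) : ℝ → ℂ)).transpose.mulVec (nodalTangent κ κ' 1 τ)
        = k • homCoord ζ}.Infinite := by
  let n : ℝ → Fin 3 → ℝ := fun τ => ![2 * κ * τ - κ' * τ ^ 4, 2 * κ' * τ ^ 3 - κ, τ ^ 2]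
  let u : ℝ → Fin 3 → ℝ := fun τ => T.transpose.mulVec (n τ)
  have hu : ∀ τ i, u τ i = T 0 i * n τ 0 + T 1 i * n τ 1 + T 2 i * n τ 2 := fun τ i => by
    simp [u, Matrix.mulVec, dotProduct, Fin.sum_univ_three]
  have hcol : ∀ s : ℝ, (fun i => T i 0 - s * T i 2) ≠ 0 := by
    intro s h0
    apply hT
    have h : ∀ i, T i 0 = s * T i 2 := fun i => by
      have := congrFun h0 i
      simp only [Pi.zero_apply] at this
      linarith
    rw [Matrix.det_fin_three, h 0, h 1, h 2]
    ring
  have hcol2 : (fun i => T i 2) ≠ 0 := by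
    intro h0
    apply hT
    have h : ∀ i, T i 2 = 0 := fun i => congrFun h0 i
    rw [Matrix.det_fin_three, h 0, h 1, h 2]
    ring
  have hfin2 : {τ | u τ 2 = 0}.Finite := by
    refine (finite_nodalTangent hκ hκ' hcol2).subset fun τ hτ => ?_
    have : u τ 2 = 0 := hτ
    rw [hu] at this
    exact this
  let φ : ℝ → ℂ := fun τ => ⟨u τ 0 / u τ 2, u τ 1 / u τ 2⟩
  intro hfin
  have hpre := hfin.preimage' (f := φ) fun ζ _ => by
    refine ((finite_nodalTangent hκ hκ' (hcol ζ.re)).union hfin2).subset fun τ hτ => ?_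
    by_cases h2 : u τ 2 = 0
    · exact Or.inr h2
    · left
      have h1 : u τ 0 / u τ 2 = ζ.re := congrArg Complex.re hτ
      rw [div_eq_iff h2, hu, hu] at h1
      change (T 0 0 - ζ.re * T 0 2) * n τ 0 + (T 1 0 - ζ.re * T 1 2) * n τ 1
        + (T 2 0 - ζ.re * T 2 2) * n τ 2 = 0
      linear_combination h1
  refine Set.infinite_univ ((hpre.union hfin2).subset fun τ _ => ?_)
  by_cases h2 : u τ 2 = 0
  · exact Or.inr h2
  · left
    refine ⟨u τ 2, τ, by exact_mod_cast h2, ?_⟩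
    have h2' : (u τ 2 : ℂ) ≠ 0 := by exact_mod_cast h2
    have hc : ∀ i, (T.map ((↑) : ℝ → ℂ)).transpose.mulVec (nodalTangent κ κ' 1 τ) i
        = ((u τ i : ℝ) : ℂ) := by
      intro i
      rw [hu]
      simp [Matrix.mulVec, dotProduct, Fin.sum_univ_three, nodalTangent, n]
    ext i
    rw [hc]
    fin_cases i
    · simp [homCoord, φ, mul_div_cancel₀ _ h2']
    · simp [homCoord, φ, mul_div_cancel₀ _ h2']
    · simp [homCoord]

/-- The dual of a focal cubic that is projectively equivalent over the reals to a nodal cubic with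
real tangents at the node is a quartic with a double tangent, the dual of the node. -/
lemma isQuarticWithDoubleTangent_of_linSubst {l₁ l₂ l₃ a b c : ℂ} {T : Matrix (Fin 3) (Fin 3) ℝ}
    (hT : T.det ≠ 0) (h₀ : T 0 2 = 1) (h₁ : T 1 2 = 1) {κ κ' : ℝ} (hκ : κ ≠ 0) (hκ' : κ' ≠ 0)
    (hf : focalCubic l₁ l₂ l₃ a b c = linSubst (T.map (↑)) (nodalCubic κ κ')) :
    IsQuarticWithDoubleTangent {ζ | homCoord ζ ∈ dualCurve (focalCubic l₁ l₂ l₃ a b c)}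
      {l₁, l₂, l₃} := by
  have hκC : (κ : ℂ) ≠ 0 := by exact_mod_cast hκ
  have hκC' : (κ' : ℂ) ≠ 0 := by exact_mod_cast hκ'
  set M : Matrix (Fin 3) (Fin 3) ℂ := T.map (↑) with hM
  set N : Matrix (Fin 3) (Fin 3) ℂ := T⁻¹.map (↑) with hN
  have hMN : M * N = 1 := by
    have h1 : T * T⁻¹ = 1 := Matrix.mul_nonsing_inv _ (isUnit_iff_ne_zero.2 hT)
    have h2 := congrArg (fun A : Matrix (Fin 3) (Fin 3) ℝ => A.map Complex.ofRealHom) h1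
    simp only [Matrix.map_mul] at h2
    rw [Matrix.map_one _ (map_zero _) (map_one _)] at h2
    exact h2
  have hNM : N.transpose * M.transpose = 1 := by
    rw [← Matrix.transpose_mul, hMN, Matrix.transpose_one]
  have hMN' : M.transpose * N.transpose = 1 := mul_eq_one_comm.1 hNM
  have hM0 : ∀ {u : Fin 3 → ℂ}, u ≠ 0 → M.mulVec u ≠ 0 := fun {u} hu h0 => hu <| by
    have : N.mulVec (M.mulVec u) = u := by
      rw [Matrix.mulVec_mulVec, mul_eq_one_comm.1 hMN, Matrix.one_mulVec]
    rw [← this, h0, Matrix.mulVec_zero]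
  have hN0 : ∀ {u : Fin 3 → ℂ}, u ≠ 0 → N.mulVec u ≠ 0 := fun {u} hu h0 => hu <| by
    have : M.mulVec (N.mulVec u) = u := by
      rw [Matrix.mulVec_mulVec, hMN, Matrix.one_mulVec]
    rw [← this, h0, Matrix.mulVec_zero]
  have hNt0 : ∀ {u : Fin 3 → ℂ}, u ≠ 0 → N.transpose.mulVec u ≠ 0 := fun {u} hu h0 => hu <| by
    have : M.transpose.mulVec (N.transpose.mulVec u) = u := by
      rw [Matrix.mulVec_mulVec, hMN', Matrix.one_mulVec]
    rw [← this, h0, Matrix.mulVec_zero]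
  set g := linSubst N.transpose (dualQuartic κ κ') with hg
  have hdual : ∀ u : Fin 3 → ℂ, u ∈ dualCurve (focalCubic l₁ l₂ l₃ a b c) ↔
      u ≠ 0 ∧ eval u g = 0 := by
    intro u
    rw [hf, mem_dualCurve_linSubst hMN, mem_dualCurve_nodalCubic hκC hκC', hg, eval_linSubst]
    refine and_congr_left fun _ => ⟨fun h h0 => h (by rw [h0, Matrix.mulVec_zero]), hNt0⟩
  have hbidual : ∀ u : Fin 3 → ℂ, u ∈ dualCurve g ↔
      u ≠ 0 ∧ eval u (focalCubic l₁ l₂ l₃ a b c) = 0 := by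
    intro u
    rw [hg, mem_dualCurve_linSubst hNM, Matrix.transpose_transpose,
      mem_dualCurve_dualQuartic hκC hκC', hf, eval_linSubst]
    refine and_congr_left fun _ => ⟨fun h h0 => h (by rw [h0, Matrix.mulVec_zero]), hM0⟩
  have hS : {ζ | homCoord ζ ∈ dualCurve (focalCubic l₁ l₂ l₃ a b c)}
      = {ζ | eval (homCoord ζ) g = 0} := by
    ext ζ
    simp only [Set.mem_ofPred_eq, hdual, homCoord_ne_zero, ne_eq, not_false_eq_true, true_and]
  refine ⟨g, irreducible_linSubst hNM (irreducible_dualQuartic hκC hκC'),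
    isHomogeneous_linSubst (isHomogeneous_dualQuartic _ _), hS, ?_, ?_, ?_⟩
  · rw [hS]
    refine (infinite_dual_linSubst_nodalCubic hT hκ hκ').mono ?_
    rintro ζ ⟨k, τ, hk, h⟩
    change eval (homCoord ζ) g = 0
    refine isHomogeneous_eval_eq_zero_of_smul (c := k)
      (isHomogeneous_linSubst (isHomogeneous_dualQuartic _ _)) hk ?_
    rw [← h, eval_linSubst, Matrix.mulVec_mulVec, ← hM, hNM, Matrix.one_mulVec, eval_nodalTangent]
  · -- The double tangent is the dual of the node; the points of contact are dual to the tangents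
    -- there, the first two rows of `T`.
    let pt : Fin 3 → ℂ := fun i => ⟨T i 0, T i 1⟩
    have hpt : ∀ i, T i 2 = 1 → N.transpose.mulVec (homCoord (pt i)) = Pi.single i 1 := by
      intro i hi
      have : homCoord (pt i) = M.transpose.mulVec (Pi.single i 1) := by
        rw [Matrix.mulVec_single_one]
        ext j
        fin_cases j
        · simp [homCoord, pt, hM]
        · simp [homCoord, pt, hM]
        · simp [homCoord, hM, hi]
      rw [this, Matrix.mulVec_mulVec, hNM, Matrix.one_mulVec]
    have hg0 : grad g (homCoord (pt 0)) = (4 * κ' : ℂ) • N.mulVec (Pi.single 2 1) := by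
      rw [hg, grad_linSubst, hpt 0 h₀, Matrix.transpose_transpose, grad_dualQuartic,
        ← Matrix.mulVec_smul]
      congr 1
      ext i
      fin_cases i <;> simp
    have hg1 : grad g (homCoord (pt 1)) = (4 * κ : ℂ) • N.mulVec (Pi.single 2 1) := by
      rw [hg, grad_linSubst, hpt 1 h₁, Matrix.transpose_transpose, grad_dualQuartic,
        ← Matrix.mulVec_smul]
      congr 1
      ext i
      fin_cases i <;> simp
    refine ⟨pt 0, pt 1, ?_, ?_, ?_, ?_, κ / κ', div_ne_zero hκC hκC', ?_⟩
    · intro h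
      have := congrFun
        ((hpt 0 h₀).symm.trans ((congrArg _ (congrArg homCoord h)).trans (hpt 1 h₁))) 0
      simp at this
    · rw [hg, eval_linSubst, hpt 0 h₀, eval_dualQuartic]
      simp
    · rw [hg, eval_linSubst, hpt 1 h₁, eval_dualQuartic]
      simp
    · rw [hg0]
      refine smul_ne_zero (mul_ne_zero (by norm_num) hκC') (hN0 ?_)
      intro h
      simpa using congrFun h 2
    · rw [hg0, hg1, smul_smul]
      congr 1
      field_simp
  · -- The focal cubic takes the values `∏ (l_j - l)` and `∏ conj (l_j - l)` at the isotropic lines.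
    ext l
    have e1 : (![1, Complex.I, -l] : Fin 3 → ℂ) ≠ 0 := fun h => by simpa using congrFun h 0
    have e2 : (![1, -Complex.I, -(starRingEnd ℂ l)] : Fin 3 → ℂ) ≠ 0 := fun h => by
      simpa using congrFun h 0
    have hre : ∀ z : ℂ, (z.re + z.im * Complex.I : ℂ) = z := Complex.re_add_im
    have hconj : ∀ z : ℂ, (z.re + -(z.im * Complex.I) : ℂ) = starRingEnd ℂ z := fun z => by
      apply Complex.ext <;> simp
    simp only [Set.mem_ofPred_eq, IsFocus, hbidual, e1, e2, ne_eq, not_false_eq_true, true_and,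
      eval_focalCubic, Matrix.cons_val, mul_one, mul_neg, hre, hconj, one_pow, Complex.I_sq,
      add_neg_cancel, zero_mul, sub_zero, neg_sq, mul_eq_zero, neg_add_eq_zero, Set.mem_insert_iff,
      Set.mem_singleton_iff, (starRingEnd ℂ).injective.eq_iff, and_self, or_assoc]

/-- The real Kippenhahn curve of a matrix whose Kippenhahn polynomial splits into the dual of an
ellipse and an irreducible polynomial. -/
lemma realKippenhahnCurve_eq_union {n : ℕ} {A : Matrix (Fin n) (Fin n) ℂ} {a b : ℂ} {r : ℝ}
    (hr : 0 < r) {h : MvPolynomial (Fin 3) ℂ} (hh : Irreducible h)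
    (hp : kippenhahnPoly A = conic (ellipseCoeff a b r) * h) :
    realKippenhahnCurve A = ellipse a b r ∪ {ζ | homCoord ζ ∈ dualCurve h} := by
  have hc := irreducible_conic (conicDisc_ellipseCoeff a b hr)
  ext ζ
  rw [Set.mem_union, ← homCoord_mem_dualCurve_ellipseCoeff hr]
  constructor
  · rintro ⟨f, hf, hfp, hζ⟩
    rw [hp] at hfp
    rcases hf.prime.dvd_or_dvd hfp with hd | hd
    · exact Or.inl (dualCurve_eq_of_associated (hf.associated_of_dvd hc hd) ▸ hζ)
    · exact Or.inr (by
        change homCoord ζ ∈ dualCurve h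
        exact dualCurve_eq_of_associated (hf.associated_of_dvd hh hd) ▸ hζ)
  · rintro (hζ | hζ)
    · exact ⟨_, hc, hp ▸ dvd_mul_right _ _, hζ⟩
    · exact ⟨_, hh, hp ▸ dvd_mul_left _ _, hζ⟩

/-! ### The components of the Kippenhahn curve -/

lemma isHomogeneous_kippenhahnPoly {n : ℕ} (A : Matrix (Fin n) (Fin n) ℂ) :
    (kippenhahnPoly A).IsHomogeneous n := by
  rw [kippenhahnPoly, Matrix.det_apply]
  refine IsHomogeneous.sum _ _ _ fun σ _ => ?_
  rw [Units.smul_def, zsmul_eq_mul, ← map_intCast (C : ℂ →+* MvPolynomial (Fin 3) ℂ)]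
  refine IsHomogeneous.C_mul ?_ _
  have h : (∏ i, ((X 0 : MvPolynomial (Fin 3) ℂ) • (reMat A).map (C : ℂ → MvPolynomial (Fin 3) ℂ) +
      (X 1 : MvPolynomial (Fin 3) ℂ) • (imMat A).map (C : ℂ → MvPolynomial (Fin 3) ℂ) +
      (X 2 : MvPolynomial (Fin 3) ℂ) • (1 : Matrix (Fin n) (Fin n) (MvPolynomial (Fin 3) ℂ)))
        (σ i) i).IsHomogeneous (∑ _i : Fin n, 1) := by
    refine IsHomogeneous.prod _ _ _ fun i _ => ?_
    simp only [Matrix.add_apply, Matrix.smul_apply, Matrix.map_apply, smul_eq_mul,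
      Matrix.one_apply]
    refine IsHomogeneous.add (IsHomogeneous.add ?_ ?_) ?_
    · rw [mul_comm]
      exact isHomogeneous_C_mul_X _ _
    · rw [mul_comm]
      exact isHomogeneous_C_mul_X _ _
    · split_ifs
      · rw [mul_one]
        exact isHomogeneous_X _ _
      · rw [mul_zero]
        exact isHomogeneous_zero _ _ _
  simpa using h

lemma kippenhahnPoly_ne_zero {n : ℕ} (A : Matrix (Fin n) (Fin n) ℂ) : kippenhahnPoly A ≠ 0 := by
  intro h
  have := eval_kippenhahnPoly_eq_det A ![0, 0, 1]
  rw [h] at this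
  simp at this

/-- An infinite set of real points of the Kippenhahn curve meets the dual of one of the finitely
many components in an infinite set. -/
lemma exists_component {n : ℕ} {A : Matrix (Fin n) (Fin n) ℂ} {T : Set ℂ} (hT : T.Infinite)
    (hTA : T ⊆ realKippenhahnCurve A) :
    ∃ f d, Irreducible f ∧ f.IsHomogeneous d ∧ f ∣ kippenhahnPoly A ∧
      ∃ T' ⊆ T, T'.Infinite ∧ ∀ ζ ∈ T', homCoord ζ ∈ dualCurve f := by
  classical
  have hp0 := kippenhahnPoly_ne_zero A
  let F := (UniqueFactorizationMonoid.factors (kippenhahnPoly A)).toFinset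
  have hcover : T ⊆ ⋃ f ∈ F, {ζ | ζ ∈ T ∧ homCoord ζ ∈ dualCurve f} := by
    intro ζ hζ
    obtain ⟨f, hf, hfp, hζf⟩ := hTA hζ
    obtain ⟨f', hf', hff'⟩ := UniqueFactorizationMonoid.exists_mem_factors_of_dvd hp0 hf hfp
    rw [dualCurve_eq_of_associated hff'] at hζf
    exact Set.mem_biUnion (Multiset.mem_toFinset.2 hf') ⟨hζ, hζf⟩
  obtain ⟨f, hfF, hinf⟩ : ∃ f ∈ F, {ζ | ζ ∈ T ∧ homCoord ζ ∈ dualCurve f}.Infinite := by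
    by_contra hall
    push Not at hall
    refine hT ((Set.Finite.biUnion F.finite_toSet fun f hf => ?_).subset hcover)
    exact hall f hf
  have hf := Multiset.mem_toFinset.1 hfF
  have hdvd := UniqueFactorizationMonoid.dvd_of_mem_factors hf
  exact ⟨f, _, UniqueFactorizationMonoid.irreducible_of_factor f hf,
    isHomogeneous_of_dvd (isHomogeneous_kippenhahnPoly A) hp0 hdvd, hdvd, _, fun ζ hζ => hζ.1, hinf,
    fun ζ hζ => hζ.2⟩

lemma le_of_dvd_of_isHomogeneous {σ : Type*} {g G : MvPolynomial σ ℂ} {d e : ℕ}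
    (hg : g.IsHomogeneous d) (hG : G.IsHomogeneous e) (hG0 : G ≠ 0) (h : g ∣ G) : d ≤ e := by
  obtain ⟨q, rfl⟩ := h
  obtain ⟨a, b, ha, _, rfl⟩ := isHomogeneous_mul_split hG hG0
  rw [hg.inj_right ha (left_ne_zero_of_mul hG0)]
  exact Nat.le_add_right _ _

/-- The linear form with coefficients `v`. -/
def linForm (v : Fin 3 → ℂ) : MvPolynomial (Fin 3) ℂ := ∑ i, C (v i) * X i

lemma isHomogeneous_linForm (v : Fin 3 → ℂ) : (linForm v).IsHomogeneous 1 :=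
  IsHomogeneous.sum _ _ _ fun _ _ => isHomogeneous_C_mul_X _ _

lemma eval_linForm (v P : Fin 3 → ℂ) :
    eval P (linForm v) = v 0 * P 0 + v 1 * P 1 + v 2 * P 2 := by
  simp [linForm, Fin.sum_univ_three]

lemma linForm_ne_zero {v : Fin 3 → ℂ} (hv : v ≠ 0) : linForm v ≠ 0 := by
  intro h
  apply hv
  ext i
  have := congrArg (eval (Pi.single i 1)) h
  rw [eval_linForm, map_zero] at this
  fin_cases i <;> simpa using this

/-- The dual of a line is a point. It satisfies a linear equation, which a form `g` of degree at
least `2` does not divide. -/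
lemma two_le_degree {f g : MvPolynomial (Fin 3) ℂ} {n d : ℕ} (hf : Irreducible f)
    (hfn : f.IsHomogeneous n) (hgd : g.IsHomogeneous d) (hd : 2 ≤ d)
    (hfg : ∀ G e, G.IsHomogeneous e → f ∣ bind₁ (gradPoly f) G → g ∣ G) : 2 ≤ n := by
  by_contra hn
  rcases (by omega : n = 0 ∨ n = 1) with rfl | rfl
  · exact hf.not_isUnit (isUnit_of_isHomogeneous_zero hfn hf.ne_zero)
  · obtain ⟨l, hl⟩ := exists_linear_eq hfn
    have hfl : f = linForm l := MvPolynomial.funext fun P => by rw [hl, eval_linForm]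
    have hgrad : ∀ P, grad f P = l := by
      intro P
      rw [hfl]
      ext i
      fin_cases i <;> simp [grad, linForm, pderiv_X, Fin.sum_univ_three, Derivation.leibniz]
    obtain ⟨v, hv, hvl⟩ : ∃ v : Fin 3 → ℂ, v ≠ 0 ∧ v 0 * l 0 + v 1 * l 1 + v 2 * l 2 = 0 := by
      by_cases h : l 0 = 0 ∧ l 1 = 0
      · exact ⟨![1, 0, 0], fun h0 => by simpa using congrFun h0 0, by simp [h.1]⟩
      · refine ⟨![l 1, -l 0, 0], fun h0 => h ⟨by simpa using congrFun h0 1,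
          by simpa using congrFun h0 0⟩, ?_⟩
        simp only [Matrix.cons_val]
        ring
    have := le_of_dvd_of_isHomogeneous hgd (isHomogeneous_linForm v) (linForm_ne_zero hv)
      (hfg _ 1 (isHomogeneous_linForm v) (dvd_of_forall_eval_eq_zero hf fun P _ => by
        rw [eval_bind_gradPoly, hgrad, eval_linForm, hvl]))
    omega

/-- The dual curve of a conic has degree at most two. -/
lemma three_le_degree {f g : MvPolynomial (Fin 3) ℂ} {n d : ℕ} (hf : Irreducible f)
    (hfn : f.IsHomogeneous n) (hgd : g.IsHomogeneous d) (hd : 3 ≤ d)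
    (hfg : ∀ G e, G.IsHomogeneous e → f ∣ bind₁ (gradPoly f) G → g ∣ G) : 3 ≤ n := by
  have h2 := two_le_degree hf hfn hgd (by omega) hfg
  by_contra hn
  obtain rfl : n = 2 := by omega
  obtain ⟨c, hc⟩ := exists_quadratic_eq hfn
  obtain rfl : f = conic c := MvPolynomial.funext fun P => by rw [hc, eval_conic]
  by_cases h0 : conicDisc c = 0
  · -- All tangents of a singular conic pass through the singular point.
    let M : Matrix (Fin 3) (Fin 3) ℂ :=
      !![2 * c 0, c 5, c 4; c 5, 2 * c 1, c 3; c 4, c 3, 2 * c 2]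
    have hM : M.det = 0 := by
      rw [Matrix.det_fin_three]
      simp only [M, Matrix.of_apply, Matrix.cons_val]
      rw [conicDisc] at h0
      linear_combination 2 * h0
    obtain ⟨v, hv, hMv⟩ := Matrix.exists_mulVec_eq_zero_iff.2 hM
    have hMv' : ∀ i, M i 0 * v 0 + M i 1 * v 1 + M i 2 * v 2 = 0 := fun i => by
      have := congrFun hMv i
      simpa [Matrix.mulVec, dotProduct, Fin.sum_univ_three] using this
    have e0 := hMv' 0
    have e1 := hMv' 1
    have e2 := hMv' 2
    simp only [M, Matrix.of_apply, Matrix.cons_val] at e0 e1 e2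
    have := le_of_dvd_of_isHomogeneous hgd (isHomogeneous_linForm v) (linForm_ne_zero hv)
      (hfg _ 1 (isHomogeneous_linForm v) (dvd_of_forall_eval_eq_zero hf fun P _ => by
        rw [eval_bind_gradPoly, eval_linForm, grad_conic]
        simp only [Matrix.cons_val]
        linear_combination P 0 * e0 + P 1 * e1 + P 2 * e2))
    omega
  · have hdual : conic (dualCoeff c) ≠ 0 := by
      intro hz
      have h1 : ∀ P, 4 * conicDisc c * eval P (conic c) = 0 := fun P => by
        rw [← eval_dualCoeff_grad, hz, map_zero]
      exact hf.ne_zero (MvPolynomial.funext fun P => by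
        rw [map_zero]
        exact (mul_eq_zero.1 (h1 P)).resolve_left (mul_ne_zero (by norm_num) h0))
    have := le_of_dvd_of_isHomogeneous hgd (isHomogeneous_conic _) hdual
      (hfg _ 2 (isHomogeneous_conic _) (dvd_of_forall_eval_eq_zero hf fun P hP => by
        rw [eval_bind_gradPoly, eval_dualCoeff_grad, hP, mul_zero]))
    omega

lemma conicDisc_dualCoeff (c : Fin 6 → ℂ) :
    conicDisc (dualCoeff c) = 16 * conicDisc c ^ 2 := by
  simp only [conicDisc, dualCoeff, Matrix.cons_val]
  ring

lemma eval_dualCoeff_dualCoeff (c : Fin 6 → ℂ) (P : Fin 3 → ℂ) :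
    eval P (conic (dualCoeff (dualCoeff c))) = 16 * conicDisc c * eval P (conic c) := by
  simp only [eval_conic, conicDisc, dualCoeff, Matrix.cons_val]
  ring

lemma exists_pderiv_not_dvd {f : MvPolynomial (Fin 3) ℂ} {n : ℕ} (hf : Irreducible f)
    (hfn : f.IsHomogeneous n) : ∃ j, ¬ f ∣ pderiv j f := by
  by_contra hall
  push Not at hall
  have hz : ∀ j, pderiv j f = 0 := by
    intro j
    by_contra hj
    have h1 := le_of_dvd_of_isHomogeneous hfn (hfn.pderiv (i := j)) hj (hall j)
    have hn : n ≠ 0 := by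
      rintro rfl
      exact hf.not_isUnit (isUnit_of_isHomogeneous_zero hfn hf.ne_zero)
    omega
  have h1 := hfn.sum_X_mul_pderiv
  simp only [hz, mul_zero, Finset.sum_const_zero] at h1
  have hn : n ≠ 0 := by
    rintro rfl
    exact hf.not_isUnit (isUnit_of_isHomogeneous_zero hfn hf.ne_zero)
  exact smul_ne_zero hn hf.ne_zero h1.symm

/-- An irreducible curve whose dual has infinitely many points on a smooth conic is the dual
conic. -/
lemma associated_conic {f : MvPolynomial (Fin 3) ℂ} {n : ℕ} (hf : Irreducible f)
    (hfn : f.IsHomogeneous n) {c : Fin 6 → ℂ} (hc : conicDisc c ≠ 0) {T : Set ℂ}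
    (hT : T.Infinite) (hTf : ∀ ζ ∈ T, homCoord ζ ∈ dualCurve f)
    (hTc : ∀ ζ ∈ T, eval (homCoord ζ) (conic (dualCoeff c)) = 0) :
    Associated f (conic c) := by
  have hc' : conicDisc (dualCoeff c) ≠ 0 := by
    rw [conicDisc_dualCoeff]
    exact mul_ne_zero (by norm_num) (pow_ne_zero _ hc)
  obtain ⟨h1, h2⟩ := dual_subset_of_infinite hf hfn (irreducible_conic hc')
    (isHomogeneous_conic _) hT hTf hTc
  have hn := two_le_degree hf hfn (isHomogeneous_conic _) le_rfl h2
  obtain ⟨j, hj⟩ := exists_pderiv_not_dvd hf hfn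
  have hdvd : f ∣ conic c * pderiv j f := by
    refine dvd_of_forall_eval_eq_zero hf fun P hP => ?_
    rw [map_mul]
    by_cases hg : grad f P = 0
    · have : eval P (pderiv j f) = 0 := congrFun hg j
      rw [this, mul_zero]
    · -- The line `grad f P` touches the conic at `P`, by biduality.
      have hb := biduality hf hfn hn (isHomogeneous_conic _) h1 hP
      set Q := grad (conic (dualCoeff c)) (grad f P)
      have hQ0 : Q ≠ 0 := fun h0 => hg (conic_eq_zero_of_grad_eq_zero hc' h0)
      have hu : eval (grad f P) (conic (dualCoeff c)) = 0 := by
        obtain ⟨q, hq⟩ := h1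
        rw [← eval_bind_gradPoly, hq, map_mul, hP, zero_mul]
      have hQ : eval Q (conic c) = 0 := by
        have := eval_dualCoeff_grad (dualCoeff c) (grad f P)
        rw [hu, mul_zero, eval_dualCoeff_dualCoeff] at this
        exact (mul_eq_zero.1 this).resolve_left (mul_ne_zero (by norm_num) hc)
      obtain ⟨i, hi⟩ : ∃ i, Q i ≠ 0 := by
        by_contra hall
        push Not at hall
        exact hQ0 (by ext i; exact hall i)
      have hP' : P = (P i / Q i) • Q := by
        ext k
        rw [Pi.smul_apply, smul_eq_mul, div_mul_eq_mul_div, eq_div_iff hi, mul_comm]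
        linear_combination hb i k
      rw [hP', eval_smul_of_isHomogeneous (isHomogeneous_conic c), hQ, mul_zero, zero_mul]
  exact hf.associated_of_dvd (irreducible_conic hc) ((hf.prime.dvd_or_dvd hdvd).resolve_right hj)

/-- If the real Kippenhahn curve contains an ellipse and infinitely many points of a quartic, the
Kippenhahn polynomial is the product of the dual of the ellipse and an irreducible cubic, whose
dual contains infinitely many of these points. -/
lemma exists_cubic_factor {A : Matrix (Fin 5) (Fin 5) ℂ} {a b : ℂ} {r : ℝ} (hr : 0 < r)
    {g : MvPolynomial (Fin 3) ℂ} (hg : Irreducible g) (hg4 : g.IsHomogeneous 4) {S : Set ℂ}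
    (hS : S.Infinite) (hSg : ∀ ζ ∈ S, eval (homCoord ζ) g = 0)
    (hSA : S ⊆ realKippenhahnCurve A) (hEA : ellipse a b r ⊆ realKippenhahnCurve A) :
    ∃ h, Irreducible h ∧ h.IsHomogeneous 3 ∧
      kippenhahnPoly A = conic (ellipseCoeff a b r) * h ∧ h ∣ bind₁ (gradPoly h) g ∧
      ∀ G e, G.IsHomogeneous e → h ∣ bind₁ (gradPoly h) G → g ∣ G := by
  have hc := conicDisc_ellipseCoeff a b hr
  obtain ⟨f, d, hf, hfd, hfp, T, hTE, hT, hTf⟩ := exists_component (ellipse_infinite a b hr) hEA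
  have hfc := associated_conic hf hfd hc hT hTf fun ζ hζ =>
    ((mem_dualCurve_conic hc).1 ((homCoord_mem_dualCurve_ellipseCoeff hr).2 (hTE hζ))).2
  obtain ⟨h, hh⟩ := hfc.symm.dvd.trans hfp
  have hp0 := kippenhahnPoly_ne_zero A
  have hp5 := isHomogeneous_kippenhahnPoly A
  rw [hh] at hp0 hp5
  have hc0 := left_ne_zero_of_mul hp0
  have hh0 := right_ne_zero_of_mul hp0
  obtain ⟨m, n, hm, hn, hmn⟩ := isHomogeneous_mul_split hp5 hp0
  have hm2 : m = 2 := hm.inj_right (isHomogeneous_conic _) hc0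
  obtain rfl : n = 3 := by omega
  obtain ⟨f₁, d₁, hf₁, hfd₁, hfp₁, T₁, hTS, hT₁, hTf₁⟩ := exists_component hS hSA
  have hdeg := three_le_degree hf₁ hfd₁ hg4 (by norm_num)
    (dual_subset_of_infinite hf₁ hfd₁ hg hg4 hT₁ hTf₁ fun ζ hζ => hSg ζ (hTS hζ)).2
  rw [hh] at hfp₁
  have hfh : f₁ ∣ h := by
    refine (hf₁.prime.dvd_or_dvd hfp₁).resolve_left fun hd => ?_
    have := le_of_dvd_of_isHomogeneous hfd₁ (isHomogeneous_conic _) hc0 hd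
    omega
  have hass : Associated f₁ h := by
    have hle := le_of_dvd_of_isHomogeneous hfd₁ hn hh0 hfh
    obtain ⟨k, rfl⟩ := hfh
    obtain ⟨m', n', hm', hn', hmn'⟩ := isHomogeneous_mul_split hn hh0
    have : m' = d₁ := hm'.inj_right hfd₁ hf₁.ne_zero
    obtain rfl : n' = 0 := by omega
    obtain ⟨u, hu⟩ := isUnit_of_isHomogeneous_zero hn' (right_ne_zero_of_mul hh0)
    exact ⟨u, by rw [hu]⟩
  have hirr : Irreducible h := hass.irreducible hf₁
  obtain ⟨e1, e2⟩ := dual_subset_of_infinite hirr hn hg hg4 hT₁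
    (fun ζ hζ => dualCurve_eq_of_associated hass ▸ hTf₁ ζ hζ) fun ζ hζ => hSg ζ (hTS hζ)
  exact ⟨h, hirr, hn, hh, e1, e2⟩

/-! ### Double tangents and double points -/

lemma grad_smul_of_isHomogeneous {f : MvPolynomial (Fin 3) ℂ} {n : ℕ} (hf : f.IsHomogeneous n)
    (c : ℂ) (P : Fin 3 → ℂ) : grad f (c • P) = c ^ (n - 1) • grad f P := by
  ext i
  exact eval_smul_of_isHomogeneous hf.pderiv c P

lemma isHomogeneous_bind_gradPoly {g G : MvPolynomial (Fin 3) ℂ} {d e : ℕ}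
    (hg : g.IsHomogeneous d) (hG : G.IsHomogeneous e) :
    (bind₁ (gradPoly g) G).IsHomogeneous ((d - 1) * e) :=
  hG.aeval _ fun _ => hg.pderiv

lemma sum_mul_grad {f : MvPolynomial (Fin 3) ℂ} {n : ℕ} (hf : f.IsHomogeneous n)
    (P : Fin 3 → ℂ) :
    P 0 * grad f P 0 + P 1 * grad f P 1 + P 2 * grad f P 2 = n * eval P f := by
  have := congrArg (eval P) hf.sum_X_mul_pderiv
  simpa [Fin.sum_univ_three, grad] using this

/-- If the curve `h = 0` has the dual `g = 0`, a double tangent of the latter is a double point of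
the former: by biduality, the tangents of the first curve at this point would contain two
different points. -/
lemma grad_eq_zero_of_bitangent {g h : MvPolynomial (Fin 3) ℂ} {d n : ℕ} (hh : Irreducible h)
    (hn : h.IsHomogeneous n) (hn2 : 2 ≤ n) (hgd : g.IsHomogeneous d)
    (hhg : h ∣ bind₁ (gradPoly h) g)
    (hdual : ∀ G e, G.IsHomogeneous e → h ∣ bind₁ (gradPoly h) G → g ∣ G)
    {P₁ P₂ : Fin 3 → ℂ} (h₁ : eval P₁ g = 0) (h₂ : eval P₂ g = 0)
    (hne : P₁ ≠ P₂) (e₁ : P₁ 2 = 1) (e₂ : P₂ 2 = 1) {c : ℂ} (hc : c ≠ 0)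
    (hgrad : grad g P₂ = c • grad g P₁) : grad h (grad g P₁) = 0 := by
  -- Biduality on the curve `g`, derived from biduality on `h`.
  have hcross : ∀ (u : Fin 3 → ℂ), eval u g = 0 → ∀ i j,
      grad h (grad g u) i * u j = grad h (grad g u) j * u i := by
    intro u hu i j
    let G : MvPolynomial (Fin 3) ℂ := bind₁ (gradPoly g) (pderiv i h) * X j
      - bind₁ (gradPoly g) (pderiv j h) * X i
    have hG : G.IsHomogeneous ((d - 1) * (n - 1) + 1) :=
      ((isHomogeneous_bind_gradPoly hgd hn.pderiv).mul (isHomogeneous_X _ _)).sub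
        ((isHomogeneous_bind_gradPoly hgd hn.pderiv).mul (isHomogeneous_X _ _))
    have hev : ∀ v, eval v G = grad h (grad g v) i * v j - grad h (grad g v) j * v i := by
      intro v
      simp only [G, map_sub, map_mul, eval_bind_gradPoly, eval_X]
      rfl
    obtain ⟨q, hq⟩ := hdual G _ hG (dvd_of_forall_eval_eq_zero hh fun P hP => by
      rw [eval_bind_gradPoly, hev]
      have hb := biduality hh hn hn2 hgd hhg hP
      by_cases hP0 : P = 0
      · have h0 : grad h P = 0 := by
          have := grad_smul_of_isHomogeneous hn 0 P
          rw [zero_smul, zero_pow (by omega), zero_smul] at this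
          rw [hP0, this]
        rw [h0]
        simp
      · obtain ⟨k, hk⟩ : ∃ k, P k ≠ 0 := by
          by_contra hall
          push Not at hall
          exact hP0 (by ext i; exact hall i)
        have hQ : grad g (grad h P) = (grad g (grad h P) k / P k) • P := by
          ext m
          rw [Pi.smul_apply, smul_eq_mul, div_mul_eq_mul_div, eq_div_iff hk]
          exact hb m k
        rw [hQ, grad_smul_of_isHomogeneous hn]
        simp only [Pi.smul_apply, smul_eq_mul]
        ring)
    have := hev u
    rw [hq, map_mul, hu, zero_mul] at this
    linear_combination -this
  have c₁ := hcross P₁ h₁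
  have c₂ := hcross P₂ h₂
  rw [hgrad, grad_smul_of_isHomogeneous hn] at c₂
  set W := grad h (grad g P₁)
  have hc' := pow_ne_zero (n - 1) hc
  have hW : ∀ i, W i = W 2 * P₁ i ∧ W i = W 2 * P₂ i := by
    intro i
    have a1 := c₁ i 2
    have a2 := c₂ i 2
    simp only [Pi.smul_apply, smul_eq_mul] at a2
    rw [e₁, mul_one] at a1
    rw [e₂, mul_one, mul_assoc] at a2
    exact ⟨a1, mul_left_cancel₀ hc' a2⟩
  have hW2 : W 2 = 0 := by
    by_contra h2
    exact hne (by ext i; exact mul_left_cancel₀ h2 ((hW i).1.symm.trans (hW i).2))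
  ext i
  rw [(hW i).1, hW2, zero_mul]
  rfl

lemma exists_angle (w : ℂ) : ∃ θ ∈ Set.Ico (0 : ℝ) (2 * Real.pi),
    w.re = ‖w‖ * Real.cos θ ∧ w.im = ‖w‖ * Real.sin θ := by
  have hc := Complex.norm_mul_cos_arg w
  have hs := Complex.norm_mul_sin_arg w
  by_cases h : 0 ≤ w.arg
  · exact ⟨w.arg, ⟨h, by linarith [Complex.arg_le_pi w, Real.pi_pos]⟩, hc.symm, hs.symm⟩
  · push Not at h
    refine ⟨w.arg + 2 * Real.pi, ⟨by linarith [Complex.neg_pi_lt_arg w, Real.pi_pos], by linarith⟩,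
      ?_, ?_⟩
    · rw [Real.cos_add_two_pi, hc]
    · rw [Real.sin_add_two_pi, hs]

/-- Normalized coordinates of the line through two different points of the real plane. -/
lemma exists_line_through {ζ₁ ζ₂ : ℂ} (hne : ζ₁ ≠ ζ₂) :
    ∃ θ ∈ Set.Ico (0 : ℝ) (2 * Real.pi), ∃ μ : ℝ,
    ∀ L : Fin 3 → ℂ, L ≠ 0 → ζ₁.re * L 0 + ζ₁.im * L 1 + L 2 = 0 →
      ζ₂.re * L 0 + ζ₂.im * L 1 + L 2 = 0 →
      ∃ k : ℂ, k ≠ 0 ∧ L = k • ![(Real.cos θ : ℂ), (Real.sin θ : ℂ), (μ : ℂ)] := by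
  let w : ℂ := ⟨ζ₁.im - ζ₂.im, ζ₂.re - ζ₁.re⟩
  have hw : w ≠ 0 := by
    intro h
    have hr : ζ₁.im - ζ₂.im = 0 := congrArg Complex.re h
    have hi : ζ₂.re - ζ₁.re = 0 := congrArg Complex.im h
    exact hne (Complex.ext (by linarith) (by linarith))
  obtain ⟨θ, hθ, hc, hs⟩ := exists_angle w
  have hD := norm_ne_zero_iff.2 hw
  have hD' : (‖w‖ : ℂ) ≠ 0 := by exact_mod_cast hD
  have hc' : (ζ₁.im - ζ₂.im : ℂ) = ‖w‖ * Real.cos θ := by exact_mod_cast hc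
  have hs' : (ζ₂.re - ζ₁.re : ℂ) = ‖w‖ * Real.sin θ := by exact_mod_cast hs
  have hcs : (Real.cos θ : ℂ) ^ 2 + (Real.sin θ : ℂ) ^ 2 = 1 := by
    exact_mod_cast Real.cos_sq_add_sin_sq θ
  refine ⟨θ, hθ, -(ζ₁.re * Real.cos θ + ζ₁.im * Real.sin θ), fun L hL e₁ e₂ => ?_⟩
  have hperp : L 0 * Real.sin θ = L 1 * Real.cos θ := by
    refine mul_left_cancel₀ hD' ?_
    linear_combination e₂ - e₁ - L 0 * hs' + L 1 * hc'
  set k := L 0 * Real.cos θ + L 1 * Real.sin θ with hk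
  have h0 : L 0 = k * Real.cos θ := by
    rw [hk]
    linear_combination (-L 0) * hcs + Real.sin θ * hperp
  have h1 : L 1 = k * Real.sin θ := by
    rw [hk]
    linear_combination (-L 1) * hcs - Real.cos θ * hperp
  have h2 : L 2 = k * -(ζ₁.re * Real.cos θ + ζ₁.im * Real.sin θ) := by
    linear_combination e₁ - ζ₁.re * h0 - ζ₁.im * h1
  have hLk : L = k • ![(Real.cos θ : ℂ), (Real.sin θ : ℂ),
      ((-(ζ₁.re * Real.cos θ + ζ₁.im * Real.sin θ) : ℝ) : ℂ)] := by
    ext i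
    fin_cases i
    · simpa using h0
    · simpa using h1
    · simpa using h2
  refine ⟨k, ?_, hLk⟩
  rintro h0
  exact hL (by rw [hLk, h0, zero_smul])

/-! ### Cubic factors are focal cubics -/

lemma coeff_eq_zero_of_mul_eq_zero {p q A B D E : ℂ}
    (h : ∀ z : ℂ, (z + p) * (z + q) * (A * z ^ 3 + B * z ^ 2 + D * z + E) = 0) :
    A = 0 ∧ B = 0 ∧ D = 0 ∧ E = 0 := by
  let K : Polynomial ℂ := Polynomial.C A * Polynomial.X ^ 3 + Polynomial.C B * Polynomial.X ^ 2
    + Polynomial.C D * Polynomial.X + Polynomial.C E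
  have hprod : (Polynomial.X + Polynomial.C p) * (Polynomial.X + Polynomial.C q) * K = 0 := by
    refine Polynomial.funext fun z => ?_
    simpa [K] using h z
  have hK : K = 0 := (mul_eq_zero.1 hprod).resolve_left
    (mul_ne_zero (Polynomial.X_add_C_ne_zero p) (Polynomial.X_add_C_ne_zero q))
  have h3 : K.coeff 3 = A := by
    simp only [K, Polynomial.coeff_add, Polynomial.coeff_C_mul, Polynomial.coeff_X_pow,
      Polynomial.coeff_X, Polynomial.coeff_C]
    norm_num
  have h2 : K.coeff 2 = B := by
    simp only [K, Polynomial.coeff_add, Polynomial.coeff_C_mul, Polynomial.coeff_X_pow,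
      Polynomial.coeff_X, Polynomial.coeff_C]
    norm_num
  have h1 : K.coeff 1 = D := by
    simp only [K, Polynomial.coeff_add, Polynomial.coeff_C_mul, Polynomial.coeff_X_pow,
      Polynomial.coeff_X, Polynomial.coeff_C]
    norm_num
  have h0 : K.coeff 0 = E := by
    simp [K]
  rw [hK, Polynomial.coeff_zero] at h3 h2 h1 h0
  exact ⟨h3.symm, h2.symm, h1.symm, h0.symm⟩

/-- The complementary factor of the dual of an ellipse in a Kippenhahn polynomial is a focal cubic,
since the zeros of this polynomial on `x² + y² = 0` are the isotropic lines through the eigenvalues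
of `A`. -/
lemma exists_eq_focalCubic {A : Matrix (Fin 5) (Fin 5) ℂ} (hA : A.BlockTriangular id)
    {p q w t v : Fin 5} (hpq : [p, q, w, t, v].Nodup) {r : ℝ} {h : MvPolynomial (Fin 3) ℂ}
    (hh : h.IsHomogeneous 3)
    (hp : kippenhahnPoly A = conic (ellipseCoeff (A p p) (A q q) r) * h) :
    ∃ a b c : ℂ, h = focalCubic (A w w) (A t t) (A v v) a b c := by
  set f₀ := focalCubic (A w w) (A t t) (A v v) 0 0 0
  obtain ⟨c, hc⟩ :=
    exists_cubic_eq (hh.sub (isHomogeneous_focalCubic (A w w) (A t t) (A v v) 0 0 0))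
  have hJ : ∀ J : ℂ, J ^ 2 = -1 → c 9 = 0 ∧ c 5 + c 8 * J = 0 ∧ c 2 - c 7 + c 4 * J = 0 ∧
      c 0 - c 3 + (c 1 - c 6) * J = 0 := by
    intro J hJ2
    refine coeff_eq_zero_of_mul_eq_zero (p := (A p p).re + (A p p).im * J)
      (q := (A q q).re + (A q q).im * J) fun z => ?_
    have h1 := congrArg (eval ![1, J, z]) hp
    have h2 := hc ![1, J, z]
    rw [map_mul, eval_kippenhahnPoly hA, eval_ellipseCoeff, prod_eq_of_nodup _ hpq] at h1
    rw [map_sub, eval_focalCubic] at h2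
    simp only [Matrix.cons_val, one_pow, hJ2, mul_one, add_neg_cancel, zero_div, zero_mul,
      sub_zero, mul_zero] at h1 h2
    have e : c 9 * z ^ 3 + (c 5 + c 8 * J) * z ^ 2 + (c 2 - c 7 + c 4 * J) * z
        + (c 0 - c 3 + (c 1 - c 6) * J) = eval ![1, J, z] h
          - (z + ((A w w).re + (A w w).im * J)) * (z + ((A t t).re + (A t t).im * J))
            * (z + ((A v v).re + (A v v).im * J)) := by
      rw [h2]
      linear_combination (-c 6 * J) * hJ2
    rw [e]
    linear_combination -h1
  obtain ⟨h9, a1, a2, a3⟩ := hJ Complex.I Complex.I_sq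
  obtain ⟨-, b1, b2, b3⟩ := hJ (-Complex.I) (by rw [neg_sq, Complex.I_sq])
  have hI := Complex.I_ne_zero
  have h5 : c 5 = 0 := by linear_combination (a1 + b1) / 2
  have h8 : c 8 = 0 := mul_right_cancel₀ hI (by linear_combination (a1 - b1) / 2)
  have h7 : c 7 = c 2 := by linear_combination -(a2 + b2) / 2
  have h4 : c 4 = 0 := mul_right_cancel₀ hI (by linear_combination (a2 - b2) / 2)
  have h3 : c 3 = c 0 := by linear_combination -(a3 + b3) / 2
  have h6 : c 6 = c 1 := mul_right_cancel₀ hI (by linear_combination -(a3 - b3) / 2)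
  refine ⟨-c 2, -c 0, -c 1, MvPolynomial.funext fun P => ?_⟩
  have := hc P
  rw [map_sub, eval_focalCubic, h9, h5, h8, h7, h4, h3, h6] at this
  rw [eval_focalCubic]
  linear_combination this

lemma grad_focalCubic (l₁ l₂ l₃ a b c : ℂ) (P : Fin 3 → ℂ) :
    grad (focalCubic l₁ l₂ l₃ a b c) P =
      let y₁ := P 2 + (l₁.re * P 0 + l₁.im * P 1)
      let y₂ := P 2 + (l₂.re * P 0 + l₂.im * P 1)
      let y₃ := P 2 + (l₃.re * P 0 + l₃.im * P 1)
      ![l₁.re * y₂ * y₃ + l₂.re * y₁ * y₃ + l₃.re * y₁ * y₂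
          - 2 * P 0 * (a * P 2 + b * P 0 + c * P 1) - (P 0 ^ 2 + P 1 ^ 2) * b,
        l₁.im * y₂ * y₃ + l₂.im * y₁ * y₃ + l₃.im * y₁ * y₂
          - 2 * P 1 * (a * P 2 + b * P 0 + c * P 1) - (P 0 ^ 2 + P 1 ^ 2) * c,
        y₂ * y₃ + y₁ * y₃ + y₁ * y₂ - (P 0 ^ 2 + P 1 ^ 2) * a] := by
  ext i
  fin_cases i <;>
    simp [grad, focalCubic, pointForm, pderiv_X, Derivation.leibniz, Derivation.leibniz_pow] <;>
    ring

/-- The coefficients of a focal cubic with a double point at `(cos θ, sin θ, μ)`. -/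
lemma focalCubic_coeff_of_grad_eq_zero {l₁ l₂ l₃ a b c : ℂ} {θ μ μ₁ μ₂ μ₃ : ℝ}
    (hμ₁ : μ₁ = (Complex.exp (-(Complex.I * θ)) * l₁).re + μ)
    (hμ₂ : μ₂ = (Complex.exp (-(Complex.I * θ)) * l₂).re + μ)
    (hμ₃ : μ₃ = (Complex.exp (-(Complex.I * θ)) * l₃).re + μ)
    (h : grad (focalCubic l₁ l₂ l₃ a b c) ![(Real.cos θ : ℂ), (Real.sin θ : ℂ), (μ : ℂ)] = 0) :
    a = (μ₂ * μ₃ + μ₁ * μ₃ + μ₁ * μ₂ : ℝ) ∧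
    b = (l₁.re * μ₂ * μ₃ + l₂.re * μ₁ * μ₃ + l₃.re * μ₂ * μ₁
      - 2 * μ₁ * μ₂ * μ₃ * Real.cos θ : ℝ) ∧
    c = (l₁.im * μ₂ * μ₃ + l₂.im * μ₁ * μ₃ + l₃.im * μ₂ * μ₁
      - 2 * μ₁ * μ₂ * μ₃ * Real.sin θ : ℝ) := by
  have hcs : (Real.cos θ : ℂ) ^ 2 + (Real.sin θ : ℂ) ^ 2 = 1 := by
    exact_mod_cast Real.cos_sq_add_sin_sq θ
  have hexp : ∀ l : ℂ, (Complex.exp (-(Complex.I * θ)) * l).re + μ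
      = μ + (l.re * Real.cos θ + l.im * Real.sin θ) := by
    intro l
    have : -(Complex.I * θ) = ((-θ : ℝ) : ℂ) * Complex.I := by push_cast; ring
    rw [this, Complex.mul_re, Complex.exp_ofReal_mul_I_re, Complex.exp_ofReal_mul_I_im,
      Real.cos_neg, Real.sin_neg]
    ring
  rw [hexp] at hμ₁ hμ₂ hμ₃
  have y₁ : (μ + (l₁.re * Real.cos θ + l₁.im * Real.sin θ) : ℂ) = μ₁ := by rw [hμ₁]; push_cast; rfl
  have y₂ : (μ + (l₂.re * Real.cos θ + l₂.im * Real.sin θ) : ℂ) = μ₂ := by rw [hμ₂]; push_cast; rfl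
  have y₃ : (μ + (l₃.re * Real.cos θ + l₃.im * Real.sin θ) : ℂ) = μ₃ := by rw [hμ₃]; push_cast; rfl
  have hval : (μ₁ * μ₂ * μ₃ : ℂ) = a * μ + b * Real.cos θ + c * Real.sin θ := by
    have h1 := sum_mul_grad (isHomogeneous_focalCubic l₁ l₂ l₃ a b c)
      ![(Real.cos θ : ℂ), (Real.sin θ : ℂ), (μ : ℂ)]
    rw [h, eval_focalCubic] at h1
    simp only [Matrix.cons_val, Pi.zero_apply, mul_zero, add_zero] at h1
    rw [y₁, y₂, y₃, hcs] at h1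
    push_cast at h1 ⊢
    linear_combination -h1 / 3
  rw [grad_focalCubic] at h
  have hx := congrFun h 0
  have hy := congrFun h 1
  have hz := congrFun h 2
  simp only [Matrix.cons_val, Pi.zero_apply] at hx hy hz
  rw [y₁, y₂, y₃, hcs] at hx hy hz
  refine ⟨?_, ?_, ?_⟩
  · push_cast
    linear_combination -hz
  · rw [Complex.ofReal_sub]
    push_cast at hx hval ⊢
    linear_combination -hx + 2 * Complex.cos θ * hval
  · push_cast at hy hval ⊢
    linear_combination -hy + 2 * Complex.sin θ * hval

/-- If `b + i c = a l₁`, the focal cubic contains the dual line of `l₁`. -/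
lemma not_irreducible_focalCubic {l₁ l₂ l₃ a b c : ℂ} (hb : b = a * l₁.re) (hc : c = a * l₁.im) :
    ¬ Irreducible (focalCubic l₁ l₂ l₃ a b c) := by
  intro hirr
  have hX : ∀ i : Fin 3, (X i : MvPolynomial (Fin 3) ℂ).IsHomogeneous 1 := isHomogeneous_X ℂ
  have hpt : ∀ l, (pointForm l).IsHomogeneous 1 := fun l =>
    (hX 2).add (((hX 0).C_mul _).add ((hX 1).C_mul _))
  have hq : (pointForm l₂ * pointForm l₃ - C a * (X 0 ^ 2 + X 1 ^ 2)).IsHomogeneous 2 :=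
    ((hpt l₂).mul (hpt l₃)).sub ((((hX 0).pow 2).add ((hX 1).pow 2)).C_mul _)
  have hfac : focalCubic l₁ l₂ l₃ a b c =
      pointForm l₁ * (pointForm l₂ * pointForm l₃ - C a * (X 0 ^ 2 + X 1 ^ 2)) := by
    refine MvPolynomial.funext fun P => ?_
    rw [eval_focalCubic, hb, hc]
    simp [pointForm]
    ring
  rcases hirr.isUnit_or_isUnit hfac with hu | hu
  · exact not_isUnit_of_isHomogeneous (hpt l₁) one_ne_zero hu
  · exact not_isUnit_of_isHomogeneous hq two_ne_zero hu

lemma focalCubic_swap (l₁ l₂ l₃ a b c : ℂ) :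
    focalCubic l₁ l₂ l₃ a b c = focalCubic l₂ l₁ l₃ a b c := by
  rw [focalCubic, focalCubic, mul_comm (pointForm l₁)]

lemma focalCubic_rotate (l₁ l₂ l₃ a b c : ℂ) :
    focalCubic l₁ l₂ l₃ a b c = focalCubic l₃ l₁ l₂ a b c := by
  rw [focalCubic, focalCubic, mul_comm _ (pointForm l₃), mul_assoc]

/-! ### The equivalence -/

section

variable {l₁ l₂ l₃ : ℂ} {a b c θ μ₁ μ₂ μ₃ : ℝ}

/-- The number `b + i c` for the coefficients `b`, `c` of a focal cubic with a double point. -/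
lemma focal_coeff_eq
    (hb : b = l₁.re * μ₂ * μ₃ + l₂.re * μ₁ * μ₃ + l₃.re * μ₂ * μ₁ - 2 * μ₁ * μ₂ * μ₃ * Real.cos θ)
    (hc : c = l₁.im * μ₂ * μ₃ + l₂.im * μ₁ * μ₃ + l₃.im * μ₂ * μ₁
      - 2 * μ₁ * μ₂ * μ₃ * Real.sin θ) :
    (l₁ * μ₂ * μ₃ + l₂ * μ₁ * μ₃ + l₃ * μ₂ * μ₁) - 2 * μ₁ * μ₂ * μ₃ * Complex.exp (Complex.I * θ)
      = b + c * Complex.I := by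
  rw [hb, hc, mul_comm Complex.I, Complex.exp_mul_I]
  nth_rewrite 1 [← Complex.re_add_im l₁, ← Complex.re_add_im l₂, ← Complex.re_add_im l₃]
  push_cast
  ring

/-- The inequalities in terms of the `μ_j` exclude the dual lines of the foci from the focal cubic,
which contains that of `l_i` if `b + i c = a l_i`. Up to the factor `μ_i`, the difference of the two
sides is the same. -/
lemma focal_nondegenerate_iff (ha : a = μ₂ * μ₃ + μ₁ * μ₃ + μ₁ * μ₂)
    (hκ : (l₁ * μ₂ * μ₃ + l₂ * μ₁ * μ₃ + l₃ * μ₂ * μ₁)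
      - 2 * μ₁ * μ₂ * μ₃ * Complex.exp (Complex.I * θ) = b + c * Complex.I) :
    (μ₁ * μ₂ * μ₃ ≠ 0 ∧
      l₂ * μ₃ + l₃ * μ₂ - 2 * μ₂ * μ₃ * Complex.exp (Complex.I * θ) ≠ l₁ * (μ₃ + μ₂) ∧
      l₁ * μ₃ + l₃ * μ₁ - 2 * μ₁ * μ₃ * Complex.exp (Complex.I * θ) ≠ l₂ * (μ₃ + μ₁) ∧
      l₁ * μ₂ + l₂ * μ₁ - 2 * μ₁ * μ₂ * Complex.exp (Complex.I * θ) ≠ l₃ * (μ₂ + μ₁)) ↔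
    ((b + c * Complex.I : ℂ) ≠ a * l₁ ∧ (b + c * Complex.I : ℂ) ≠ a * l₂ ∧
      (b + c * Complex.I : ℂ) ≠ a * l₃) := by
  have e₁ : μ₁ * (l₂ * μ₃ + l₃ * μ₂ - 2 * μ₂ * μ₃ * Complex.exp (Complex.I * θ) - l₁ * (μ₃ + μ₂))
      = (b + c * Complex.I : ℂ) - a * l₁ := by
    rw [← hκ, ha]; push_cast; ring
  have e₂ : μ₂ * (l₁ * μ₃ + l₃ * μ₁ - 2 * μ₁ * μ₃ * Complex.exp (Complex.I * θ) - l₂ * (μ₃ + μ₁))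
      = (b + c * Complex.I : ℂ) - a * l₂ := by
    rw [← hκ, ha]; push_cast; ring
  have e₃ : μ₃ * (l₁ * μ₂ + l₂ * μ₁ - 2 * μ₁ * μ₂ * Complex.exp (Complex.I * θ) - l₃ * (μ₂ + μ₁))
      = (b + c * Complex.I : ℂ) - a * l₃ := by
    rw [← hκ, ha]; push_cast; ring
  rw [← sub_ne_zero (b := (a : ℂ) * l₁), ← sub_ne_zero (b := (a : ℂ) * l₂),
    ← sub_ne_zero (b := (a : ℂ) * l₃), ← e₁, ← e₂, ← e₃]
  simp only [ne_eq, mul_eq_zero, not_or, Complex.ofReal_eq_zero, sub_eq_zero]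
  tauto

end

section

variable {A : Matrix (Fin 5) (Fin 5) ℂ} {p q w t v : Fin 5} {r : ℝ}

/-- A decomposition of the Kippenhahn curve gives a decomposition of the Kippenhahn polynomial. -/
lemma exists_focalCubic_of_union (hA : A.BlockTriangular id) (hpq : [p, q, w, t, v].Nodup)
    (hr : 0 < r) {S F : Set ℂ} (hS : IsQuarticWithDoubleTangent S F)
    (hAS : realKippenhahnCurve A = ellipse (A p p) (A q q) r ∪ S) :
    ∃ θ ∈ Set.Ico (0 : ℝ) (2 * Real.pi), ∃ μ a b c : ℝ,
      grad (focalCubic (A w w) (A t t) (A v v) a b c)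
        ![(Real.cos θ : ℂ), (Real.sin θ : ℂ), (μ : ℂ)] = 0 ∧
      Irreducible (focalCubic (A w w) (A t t) (A v v) a b c) ∧
      kippenhahnPoly A = conic (ellipseCoeff (A p p) (A q q) r)
        * focalCubic (A w w) (A t t) (A v v) a b c := by
  obtain ⟨g, hg, hg4, hSg, hSinf, ⟨ζ₁, ζ₂, hne, h₁, h₂, hg0, k, hk, hgrad⟩, -⟩ := hS
  obtain ⟨h, hh, hh3, hp, hhg, hdual⟩ := exists_cubic_factor hr hg hg4 hSinf
    (fun ζ hζ => by rw [hSg] at hζ; exact hζ) (by rw [hAS]; exact Set.subset_union_right)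
    (by rw [hAS]; exact Set.subset_union_left)
  have hL := grad_eq_zero_of_bitangent hh hh3 (by norm_num) hg4 hhg hdual h₁ h₂
    (fun h => hne (Complex.ext (by simpa [homCoord] using congrFun h 0)
      (by simpa [homCoord] using congrFun h 1))) rfl rfl hk hgrad
  obtain ⟨θ, hθ, μ, hline⟩ := exists_line_through hne
  have hE₁ := sum_mul_grad hg4 (homCoord ζ₁)
  have hE₂ := sum_mul_grad hg4 (homCoord ζ₂)
  rw [h₁, mul_zero] at hE₁
  rw [h₂, mul_zero, hgrad] at hE₂
  simp only [homCoord, Matrix.cons_val, one_mul, Pi.smul_apply, smul_eq_mul] at hE₁ hE₂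
  obtain ⟨m, hm, hLm⟩ := hline (grad g (homCoord ζ₁)) hg0 hE₁
    (mul_left_cancel₀ hk (by simp only [homCoord]; linear_combination hE₂))
  rw [hLm, grad_smul_of_isHomogeneous hh3] at hL
  have hsing := (smul_eq_zero.1 hL).resolve_left (pow_ne_zero _ hm)
  obtain ⟨a, b, c, rfl⟩ := exists_eq_focalCubic hA hpq hh3 hp
  obtain ⟨ha, hb, hc⟩ := focalCubic_coeff_of_grad_eq_zero rfl rfl rfl hsing
  rw [ha, hb, hc] at hsing hh hp
  exact ⟨θ, hθ, μ, _, _, _, hsing, hh, hp⟩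

/-- A decomposition of the Kippenhahn polynomial gives a decomposition of the Kippenhahn curve. -/
lemma exists_union_of_focalCubic (hr : 0 < r) {θ μ a b c : ℝ}
    (ha : a = shiftedRe A θ μ t * shiftedRe A θ μ v + shiftedRe A θ μ w * shiftedRe A θ μ v
      + shiftedRe A θ μ w * shiftedRe A θ μ t)
    (hb : b = (A w w).re * shiftedRe A θ μ t * shiftedRe A θ μ v
      + (A t t).re * shiftedRe A θ μ w * shiftedRe A θ μ v
      + (A v v).re * shiftedRe A θ μ t * shiftedRe A θ μ w
      - 2 * shiftedRe A θ μ w * shiftedRe A θ μ t * shiftedRe A θ μ v * Real.cos θ)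
    (hc : c = (A w w).im * shiftedRe A θ μ t * shiftedRe A θ μ v
      + (A t t).im * shiftedRe A θ μ w * shiftedRe A θ μ v
      + (A v v).im * shiftedRe A θ μ t * shiftedRe A θ μ w
      - 2 * shiftedRe A θ μ w * shiftedRe A θ μ t * shiftedRe A θ μ v * Real.sin θ)
    (h₁ : (b + c * Complex.I : ℂ) ≠ a * A w w) (h₂ : (b + c * Complex.I : ℂ) ≠ a * A t t)
    (h₃ : (b + c * Complex.I : ℂ) ≠ a * A v v)
    (hp : kippenhahnPoly A = conic (ellipseCoeff (A p p) (A q q) r)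
      * focalCubic (A w w) (A t t) (A v v) a b c) :
    ∃ S : Set ℂ, IsQuarticWithDoubleTangent S {A w w, A t t, A v v} ∧
      realKippenhahnCurve A = ellipse (A p p) (A q q) r ∪ S := by
  have hyp : ∀ (x y : ℝ) (z : ℂ), eval ![(x : ℂ), y, z]
      (focalCubic (A w w) (A t t) (A v v) a b c) = 0 → z.im = 0 := fun x y z hz =>
    im_eq_zero_of_eval_kippenhahnPoly A (by rw [hp, map_mul, hz, mul_zero])
  have hline := focalCubic_no_line hyp h₁ h₂ h₃
  have hirr := irreducible_of_no_line (isHomogeneous_focalCubic _ _ _ _ _ _)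
    (by rw [eval_focalCubic]; simp) hline
  obtain ⟨T, κ, κ', hT, hT0, hT1, hκ, hκ', hf⟩ :=
    exists_linSubst_nodalCubic rfl rfl rfl ha hb hc hyp hline
  exact ⟨_, isQuarticWithDoubleTangent_of_linSubst hT hT0 hT1 hκ hκ' hf,
    realKippenhahnCurve_eq_union hr hirr hp⟩

/-- An irreducible focal cubic contains no dual line of a focus. -/
lemma focal_coeff_ne {l₁ l₂ l₃ : ℂ} {a b c : ℝ} (h : Irreducible (focalCubic l₁ l₂ l₃ a b c)) :
    (b + c * Complex.I : ℂ) ≠ a * l₁ := by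
  intro he
  have hr : b = a * l₁.re := by simpa using congrArg Complex.re he
  have hi : c = a * l₁.im := by simpa using congrArg Complex.im he
  exact not_irreducible_focalCubic (by rw [hr]; push_cast; rfl) (by rw [hi]; push_cast; rfl) h

end

end Kippenhahn

end

theorem theorem2p5 (A : Matrix (Fin 5) (Fin 5) ℂ) (hA : A.BlockTriangular id)
    (p q w t v : Fin 5) (hpq : [p, q, w, t, v].Nodup) (r : ℝ) (hr : 0 < r) :
    (∃ S : Set ℂ,
      Kippenhahn.IsQuarticWithDoubleTangent S {A w w, A t t, A v v} ∧
      Kippenhahn.realKippenhahnCurve A = Kippenhahn.ellipse (A p p) (A q q) r ∪ S) ↔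
    ∃ θ ∈ Set.Ico (0 : ℝ) (2 * Real.pi), ∃ μ : ℝ,
      let L : Fin 5 → ℂ := fun j => A j j
      let α : Fin 5 → ℝ := fun j => (A j j).re
      let β : Fin 5 → ℝ := fun j => (A j j).im
      let m : Fin 5 → ℝ := Kippenhahn.shiftedRe A θ μ
      let e : ℂ := Complex.exp (Complex.I * θ)
      (r ^ 2 + 4 * (m t * m v + m w * m v + m w * m t)
        = Kippenhahn.sum2 (fun l n => ‖A l n‖ ^ 2)) ∧
      ((r : ℂ) ^ 2 * (L w + L t + L v)
          + 4 * ((L w * m t * m v + L t * m w * m v + L v * m t * m w)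
            - 2 * m w * m t * m v * e
            + (L p + L q) * (m t * m v + m w * m v + m w * m t))
        = Kippenhahn.sum32 (fun i j k l n => (‖A l n‖ : ℂ) ^ 2 * (L i + L j + L k))
          - Kippenhahn.sum3 (fun k l n => Kippenhahn.cyc3 A k l n)) ∧
      ((r : ℂ) ^ 2 * (L w * L t + L t * L v + L w * L v)
          + 4 * (L p * L q * (m t * m v + m w * m v + m t * m w)
            + (L p + L q) * (L w * m t * m v + L t * m w * m v + L v * m t * m w)
            - (L p + L q) * (2 * m w * m t * m v * e))
        = Kippenhahn.sum32 (fun i j k l n =>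
            (‖A l n‖ : ℂ) ^ 2 * (L i * L j + L i * L k + L j * L k))
          - Kippenhahn.sum23 (fun i j k l n => (L i + L j) * Kippenhahn.cyc3 A k l n)
          + Kippenhahn.sum4 (fun j k l n => Kippenhahn.cyc4 A j k l n)) ∧
      ((r : ℂ) ^ 2 * (L w * L t * L v)
          + 4 * (L p * L q * ((L w * m t * m v + L t * m w * m v + L v * m t * m w)
            - 2 * m w * m t * m v * e))
        = Kippenhahn.sum32 (fun i j k l n => (‖A l n‖ : ℂ) ^ 2 * (L i * L j * L k))
          - Kippenhahn.sum23 (fun i j k l n => L i * L j * Kippenhahn.cyc3 A k l n)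
          + Kippenhahn.sum14 (fun i j k l n => Kippenhahn.cyc4 A j k l n * L i)
          - Kippenhahn.cyc5 A) ∧
      (r ^ 2 * (α w * α t * α v - (α w * m t * m v + α t * m w * m v + α v * m w * m t)
            + 2 * m w * m t * m v * Real.cos θ)
          + 4 * α p * α q * ((α w * m t * m v + α t * m w * m v + α v * m w * m t)
            - 2 * m w * m t * m v * Real.cos θ)
        = Kippenhahn.sum32 (fun i j k l n => ‖A l n‖ ^ 2 * (α i * α j * α k))
          - Kippenhahn.sum23 (fun i j k l n => (Kippenhahn.cyc3 A k l n).re * (α i * α j))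
          - 1 / 4 * ∑ i, Kippenhahn.Pcoef A i * α i
          + 1 / 2 * Kippenhahn.sum14 (fun i j k l n => (Kippenhahn.cyc4 A j k l n).re * α i)
          + 1 / 4 * Kippenhahn.sum23 (fun i j k l n =>
              (Kippenhahn.cyc3 A k l n).re * ‖A i j‖ ^ 2)
          - 1 / 4 * (Kippenhahn.cycU A).re
          - 1 / 4 * (Kippenhahn.cycV A).re
          - 1 / 4 * (Kippenhahn.cyc5 A).re) ∧
      (r ^ 2 * (β w * β t * β v - (β w * m t * m v + β t * m w * m v + β v * m w * m t)
            + 2 * m w * m t * m v * Real.sin θ)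
          + 4 * β p * β q * ((β w * m t * m v + β t * m w * m v + β v * m w * m t)
            - 2 * m w * m t * m v * Real.sin θ)
        = Kippenhahn.sum32 (fun i j k l n => ‖A l n‖ ^ 2 * (β i * β j * β k))
          - Kippenhahn.sum23 (fun i j k l n => (Kippenhahn.cyc3 A k l n).im * (β i * β j))
          - 1 / 4 * ∑ i, Kippenhahn.Pcoef A i * β i
          - 1 / 2 * Kippenhahn.sum14 (fun i j k l n => (Kippenhahn.cyc4 A j k l n).re * β i)
          + 1 / 4 * Kippenhahn.sum23 (fun i j k l n =>
              (Kippenhahn.cyc3 A k l n).im * ‖A i j‖ ^ 2)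
          - 1 / 4 * (Kippenhahn.cycU A).im
          - 1 / 4 * (Kippenhahn.cycV A).im
          + 1 / 4 * (Kippenhahn.cyc5 A).im) ∧
      (r ^ 2 * ((α t * α v + α w * α v + α w * α t) - (m t * m v + m w * m v + m w * m t))
          + 4 * α p * α q * (m t * m v + m w * m v + m w * m t)
          + 4 * (α p + α q) * ((α w * m t * m v + α t * m w * m v + α v * m w * m t)
            - 2 * m w * m t * m v * Real.cos θ)
        = Kippenhahn.sum32 (fun i j k l n =>
            ‖A l n‖ ^ 2 * (α i * α j + α i * α k + α j * α k))
          - Kippenhahn.sum23 (fun i j k l n => (Kippenhahn.cyc3 A k l n).re * (α i + α j))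
          - 1 / 4 * ∑ i, Kippenhahn.Pcoef A i
          + 1 / 2 * Kippenhahn.sum4 (fun j k l n => (Kippenhahn.cyc4 A j k l n).re)) ∧
      m w * m t * m v ≠ 0 ∧
      ∀ i j k : Fin 5, i ∈ ({w, t, v} : Set (Fin 5)) → j ∈ ({w, t, v} : Set (Fin 5)) →
        k ∈ ({w, t, v} : Set (Fin 5)) → i ≠ j → j ≠ k → i ≠ k →
        L j * m k + L k * m j - 2 * m j * m k * e ≠ L i * (m k + m j) := by
  constructor
  · rintro ⟨S, hS, hAS⟩
    obtain ⟨θ, hθ, μ, a, b, c, hsing, hirr, hp⟩ :=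
      Kippenhahn.exists_focalCubic_of_union hA hpq hr hS hAS
    obtain ⟨ha, hb, hc⟩ := Kippenhahn.focalCubic_coeff_of_grad_eq_zero
      (μ₁ := Kippenhahn.shiftedRe A θ μ w) (μ₂ := Kippenhahn.shiftedRe A θ μ t)
      (μ₃ := Kippenhahn.shiftedRe A θ μ v) rfl rfl rfl hsing
    rw [Complex.ofReal_inj] at ha hb hc
    have hκ := Kippenhahn.focal_coeff_eq hb hc
    obtain ⟨h0, hw, ht, hv⟩ := (Kippenhahn.focal_nondegenerate_iff ha hκ).2
      ⟨Kippenhahn.focal_coeff_ne hirr,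
        Kippenhahn.focal_coeff_ne (Kippenhahn.focalCubic_swap _ _ _ _ _ _ ▸ hirr),
        Kippenhahn.focal_coeff_ne (Kippenhahn.focalCubic_rotate _ _ _ _ _ _ ▸ hirr)⟩
    obtain ⟨hA', hB', hC', hD', hE', hF', hG'⟩ :=
      (Kippenhahn.kippenhahnPoly_eq_mul_iff hA hpq r a b c hκ).1 hp
    refine ⟨θ, hθ, μ, ?_, ?_, ?_, ?_, ?_, ?_, ?_, h0, ?_⟩
    · rw [← ha]
      exact hA'
    · refine Eq.trans ?_ hB'
      rw [ha]
      push_cast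
      ring
    · refine Eq.trans ?_ hC'
      rw [ha]
      push_cast
      ring
    · refine Eq.trans ?_ hD'
      ring
    · refine Eq.trans ?_ hE'
      rw [hb]
      ring
    · refine Eq.trans ?_ hF'
      rw [hc]
      ring
    · refine Eq.trans ?_ hG'
      rw [hb, ha]
      ring
    · rintro i j k (rfl | rfl | rfl) (rfl | rfl | rfl) (rfl | rfl | rfl) hij hjk hik <;>
        first
          | exact absurd rfl hij
          | exact absurd rfl hjk
          | exact absurd rfl hik
          | exact hw
          | exact ht
          | exact hv
          | exact fun h => hw (by linear_combination h)
          | exact fun h => ht (by linear_combination h)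
          | exact fun h => hv (by linear_combination h)
  · rintro ⟨θ, -, μ, hA', hB', hC', hD', hE', hF', hG', h0, hi⟩
    obtain ⟨a, ha⟩ : ∃ a, a = Kippenhahn.shiftedRe A θ μ t * Kippenhahn.shiftedRe A θ μ v
        + Kippenhahn.shiftedRe A θ μ w * Kippenhahn.shiftedRe A θ μ v
        + Kippenhahn.shiftedRe A θ μ w * Kippenhahn.shiftedRe A θ μ t := ⟨_, rfl⟩
    obtain ⟨b, hb⟩ : ∃ b, b =
        (A w w).re * Kippenhahn.shiftedRe A θ μ t * Kippenhahn.shiftedRe A θ μ v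
        + (A t t).re * Kippenhahn.shiftedRe A θ μ w * Kippenhahn.shiftedRe A θ μ v
        + (A v v).re * Kippenhahn.shiftedRe A θ μ t * Kippenhahn.shiftedRe A θ μ w
        - 2 * Kippenhahn.shiftedRe A θ μ w * Kippenhahn.shiftedRe A θ μ t
          * Kippenhahn.shiftedRe A θ μ v * Real.cos θ := ⟨_, rfl⟩
    obtain ⟨c, hc⟩ : ∃ c, c =
        (A w w).im * Kippenhahn.shiftedRe A θ μ t * Kippenhahn.shiftedRe A θ μ v
        + (A t t).im * Kippenhahn.shiftedRe A θ μ w * Kippenhahn.shiftedRe A θ μ v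
        + (A v v).im * Kippenhahn.shiftedRe A θ μ t * Kippenhahn.shiftedRe A θ μ w
        - 2 * Kippenhahn.shiftedRe A θ μ w * Kippenhahn.shiftedRe A θ μ t
          * Kippenhahn.shiftedRe A θ μ v * Real.sin θ := ⟨_, rfl⟩
    have hκ := Kippenhahn.focal_coeff_eq hb hc
    have hnd := List.nodup_iff_pairwise_ne.1 hpq
    simp only [List.pairwise_cons, List.mem_cons, List.not_mem_nil, or_false, forall_eq_or_imp,
      forall_eq] at hnd
    obtain ⟨-, -, ⟨hwt, hwv⟩, htv, -⟩ := hnd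
    obtain ⟨n₁, n₂, n₃⟩ := (Kippenhahn.focal_nondegenerate_iff ha hκ).1 ⟨h0,
      hi w t v (by simp) (by simp) (by simp) hwt htv hwv,
      hi t w v (by simp) (by simp) (by simp) hwt.symm hwv htv,
      hi v w t (by simp) (by simp) (by simp) hwv.symm hwt htv.symm⟩
    refine Kippenhahn.exists_union_of_focalCubic hr ha hb hc n₁ n₂ n₃
      ((Kippenhahn.kippenhahnPoly_eq_mul_iff hA hpq r a b c hκ).2
        ⟨?_, ?_, ?_, ?_, ?_, ?_, ?_⟩)
    · rw [ha]
      exact hA'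
    · refine Eq.trans ?_ hB'
      rw [ha]
      push_cast
      ring
    · refine Eq.trans ?_ hC'
      rw [ha]
      push_cast
      ring
    · refine Eq.trans ?_ hD'
      ring
    · refine Eq.trans ?_ hE'
      rw [hb]
      ring
    · refine Eq.trans ?_ hF'
      rw [hc]
      ring
    · refine Eq.trans ?_ hG'
      rw [hb, ha]
      ring
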